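/- **Theorem (Cramér–Rao-like inequality with cumulative moments).** Let $p\in[1,\infty]$ with Hölder conjugate $p^*$, $\frac1p+\frac1{p^*}=1$, and let $\lambda,\beta\in\mathbb R$ satisfy $\beta>\max\left(\lambda-1,\frac{1-\lambda}{p^*}\right)$ (with $\frac{1-\lambda}{\infty}=0$). Put $\alpha=1+\beta-\lambda>0$. For a probability density $f$ on $\mathbb R$ let $$\phi_{p,\beta}[f]=\left(\int_{\{f>0\}}\left|f^{\beta-2}f'\right|^p f\,dx\right)^{\frac1{p\beta}},\qquad \sigma_{q,\gamma}[f]=\left(\int_{\mathbb R}\left|\int_0^x f(t)^{1-\gamma}\mathbf 1_{\{f(t)>0\}}\,dt\right|^{q}f(x)\,dx\right)^{\frac1{q\gamma}},$$ with values in $[0,\infty]$; for $p=\infty$ (resp. $q=\infty$) the $L^p(f\,dx)$ norm of $f^{\beta-2}f'$ (resp. the $L^q(f\,dx)$ norm of the inner integral) is an essential supremum on $\{f>0\}$. "Continuously differentiable" means: continuous on $\mathbb R$ and $C^1$ on the open set $\{f>0\}$ (in particular every $C^1$ density on $\mathbb R$ qualifies). For $\kappa>0$ let $f_{(\kappa)}(x)=\kappa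 f(\kappa x)$. For $1<p\le\infty$ define, with $B$ the Beta function, $$a_{p,\ell}=\frac{p^*|1-\ell|^{1/p^*}}{2B\left(\frac1{p^*},\frac{\ell}{|1-\ell|}+\frac1p\mathbf 1_{\ell\le1}\right)}\ (\ell\ne1),\quad a_{p,1}=\frac{p^*}{2\Gamma(1/p^*)},\quad a_{p,\beta,\lambda}=a_{p,\beta/\alpha},\quad \kappa_{p,\beta,\lambda}=\left|\tfrac{\lambda-1}{\alpha}\right|^{1/p^*},$$ and the density $\rho=\rho_{p,\beta,\lambda}$, which is $0$ outside the stated set, by: * $\beta=\lambda\neq1$: $\rho(x)=a_{p,\lambda}\left(1-(\lambda-1)|x|^{p^*}\right)_+^{1/(\lambda-1)}$; $\beta=\lambda=1$: $\rho(x)=a_{p,1}e^{-|x|^{p^*}}$; * $\lambda=1\ne\beta$: $\rho(x)=a_{p,\beta,1}\exp\left(-\frac{\tau(x)}{|\beta-1|}\right)$, where $\tau(x)\ge0$ solves $\int_0^{\tau(x)}t^{\frac1{p^*}-1}e^{-\varepsilon t}\,dt=p^*\left|\frac{\beta-1}{\beta}\right|^{1/p^*}|x|$, $\varepsilon=\operatorname{sign}(\beta-1)$,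 for those $x$ for which a solution exists; * $\lambda<1$, $\lambda\ne\beta$: $\rho(x)=a_{p,\beta,\lambda}\left[\cosh_{v,p^*}(\kappa_{p,\beta,\lambda}x)\right]^{1/(\lambda-\beta)}$, $v=\frac{1-\lambda}{\beta-\lambda}$, where $\cosh_{v,w}=\sinh_{v,w}'$ and $\sinh_{v,w}$ is the inverse of $y\mapsto\int_0^y(1+|t|^w)^{-1/v}dt$ on $\mathbb R$, for $\kappa_{p,\beta,\lambda}x$ in the domain of $\sinh_{v,p^*}$; * $\lambda>1$, $\lambda\ne\beta$: $\rho(x)=a_{p,\beta,\lambda}\left[\cos_{v,p^*}(\kappa_{p,\beta,\lambda}x)\right]^{1/(\lambda-\beta)}$, $v=\frac{\lambda-1}{\lambda-\beta}$, where $\cos_{v,w}=\sin_{v,w}'$ and $\sin_{v,w}$ is the inverse of $y\mapsto\int_0^y(1-|t|^w)^{-1/v}dt$ on $(-1,1)$, for $\kappa_{p,\beta,\lambda}x$ in the domain of $\sin_{v,p^*}$. For $p=1$ let $\rho=\frac12\mathbf 1_{(-1,1)}$. Finally let $$K_{p,\beta,\lambda}=(p^*)^{\frac1\beta}\left(\frac{(1+\beta-\lambda)^{\frac{\lambda-1}{p^*}}\,a_{p,\beta,\lambda}^{\lambda-1}}{(p^*\beta+\lambda-1)^{\beta+\frac{1-\lambda}{p}}}\right)^{\frac1{\beta(1+\beta-\lambda)}}\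 (p>1),\qquad K_{1,\beta,\lambda}=\beta^{-\frac1\beta}\,2^{\frac{1-\lambda}{\beta(1+\beta-\lambda)}}$$ (the second being the limit of the first as $p\to1$). Then: 1. For every continuously differentiable probability density $f$, $\ \phi_{p,\beta}[f]\,\sigma_{p^*,1+\beta-\lambda}[f]\ge K_{p,\beta,\lambda}$. 2. If equality holds for such an $f$, then $f=\rho_{(\kappa)}$ for some $\kappa>0$. 3. $\rho$ is a probability density, and it is continuously differentiable if $1<p<\infty$. If $p>1$, then equality holds for $\rho_{(\kappa)}$ for every $\kappa>0$; in particular $K_{p,\beta,\lambda}=\phi_{p,\beta}[\rho]\,\sigma_{p^*,1+\beta-\lambda}[\rho]$. 4. If $p=1$ and $\phi_{1,\beta}[f]$ is read as $\left(\operatorname{TV}(f^\beta/\beta)\right)^{1/\beta}$ with $\operatorname{TV}$ the total variation on $\mathbb R$, then the inequality of 1 holds for every probability density $f$, equality implies that $f=\rho_{(\kappa)}$ almost everywhere for some $\kappa>0$, and equality holds for $\rho_{(\kappa)}$ for every $\kappa>0$. -/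

import Mathlib

open MeasureTheory Set
open scoped ENNReal

noncomputable section

namespace CumulativeCR

/-! ### Densities -/

/-- A probability density on the real line, with respect to Lebesgue measure. -/
structure IsDensity (f : ℝ → ℝ) : Prop where
  measurable : Measurable f
  nonneg : ∀ x, 0 ≤ f x
  lintegral_eq_one : ∫⁻ x, ENNReal.ofReal (f x) = 1

/-- A continuously differentiable probability density: it is continuous on the whole line and
continuously differentiable on its (open) support `{f > 0}`. Every density that is `C¹` on `ℝ`
is of this kind. -/
structure IsC1Density (f : ℝ → ℝ) : Prop extends IsDensity f where
  continuous : Continuous f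
  contDiffOn : ContDiffOn ℝ 1 f {x | 0 < f x}

/-- The measure `f(x) dx`. -/
def densityMeasure (f : ℝ → ℝ) : Measure ℝ :=
  volume.withDensity fun x => ENNReal.ofReal (f x)

/-- The rescaled density `x ↦ κ f(κ x)`. -/
def rescale (κ : ℝ) (f : ℝ → ℝ) : ℝ → ℝ := fun x => κ * f (κ * x)

/-! ### Informational quantities -/

/-- `φ_{p,β}[f] = F_{p,β}[f] ^ (1 / (p β))`, where
`F_{p,β}[f] = ∫ |f ^ (β - 2) f'| ^ p f` is the `(p, β)`-Fisher information. For `p = ∞` the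
`L^p(f dx)` norm is the essential supremum of `|f ^ (β - 2) f'|` on the support of `f`. -/
def fisherPhi (p : ℝ≥0∞) (β : ℝ) (f : ℝ → ℝ) : ℝ≥0∞ :=
  eLpNorm (fun x => f x ^ (β - 2) * deriv f x) p (densityMeasure f) ^ (1 / β)

/-- `φ_{1,β}[f]` for densities that need not be differentiable: the `(1, β)`-Fisher information
is the total variation of `f ^ β / β`. -/
def fisherPhiTV (β : ℝ) (f : ℝ → ℝ) : ℝ≥0∞ :=
  eVariationOn (fun x => f x ^ β / β) univ ^ (1 / β)

/-- `|∫_0^x f(t) ^ (1 - γ) dt|`, the integral being taken over the part of the interval between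
`0` and `x` that lies in the support of `f` (for `γ = 1` it is the length of that part). -/
def absCumul (γ : ℝ) (f : ℝ → ℝ) (x : ℝ) : ℝ≥0∞ :=
  ∫⁻ t in uIoc 0 x ∩ {t | 0 < f t}, ENNReal.ofReal (f t ^ (1 - γ))

/-- The cumulative deviation `σ_{q,γ}[f] = μ_{q,γ}[f] ^ (1 / (q γ))`, where
`μ_{q,γ}[f] = ∫ |∫_0^x f ^ (1 - γ)| ^ q f(x) dx`. For `q = ∞` the `L^q(f dx)` norm is the
essential supremum on the support of `f`. -/
def cumDev (q : ℝ≥0∞) (γ : ℝ) (f : ℝ → ℝ) : ℝ≥0∞ :=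
  eLpNorm (absCumul γ f) q (densityMeasure f) ^ (1 / γ)

/-- The Hölder conjugate `p*`, with `1/p + 1/p* = 1` (so `1* = ∞` and `∞* = 1`). -/
def dual (p : ℝ≥0∞) : ℝ≥0∞ := (1 - p⁻¹)⁻¹

/-! ### Generalized trigonometric functions -/

/-- `arcsin_{v,w}`, used on `(-1, 1)`. -/
def gArcsin (v w y : ℝ) : ℝ := ∫ t in (0 : ℝ)..y, (1 - |t| ^ w) ^ (-(1 / v))

/-- `arsinh_{v,w}`. -/
def gArsinh (v w y : ℝ) : ℝ := ∫ t in (0 : ℝ)..y, (1 + |t| ^ w) ^ (-(1 / v))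

/-- The main branch of `sin_{v,w}`, on `(-π_{v,w}/2, π_{v,w}/2)`, which is the image of
`(-1, 1)` under `arcsin_{v,w}`. -/
def gSin (v w : ℝ) : ℝ → ℝ := Function.invFunOn (gArcsin v w) (Ioo (-1) 1)

/-- `cos_{v,w}`, the derivative of `sin_{v,w}`. -/
def gCos (v w x : ℝ) : ℝ := deriv (gSin v w) x

/-- `sinh_{v,w}`, on the range of `arsinh_{v,w}`. -/
def gSinh (v w : ℝ) : ℝ → ℝ := Function.invFunOn (gArsinh v w) univ

/-- `cosh_{v,w}`, the derivative of `sinh_{v,w}`. -/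
def gCosh (v w x : ℝ) : ℝ := deriv (gSinh v w) x

/-! ### The minimizing densities

In this part `q = p*` is a real number, so that `1/p = 1 - 1/q`. -/

/-- The Tsallis exponential `exp_lam`. -/
def qExp (lam x : ℝ) : ℝ :=
  if lam = 1 then Real.exp x else (max 0 (1 + (1 - lam) * x)) ^ (1 / (1 - lam))

/-- The normalization constant `a_{p,lam}` of the stretched deformed Gaussian. -/
def normConst (q lam : ℝ) : ℝ :=
  if lam = 1 then q / (2 * Real.Gamma (1 / q))
  else q * |1 - lam| ^ (1 / q) /
    (2 * ProbabilityTheory.beta (1 / q) (lam / |1 - lam| + if lam ≤ 1 then 1 - 1 / q else 0))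

/-- The stretched deformed Gaussian `g_{p,lam}`. -/
def stretchedGaussian (q lam x : ℝ) : ℝ := normConst q lam * qExp (2 - lam) (-|x| ^ q)

/-- The constant `a_{p,β,lam} = a_{p, β / (1 + β - lam)}`. -/
def normConst₃ (q β lam : ℝ) : ℝ := normConst q (β / (1 + β - lam))

/-- The constant `κ_{p,β,lam}`. -/
def kappa (q β lam : ℝ) : ℝ := |(lam - 1) / (1 + β - lam)| ^ (1 / q)

open Classical in
/-- The generalized trigonometric density, extended by zero outside its support
(`lam ≠ 1`, `lam ≠ β`). -/
def trigDensity (q β lam y : ℝ) : ℝ :=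
  if lam < 1 then
    if kappa q β lam * y ∈ range (gArsinh ((1 - lam) / (β - lam)) q) then
      normConst₃ q β lam *
        gCosh ((1 - lam) / (β - lam)) q (kappa q β lam * y) ^ (1 / (lam - β))
    else 0
  else
    if kappa q β lam * y ∈ gArcsin ((lam - 1) / (lam - β)) q '' Ioo (-1) 1 then
      normConst₃ q β lam *
        gCos ((lam - 1) / (lam - β)) q (kappa q β lam * y) ^ (1 / (lam - β))
    else 0

/-- `∫_0^z t ^ (a - 1) exp (-ε t) dt`: the lower incomplete Gamma function for `ε = 1`, and its
continuation to negative arguments (up to a phase) for `ε = -1`. -/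
def incGamma (ε a z : ℝ) : ℝ := ∫ t in (0 : ℝ)..z, t ^ (a - 1) * Real.exp (-(ε * t))

open Classical in
/-- The density `𝔊_{p,β}` of the case `lam = 1`, `β ≠ 1`, extended by zero outside its support.
Here `|β / (β - 1)|` is the absolute value of the conjugate `β*` of `β`. -/
def gammaDensity (q β x : ℝ) : ℝ :=
  let ε : ℝ := if 1 < β then 1 else -1
  let z : ℝ := q / |β / (β - 1)| ^ (1 / q) * |x|
  if z ∈ incGamma ε (1 / q) '' Ici 0 then
    normConst₃ q β 1 *
      Real.exp (-(Function.invFunOn (incGamma ε (1 / q)) (Ici 0) z / |β - 1|))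
  else 0

/-- The minimizing density `ρ_{p,β,lam}`. For `p = 1` it is the uniform density (the limit of the
other cases). -/
def minDensity (p : ℝ≥0∞) (β lam : ℝ) : ℝ → ℝ :=
  if p = 1 then (Ioo (-1) 1).indicator fun _ => 1 / 2
  else if β = lam then stretchedGaussian (dual p).toReal lam
  else if lam = 1 then gammaDensity (dual p).toReal β
  else trigDensity (dual p).toReal β lam

/-! ### The bound -/

/-- The closed form of `K_{p,β,lam}`. For `p = 1` it is the limit of the other cases as `p → 1`;
note that `(p β + 1 - lam) / p = β + (1 - lam) (1 - 1 / p*)`. -/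
def bound (p : ℝ≥0∞) (β lam : ℝ) : ℝ :=
  if p = 1 then β ^ (-(1 / β)) * 2 ^ ((1 - lam) / (β * (1 + β - lam)))
  else
    let q : ℝ := (dual p).toReal
    q ^ (1 / β) *
      ((1 + β - lam) ^ ((lam - 1) / q) * normConst₃ q β lam ^ (lam - 1) /
        (q * β + lam - 1) ^ (β + (1 - lam) * (1 - 1 / q))) ^ (1 / (β * (1 + β - lam)))

end CumulativeCR

end

open CumulativeCR

namespace CumulativeCR

open ProbabilityTheory Filter
open scoped Topology

/-! Write `α = 1 + β - lam`, `b = β / α`, `q = p*`. For `p > 1` the proof is by mass transport to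
one reference density `G = stretchedGaussian q b`, which depends on `β` and `lam` only through `b`.
Let `X` and `Z` be the quantile functions of `f` and `G` on the unit interval. With `r = f(X)^α / (k
G(Z))`, the elementary inequality `1 + b ≤ r^b + b / r` gives pointwise, for every `k > 0`, `(1 + b)
k^b G(Z)^(b-1) ≤ f(X)^β / G(Z) + b k^(b+1) f(X)^(-α) G(Z)^b` (`transport_le`). The integral of the
left side is explicit, because `G^(b-1)` is affine in `|z|^q`.

Each term on the right is estimated by a tail integral and Fubini (`lintegral_tailIntegral_le`). In
the first, `f^β` is at most `β` times the integral of `|f^(β-1) f'|` over either half-line ending at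
the point. Taking the side on which `Z` lies and exchanging integrals along the monotone coupling
turns the weight `1/G` into `|Z|`, and Hölder's inequality leaves the Fisher norm times `‖Z‖_q`. In
the second term the densities change roles: `G^b` is bounded by tails of its own score, which is a
multiple of `|z|^(q-1)`; the exchange turns the weight `f^(-α)` into the cumulative integral of
`f^(1-α)`, and Hölder leaves the cumulative norm. The best `k` gives `sharpConst_le`.

In the equality case (`ae_eq_of_eq_sharpConst`), `f(X)^α = k G(Z)` almost everywhere, and equality
in the tail bound for `G` forces `X` and `Z` to have compatible signs. With `F` the distribution
function of `f`, the map `Z ∘ F` then solves a differential equation with separated variables, whose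
integral `escortMap` satisfies `escortMap (Z (F x)) = κ x`; so `f` is a rescaled image of `G`
(`eq_rescale_of_ae_eq`). That these images attain the bound is a change of variables
(`IsEscort.eq_sharpConst`), and `isEscort_minDensity` identifies them with the explicit formulas.

For `p = 1` the argument is direct. The Fisher information bounds the height of `f` by some `C`, and
the essential supremum `M` of the cumulative integral bounds the integral of `f^(1-α)` over each
half-line; hence `1 = ∫ f^α f^(1-α) ≤ C^α · 2M` (`ofReal_le_mul_of_sup_le`). Equality makes `f`
constant on its support, with equal masses on both sides of the origin, and minimal total variation
makes the set `{f = C}` an interval. -/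

/-! ### Monotone coupling -/

/-- Lebesgue measure on the unit interval. -/
noncomputable def unitMeasure : Measure ℝ := volume.restrict (Ioo 0 1)

instance : IsProbabilityMeasure unitMeasure := ⟨by simp [unitMeasure]⟩

/-- The quantile function of a probability measure on the line. -/
noncomputable def quantile (ν : Measure ℝ) (t : ℝ) : ℝ :=
  if t ∈ Ioo (0 : ℝ) 1 then sInf {x | t ≤ cdf ν x} else 0

/-- Right continuity of the distribution function makes the infimum attained. The monotonicity,
measurability and law of `quantile` all come from this Galois connection. -/
lemma quantile_le_iff (ν : Measure ℝ) {t : ℝ} (ht : t ∈ Ioo (0 : ℝ) 1)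
    (x : ℝ) : quantile ν t ≤ x ↔ t ≤ cdf ν x := by
  have hne : {x | t ≤ cdf ν x}.Nonempty :=
    ((tendsto_cdf_atTop ν).eventually_const_lt ht.2).exists.imp fun _ h => h.le
  have hbdd : BddBelow {x | t ≤ cdf ν x} := by
    obtain ⟨y, hy⟩ := ((tendsto_cdf_atBot ν).eventually_lt_const ht.1).exists
    exact ⟨y, fun x hx => le_of_not_gt fun hxy =>
      absurd (hx.trans (monotone_cdf ν hxy.le)) hy.not_ge⟩
  rw [quantile, if_pos ht]
  refine ⟨fun h => ?_, fun h => csInf_le hbdd h⟩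
  refine ge_of_tendsto (((cdf ν).right_continuous x).tendsto.mono_left
    (nhdsWithin_mono x Ioi_subset_Ici_self)) ?_
  filter_upwards [self_mem_nhdsWithin] with y hy
  obtain ⟨z, hz, hzy⟩ := (csInf_lt_iff hbdd hne).1 (h.trans_lt hy)
  exact hz.trans (monotone_cdf ν hzy.le)

lemma monotoneOn_quantile (ν : Measure ℝ) : MonotoneOn (quantile ν) (Ioo 0 1) :=
  fun _ hs _ ht hst => (quantile_le_iff ν hs _).2 (hst.trans ((quantile_le_iff ν ht _).1 le_rfl))

lemma measurable_quantile (ν : Measure ℝ) : Measurable (quantile ν) := by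
  refine measurable_of_Iic fun x => ?_
  have : quantile ν ⁻¹' Iic x =
      (Ioo 0 1 ∩ Iic (cdf ν x)) ∪ ((Ioo 0 1)ᶜ ∩ {_t | 0 ≤ x}) := by
    ext t
    by_cases ht : t ∈ Ioo (0 : ℝ) 1
    · simp only [mem_preimage, mem_Iic, quantile_le_iff ν ht, mem_union, mem_inter_iff, ht,
        mem_compl_iff, true_and, not_true, false_and, or_false]
    · simp [quantile, ht]
  rw [this]
  exact (measurableSet_Ioo.inter measurableSet_Iic).union
    (measurableSet_Ioo.compl.inter (MeasurableSet.const _))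

lemma map_quantile (ν : Measure ℝ) [IsProbabilityMeasure ν] :
    unitMeasure.map (quantile ν) = ν := by
  have : IsProbabilityMeasure (unitMeasure.map (quantile ν)) :=
    Measure.isProbabilityMeasure_map (measurable_quantile ν).aemeasurable
  refine Measure.ext_of_Iic _ _ fun x => ?_
  rw [Measure.map_apply (measurable_quantile ν) measurableSet_Iic, unitMeasure,
    Measure.restrict_apply (measurable_quantile ν measurableSet_Iic)]
  have h : quantile ν ⁻¹' Iic x ∩ Ioo 0 1 = Ioo 0 1 ∩ Iic (cdf ν x) := by
    ext t
    simp only [mem_inter_iff, mem_preimage, mem_Iic]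
    exact ⟨fun h => ⟨h.2, (quantile_le_iff ν h.2 x).1 h.1⟩,
      fun h => ⟨(quantile_le_iff ν h.1 x).2 h.2, h.1⟩⟩
  have h' : volume (Ioo 0 1 ∩ Iic (cdf ν x)) = volume (Ioc 0 (cdf ν x)) := by
    refine measure_congr ?_
    have : Ioo (0 : ℝ) 1 =ᵐ[volume] Ioc 0 1 := Ioo_ae_eq_Ioc
    refine (this.inter (ae_eq_refl _)).trans (ae_of_all _ fun t => ?_)
    have := cdf_le_one ν x
    apply propext
    change (t ∈ Ioc (0 : ℝ) 1 ∩ Iic (cdf ν x)) ↔ t ∈ Ioc 0 (cdf ν x)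
    simp only [mem_inter_iff, mem_Ioc, mem_Iic]
    exact ⟨fun h => ⟨h.1.1, h.2⟩, fun h => ⟨⟨h.1, h.2.trans this⟩, h.2⟩⟩
  rw [h, h', Real.volume_Ioc, sub_zero, ofReal_cdf]

/-- To the left of the quantile the distribution function is at most `t`; without atoms this bound
passes to the limit. -/
lemma cdf_quantile (ν : Measure ℝ) (hc : Continuous (cdf ν)) {t : ℝ} (ht : t ∈ Ioo (0 : ℝ) 1) :
    cdf ν (quantile ν t) = t := by
  refine le_antisymm ?_ ((quantile_le_iff ν ht _).1 le_rfl)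
  refine le_of_tendsto (x := 𝓝[<] quantile ν t)
    (hc.continuousAt.tendsto.mono_left nhdsWithin_le_nhds) ?_
  filter_upwards [self_mem_nhdsWithin] with y hy
  exact le_of_not_gt fun h => absurd ((quantile_le_iff ν ht y).2 h.le) (not_le.2 hy)

lemma lintegral_quantile (ν : Measure ℝ) [IsProbabilityMeasure ν] {g : ℝ → ℝ≥0∞}
    (hg : Measurable g) : ∫⁻ t, g (quantile ν t) ∂unitMeasure = ∫⁻ x, g x ∂ν := by
  conv_rhs => rw [← map_quantile ν]
  rw [lintegral_map hg (measurable_quantile ν)]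

lemma setLIntegral_quantile (ν : Measure ℝ) [IsProbabilityMeasure ν] {g : ℝ → ℝ≥0∞}
    (hg : Measurable g) {s : Set ℝ} (hs : MeasurableSet s) :
    ∫⁻ t in quantile ν ⁻¹' s, g (quantile ν t) ∂unitMeasure = ∫⁻ x in s, g x ∂ν := by
  conv_rhs => rw [← map_quantile ν]
  rw [setLIntegral_map hs hg (measurable_quantile ν)]

lemma ae_unitMeasure_mem : ∀ᵐ t ∂unitMeasure, t ∈ Ioo (0 : ℝ) 1 :=
  ae_restrict_mem measurableSet_Ioo

/-- The integral of `D` over the part of the line beyond `x`, on the side given by the sign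
of `z`. -/
noncomputable def tailIntegral (ν : Measure ℝ) (D : ℝ → ℝ≥0∞) (z x : ℝ) : ℝ≥0∞ :=
  if 0 < z then ∫⁻ y in Ioi x, D y ∂ν else ∫⁻ y in Iio x, D y ∂ν

/-- Fubini for two measures that are coupled monotonically. -/
lemma lintegral_tailIntegral_le (ν γ : Measure ℝ) [IsProbabilityMeasure ν]
    [IsProbabilityMeasure γ] {D w : ℝ → ℝ≥0∞} (hD : Measurable D) (hw : Measurable w) :
    ∫⁻ t, w (quantile γ t) * tailIntegral ν D (quantile γ t) (quantile ν t) ∂unitMeasure ≤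
      ∫⁻ s, D (quantile ν s) * ∫⁻ z in uIcc 0 (quantile γ s), w z ∂γ ∂unitMeasure := by
  set X := quantile ν
  set Z := quantile γ
  have hX : Measurable X := measurable_quantile ν
  have hZ : Measurable Z := measurable_quantile γ
  -- Monotonicity of `X` makes `X t < X s` imply `t < s`, so replacing the tail beyond `X t` by the
  -- section of `r` at `t` can only increase the integral.
  let r : Set (ℝ × ℝ) := {p | (0 < Z p.1 ∧ p.1 < p.2) ∨ (Z p.1 ≤ 0 ∧ p.2 < p.1)}
  have hr : MeasurableSet r := by
    refine ((measurableSet_lt measurable_const (hZ.comp measurable_fst)).inter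
      (measurableSet_lt measurable_fst measurable_snd)).union
      ((measurableSet_le (hZ.comp measurable_fst) measurable_const).inter
      (measurableSet_lt measurable_snd measurable_fst))
  let k : ℝ → ℝ → ℝ≥0∞ := fun t s => r.indicator (fun p => w (Z p.1) * D (X p.2)) (t, s)
  have hk : Measurable (Function.uncurry k) :=
    ((hw.comp (hZ.comp measurable_fst)).mul (hD.comp (hX.comp measurable_snd))).indicator hr
  calc
    _ ≤ ∫⁻ t, ∫⁻ s, k t s ∂unitMeasure ∂unitMeasure := by
      refine lintegral_mono_ae ?_
      filter_upwards [ae_unitMeasure_mem] with t ht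
      have key : tailIntegral ν D (Z t) (X t) ≤
          ∫⁻ s, {s | (t, s) ∈ r}.indicator (fun s => D (X s)) s ∂unitMeasure := by
        rw [lintegral_indicator (s := {s | (t, s) ∈ r}) (measurable_prodMk_left hr),
          tailIntegral]
        split_ifs with h
        · rw [← setLIntegral_quantile ν hD measurableSet_Ioi]
          refine lintegral_mono' (Measure.restrict_mono' ?_ le_rfl) le_rfl
          filter_upwards [ae_unitMeasure_mem] with s hs hXs
          refine Or.inl ⟨h, lt_of_not_ge fun hst => ?_⟩
          exact absurd (monotoneOn_quantile ν hs ht hst) (not_le.2 hXs)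
        · rw [← setLIntegral_quantile ν hD measurableSet_Iio]
          refine lintegral_mono' (Measure.restrict_mono' ?_ le_rfl) le_rfl
          filter_upwards [ae_unitMeasure_mem] with s hs hXs
          refine Or.inr ⟨not_lt.1 h, lt_of_not_ge fun hst => ?_⟩
          exact absurd (monotoneOn_quantile ν ht hs hst) (not_le.2 hXs)
      calc w (Z t) * tailIntegral ν D (Z t) (X t)
          ≤ w (Z t) * ∫⁻ s, {s | (t, s) ∈ r}.indicator (fun s => D (X s)) s ∂unitMeasure := by
            gcongr
        _ = ∫⁻ s, w (Z t) * {s | (t, s) ∈ r}.indicator (fun s => D (X s)) s ∂unitMeasure := by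
            rw [lintegral_const_mul]
            exact Measurable.indicator (s := {s | (t, s) ∈ r}) (hD.comp hX)
              (measurable_prodMk_left hr)
        _ = _ := by
            refine lintegral_congr fun s => ?_
            by_cases h : (t, s) ∈ r <;> simp [k, h]
    _ = ∫⁻ s, ∫⁻ t, k t s ∂unitMeasure ∂unitMeasure := lintegral_lintegral_swap hk.aemeasurable
    _ ≤ _ := by
      refine lintegral_mono_ae ?_
      filter_upwards [ae_unitMeasure_mem] with s hs
      rw [← setLIntegral_quantile γ hw measurableSet_uIcc,
        ← lintegral_indicator (hZ measurableSet_uIcc), ← lintegral_const_mul _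
          (Measurable.indicator (f := fun t => w (quantile γ t)) (hw.comp hZ)
            (hZ measurableSet_uIcc))]
      refine lintegral_mono_ae ?_
      filter_upwards [ae_unitMeasure_mem] with t ht
      by_cases h : (t, s) ∈ r
      -- On `r`, monotonicity of `Z` gives `0 < Z t ≤ Z s` or `Z s ≤ Z t ≤ 0`.
      · have hmem : t ∈ Z ⁻¹' uIcc 0 (Z s) := by
          rcases h with ⟨h0, hts⟩ | ⟨h0, hts⟩
          · exact mem_uIcc.2 (Or.inl ⟨h0.le, monotoneOn_quantile γ ht hs hts.le⟩)
          · exact mem_uIcc.2 (Or.inr ⟨monotoneOn_quantile γ hs ht hts.le, h0⟩)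
        simp only [k, h, indicator_of_mem, hmem]
        rw [mul_comm]
      · simp [k, h]

/-! ### Inverse functions -/

lemma image_mem_nhds_of_strictMonoOn {g : ℝ → ℝ} {s : Set ℝ} (hs : IsOpen s)
    (hc : s.OrdConnected) (hg : StrictMonoOn g s) (hcont : ContinuousOn g s) {z : ℝ}
    (hz : z ∈ s) : g '' s ∈ 𝓝 (g z) := by
  obtain ⟨ε, hε, hb⟩ := Metric.isOpen_iff.1 hs z hz
  have h1 : z - ε / 2 ∈ s := hb (by simp [abs_of_pos hε, hε])
  have h2 : z + ε / 2 ∈ s := hb (by simp [abs_of_pos hε, hε])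
  have hsub : Icc (z - ε / 2) (z + ε / 2) ⊆ s := hc.out h1 h2
  refine mem_of_superset (Icc_mem_nhds (hg h1 hz (by linarith)) (hg hz h2 (by linarith))) ?_
  exact (intermediate_value_Icc (by linarith) (hcont.mono hsub)).trans (image_mono hsub)

lemma isOpen_image_of_strictMonoOn {g : ℝ → ℝ} {s : Set ℝ} (hs : IsOpen s)
    (hc : s.OrdConnected) (hg : StrictMonoOn g s) (hcont : ContinuousOn g s) :
    IsOpen (g '' s) := by
  rw [isOpen_iff_mem_nhds]
  rintro _ ⟨z, hz, rfl⟩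
  exact image_mem_nhds_of_strictMonoOn hs hc hg hcont hz

lemma invFunOn_image_eq {g : ℝ → ℝ} {s : Set ℝ} (hg : StrictMonoOn g s) {z : ℝ} (hz : z ∈ s) :
    Function.invFunOn g s (g z) = z :=
  hg.injOn.leftInvOn_invFunOn hz

lemma continuousAt_invFunOn {g : ℝ → ℝ} {s : Set ℝ} (hs : IsOpen s)
    (hc : s.OrdConnected) (hg : StrictMonoOn g s) (hcont : ContinuousOn g s) {z : ℝ}
    (hz : z ∈ s) : ContinuousAt (Function.invFunOn g s) (g z) := by
  refine continuousAt_of_monotoneOn_of_image_mem_nhds (s := g '' s) ?_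
    (image_mem_nhds_of_strictMonoOn hs hc hg hcont hz) ?_
  · rintro _ ⟨a, ha, rfl⟩ _ ⟨b, hb, rfl⟩ hab
    rw [invFunOn_image_eq hg ha, invFunOn_image_eq hg hb]
    exact (hg.le_iff_le ha hb).1 hab
  · rw [hg.injOn.invFunOn_image Subset.rfl, invFunOn_image_eq hg hz]
    exact hs.mem_nhds hz

lemma hasDerivAt_invFunOn {g : ℝ → ℝ} {s : Set ℝ} (hs : IsOpen s)
    (hc : s.OrdConnected) (hg : StrictMonoOn g s) (hcont : ContinuousOn g s) {z g' : ℝ}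
    (hz : z ∈ s) (hd : HasDerivAt g g' z) (hg' : g' ≠ 0) :
    HasDerivAt (Function.invFunOn g s) g'⁻¹ (g z) := by
  refine HasDerivAt.of_local_left_inverse (f := g) (continuousAt_invFunOn hs hc hg hcont hz)
    ((invFunOn_image_eq hg hz).symm ▸ hd) hg' ?_
  filter_upwards [image_mem_nhds_of_strictMonoOn hs hc hg hcont hz] with y hy
  exact Function.invFunOn_eq hy

lemma strictMonoOn_of_hasDerivAt_pos {g g' : ℝ → ℝ} {s : Set ℝ} (hs : IsOpen s)
    (hc : s.OrdConnected) (hd : ∀ z ∈ s, HasDerivAt g (g' z) z) (hpos : ∀ z ∈ s, 0 < g' z) :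
    StrictMonoOn g s := by
  refine strictMonoOn_of_deriv_pos hc.convex
    (fun z hz => (hd z hz).continuousAt.continuousWithinAt) fun z hz => ?_
  rw [hs.interior_eq] at hz
  rw [(hd z hz).deriv]
  exact hpos z hz

/-! ### Densities -/

lemma IsDensity.measurable_ofReal {f : ℝ → ℝ} (hf : IsDensity f) :
    Measurable fun x => ENNReal.ofReal (f x) := hf.measurable.ennreal_ofReal

lemma IsDensity.isProbabilityMeasure {f : ℝ → ℝ} (hf : IsDensity f) :
    IsProbabilityMeasure (densityMeasure f) :=
  ⟨by rw [densityMeasure, withDensity_apply _ MeasurableSet.univ, setLIntegral_univ,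
    hf.lintegral_eq_one]⟩

lemma IsDensity.lintegral_densityMeasure {f : ℝ → ℝ} (hf : IsDensity f) (g : ℝ → ℝ≥0∞) :
    ∫⁻ x, g x ∂densityMeasure f = ∫⁻ x, ENNReal.ofReal (f x) * g x := by
  rw [densityMeasure, lintegral_withDensity_eq_lintegral_mul_non_measurable _ hf.measurable_ofReal
    (ae_of_all _ fun _ => ENNReal.ofReal_lt_top)]
  rfl

lemma IsDensity.setLIntegral_densityMeasure {f : ℝ → ℝ} (hf : IsDensity f) (g : ℝ → ℝ≥0∞)
    {s : Set ℝ} (hs : MeasurableSet s) :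
    ∫⁻ x in s, g x ∂densityMeasure f = ∫⁻ x in s, ENNReal.ofReal (f x) * g x := by
  rw [densityMeasure, setLIntegral_withDensity_eq_setLIntegral_mul_non_measurable _
    hf.measurable_ofReal _ hs (ae_of_all _ fun _ => ENNReal.ofReal_lt_top)]
  rfl

lemma IsDensity.ae_pos {f : ℝ → ℝ} (hf : IsDensity f) : ∀ᵐ x ∂densityMeasure f, 0 < f x := by
  rw [densityMeasure, ae_withDensity_iff hf.measurable_ofReal]
  exact ae_of_all _ fun x hx => ENNReal.ofReal_pos.1 (pos_iff_ne_zero.2 hx)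

lemma IsDensity.ae_densityMeasure_iff {f : ℝ → ℝ} (hf : IsDensity f) {P : ℝ → Prop} :
    (∀ᵐ x ∂densityMeasure f, P x) ↔ ∀ᵐ x, 0 < f x → P x := by
  rw [densityMeasure, ae_withDensity_iff hf.measurable_ofReal]
  simp only [ne_eq, ENNReal.ofReal_eq_zero, not_le]

lemma IsDensity.comp_neg {f : ℝ → ℝ} (hf : IsDensity f) : IsDensity fun x => f (-x) where
  measurable := hf.measurable.comp measurable_neg
  nonneg x := hf.nonneg _
  lintegral_eq_one := by
    rw [← hf.lintegral_eq_one]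
    exact lintegral_neg_eq_self (fun x => ENNReal.ofReal (f x))

/-- Otherwise the mass of the half-line would be infinite. This replaces decay at infinity, which a
density need not have. -/
lemma IsDensity.exists_gt_le {f : ℝ → ℝ} (hf : IsDensity f) (x : ℝ) {δ : ℝ} (hδ : 0 < δ) :
    ∃ y > x, f y ≤ δ := by
  by_contra! h
  have h1 : ∫⁻ y in Ioi x, ENNReal.ofReal δ ≤ 1 := by
    rw [← hf.lintegral_eq_one]
    refine (setLIntegral_mono hf.measurable_ofReal fun y hy =>
      ENNReal.ofReal_le_ofReal (h y hy).le).trans (setLIntegral_le_lintegral _ _)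
  rw [setLIntegral_const, Real.volume_Ioi, ENNReal.mul_top (by simpa using hδ)] at h1
  exact absurd h1 (by simp)

lemma setLIntegral_Iio_eq (g : ℝ → ℝ≥0∞) (x : ℝ) :
    ∫⁻ y in Iio x, g y = ∫⁻ y in Ioi (-x), g (-y) := by
  rw [← lintegral_indicator measurableSet_Iio, ← lintegral_indicator measurableSet_Ioi,
    ← lintegral_neg_eq_self]
  refine lintegral_congr fun y => ?_
  simp only [indicator, mem_Iio, mem_Ioi, neg_lt]

/-- The integrand of the Fisher information. -/
noncomputable def score (β : ℝ) (f : ℝ → ℝ) (x : ℝ) : ℝ≥0∞ := ‖f x ^ (β - 2) * deriv f x‖ₑ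

lemma measurable_score {f : ℝ → ℝ} (hf : Measurable f) (β : ℝ) : Measurable (score β f) :=
  ((hf.pow_const _).mul (measurable_deriv f)).enorm

lemma ofReal_mul_score {f : ℝ → ℝ} {x : ℝ} (hx : 0 < f x) (β : ℝ) :
    ENNReal.ofReal (f x) * score β f x = ‖f x ^ (β - 1) * deriv f x‖ₑ := by
  rw [score, ← Real.enorm_of_nonneg hx.le, ← enorm_mul, ← mul_assoc,
    show β - 1 = 1 + (β - 2) by ring, Real.rpow_add hx, Real.rpow_one]

/-- The fundamental theorem of calculus for `f^β`, from `x` to the first point where `f` has dropped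
to `δ`; then `δ → 0`. Stopping there keeps `f` positive, so that differentiability on the support
suffices. The countable set `C` is for the kink of the stretched Gaussian at the origin when `q =
1`. -/
lemma IsDensity.rpow_le_setLIntegral_Ioi {f : ℝ → ℝ} (hf : IsDensity f) (hc : Continuous f)
    {C : Set ℝ} (hC : C.Countable) (hd : ∀ x, 0 < f x → x ∉ C → DifferentiableAt ℝ f x) {β : ℝ}
    (hβ : 0 < β) (x : ℝ) :
    ENNReal.ofReal (f x ^ β) ≤
      ENNReal.ofReal β * ∫⁻ y in Ioi x, score β f y ∂densityMeasure f := by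
  rcases (hf.nonneg x).eq_or_lt with h0 | h0
  · simp [← h0, Real.zero_rpow hβ.ne']
  rw [hf.setLIntegral_densityMeasure _ measurableSet_Ioi]
  set I := ∫⁻ y in Ioi x, ENNReal.ofReal (f y) * score β f y with hI
  by_cases hItop : I = ∞
  · rw [hItop, ENNReal.mul_top (by simpa using hβ)]
    exact le_top
  have key : ∀ δ ∈ Ioo 0 (f x), f x ^ β ≤ β * I.toReal + δ ^ β := by
    intro δ hδ
    let s := {y | x ≤ y ∧ f y ≤ δ}
    have hs : IsClosed s := isClosed_Ici.inter (isClosed_le hc continuous_const)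
    have hne : s.Nonempty := by
      obtain ⟨y, hy, hy'⟩ := hf.exists_gt_le x hδ.1
      exact ⟨y, hy.le, hy'⟩
    have hbdd : BddBelow s := ⟨x, fun y hy => hy.1⟩
    set y := sInf s
    have hy : y ∈ s := hs.csInf_mem hne hbdd
    have hxy : x < y := lt_of_le_of_ne hy.1 fun h => absurd hy.2 (by rw [← h]; exact not_le.2 hδ.2)
    have hlow : ∀ z ∈ Ico x y, δ < f z := fun z hz => lt_of_not_ge fun h =>
      absurd (csInf_le hbdd ⟨hz.1, h⟩) (not_le.2 hz.2)
    have hlow' : ∀ z ∈ Icc x y, δ ≤ f z := by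
      have : closure (Ico x y) ⊆ {z | δ ≤ f z} :=
        closure_minimal (fun z hz => (hlow z hz).le) (isClosed_le continuous_const hc)
      rwa [closure_Ico hxy.ne] at this
    have hpos : ∀ z ∈ Icc x y, 0 < f z := fun z hz => hδ.1.trans_le (hlow' z hz)
    have hmeas : Measurable fun z => f z ^ (β - 1) * deriv f z :=
      (hf.measurable.pow_const _).mul (measurable_deriv f)
    have hle : ∫⁻ z in Ioc x y, ‖f z ^ (β - 1) * deriv f z‖ₑ ≤ I := by
      rw [hI]
      refine le_trans (le_of_eq ?_) (lintegral_mono_set (show Ioc x y ⊆ Ioi x from fun z hz => hz.1))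
      exact setLIntegral_congr_fun measurableSet_Ioc fun z hz =>
        (ofReal_mul_score (hpos z (Ioc_subset_Icc_self hz)) β).symm
    have hint : IntegrableOn (fun z => f z ^ (β - 1) * deriv f z) (Ioc x y) :=
      ⟨hmeas.aestronglyMeasurable, hle.trans_lt (lt_top_iff_ne_top.2 hItop)⟩
    have hFTC := integral_eq_of_hasDerivAt_off_countable_of_le (fun z => f z ^ β)
      (fun z => β * (f z ^ (β - 1) * deriv f z)) hxy.le hC
      (hc.continuousOn.rpow_const fun z _ => Or.inr hβ.le) (fun z hz => by
        have hz0 := hpos z (Ioo_subset_Icc_self hz.1)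
        exact ((hd z hz0 hz.2).hasDerivAt.rpow_const (p := β) (Or.inl hz0.ne')).congr_deriv
          (by ring))
      ((intervalIntegrable_iff_integrableOn_Ioc_of_le hxy.le).2 (hint.const_mul β))
    rw [intervalIntegral.integral_const_mul, intervalIntegral.integral_of_le hxy.le] at hFTC
    have habs : |∫ z in Ioc x y, f z ^ (β - 1) * deriv f z| ≤ I.toReal := by
      rw [← Real.norm_eq_abs]
      refine (norm_integral_le_lintegral_norm _).trans (ENNReal.toReal_mono hItop ?_)
      simpa only [ofReal_norm] using hle
    have h1 : f y ^ β ≤ δ ^ β := Real.rpow_le_rpow (hpos y ⟨hxy.le, le_rfl⟩).le hy.2 hβ.le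
    have h2 := mul_le_mul_of_nonneg_left (abs_le.1 habs).1 hβ.le
    linarith
  have hlim : Tendsto (fun δ : ℝ => β * I.toReal + δ ^ β) (𝓝[>] 0) (𝓝 (β * I.toReal + 0 ^ β)) :=
    tendsto_const_nhds.add ((Real.continuousAt_rpow_const 0 β (Or.inr hβ.le)).tendsto.mono_left
      nhdsWithin_le_nhds)
  have h3 : f x ^ β ≤ β * I.toReal + 0 ^ β :=
    ge_of_tendsto hlim (by filter_upwards [Ioo_mem_nhdsGT h0] with δ hδ using key δ hδ)
  rw [Real.zero_rpow hβ.ne', add_zero] at h3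
  rw [← ENNReal.ofReal_toReal hItop, ← ENNReal.ofReal_mul hβ.le]
  exact ENNReal.ofReal_le_ofReal h3

lemma score_comp_neg (β : ℝ) (f : ℝ → ℝ) (x : ℝ) :
    score β (fun x => f (-x)) x = score β f (-x) := by
  rw [score, score, deriv_comp_neg, mul_neg, enorm_neg]

lemma IsDensity.rpow_le_setLIntegral_Iio {f : ℝ → ℝ} (hf : IsDensity f) (hc : Continuous f)
    {C : Set ℝ} (hC : C.Countable) (hd : ∀ x, 0 < f x → x ∉ C → DifferentiableAt ℝ f x) {β : ℝ}
    (hβ : 0 < β) (x : ℝ) :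
    ENNReal.ofReal (f x ^ β) ≤
      ENNReal.ofReal β * ∫⁻ y in Iio x, score β f y ∂densityMeasure f := by
  have := hf.comp_neg.rpow_le_setLIntegral_Ioi (hc.comp continuous_neg) (C := -C)
    (hC.preimage neg_injective) (fun x hx hxC => ?_) hβ (-x)
  · rw [hf.comp_neg.setLIntegral_densityMeasure _ measurableSet_Ioi] at this
    rw [hf.setLIntegral_densityMeasure _ measurableSet_Iio, setLIntegral_Iio_eq]
    simpa only [neg_neg, score_comp_neg] using this
  · exact (hd _ hx (by simpa using hxC)).comp x differentiableAt_id.neg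

/-! ### The profile of the stretched deformed Gaussian -/

/-- The stretched deformed Gaussian, not normalized. -/
noncomputable def profile (q b z : ℝ) : ℝ := qExp (2 - b) (-|z| ^ q)

/-- The power `profile ^ (b - 1)`, extended beyond the support. -/
noncomputable def profileBase (q b z : ℝ) : ℝ := 1 - (b - 1) * |z| ^ q

/-- The support of the profile. -/
def profileSupport (q b : ℝ) : Set ℝ := {z | 0 < profileBase q b z}

section Profile

variable {q b : ℝ}

lemma continuous_profileBase (hq : 0 < q) : Continuous (profileBase q b) :=
  continuous_const.sub (continuous_const.mul
    (continuous_abs.rpow_const fun _ => Or.inr hq.le))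

lemma isOpen_profileSupport (hq : 0 < q) : IsOpen (profileSupport q b) :=
  isOpen_lt continuous_const (continuous_profileBase hq)

lemma zero_mem_profileSupport (hq : 0 < q) : (0 : ℝ) ∈ profileSupport q b := by
  simp [profileSupport, profileBase, Real.zero_rpow hq.ne']

lemma profile_neg (z : ℝ) : profile q b (-z) = profile q b z := by simp [profile]

lemma one_le_profileBase (hb : b ≤ 1) (z : ℝ) : 1 ≤ profileBase q b z := by
  have : 0 ≤ |z| ^ q := by positivity
  unfold profileBase
  nlinarith

lemma profileSupport_eq_univ (hb : b ≤ 1) : profileSupport q b = univ :=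
  eq_univ_of_forall fun z => zero_lt_one.trans_le (one_le_profileBase hb z)

lemma mem_profileSupport_of_abs_le (hq : 0 < q) {x z : ℝ} (hx : x ∈ profileSupport q b)
    (h : |z| ≤ |x|) : z ∈ profileSupport q b := by
  rcases le_or_gt b 1 with hb | hb
  · rw [profileSupport_eq_univ hb]; trivial
  · have h1 : |z| ^ q ≤ |x| ^ q := Real.rpow_le_rpow (abs_nonneg _) h hq.le
    have h2 : 0 < 1 - (b - 1) * |x| ^ q := hx
    change 0 < 1 - (b - 1) * |z| ^ q
    nlinarith

lemma ordConnected_profileSupport (hq : 0 < q) : (profileSupport q b).OrdConnected := by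
  refine ⟨fun x hx y hy z hz => ?_⟩
  rcases le_max_iff.1 (abs_le_max_abs_abs hz.1 hz.2) with h | h
  · exact mem_profileSupport_of_abs_le hq hx h
  · exact mem_profileSupport_of_abs_le hq hy h

lemma uIcc_subset_profileSupport (hq : 0 < q) {z : ℝ} (hz : z ∈ profileSupport q b) :
    uIcc 0 z ⊆ profileSupport q b :=
  (ordConnected_profileSupport hq).uIcc_subset (zero_mem_profileSupport hq) hz

lemma profile_one (z : ℝ) : profile q 1 z = Real.exp (-|z| ^ q) := by
  rw [profile, qExp, if_pos (by norm_num)]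

lemma profile_of_ne (hb : b ≠ 1) (z : ℝ) :
    profile q b z = max 0 (profileBase q b z) ^ (1 / (b - 1)) := by
  have h : 2 - b ≠ 1 := fun h => hb (by linarith)
  rw [profile, qExp, if_neg h, profileBase]
  ring_nf

lemma profile_of_mem (hb : b ≠ 1) {z : ℝ} (hz : z ∈ profileSupport q b) :
    profile q b z = profileBase q b z ^ (1 / (b - 1)) := by
  rw [profile_of_ne hb, max_eq_right (le_of_lt hz)]

lemma profile_pos {z : ℝ} (hz : z ∈ profileSupport q b) : 0 < profile q b z := by
  by_cases hb : b = 1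
  · rw [hb, profile_one]; exact Real.exp_pos _
  · rw [profile_of_mem hb hz]; exact Real.rpow_pos_of_pos hz _

lemma profile_eq_zero {z : ℝ} (hz : z ∉ profileSupport q b) : profile q b z = 0 := by
  have hb : b ≠ 1 := fun hb => hz (by rw [profileSupport_eq_univ hb.le]; trivial)
  have h0 : profileBase q b z ≤ 0 := not_lt.1 hz
  rw [profile_of_ne hb, max_eq_left h0, Real.zero_rpow]
  exact one_div_ne_zero (sub_ne_zero.2 hb)

lemma profile_nonneg (z : ℝ) : 0 ≤ profile q b z := by
  by_cases hz : z ∈ profileSupport q b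
  · exact (profile_pos hz).le
  · exact (profile_eq_zero hz).ge

lemma profile_pos_iff {z : ℝ} : 0 < profile q b z ↔ z ∈ profileSupport q b :=
  ⟨fun h => by_contra fun hz => h.ne' (profile_eq_zero hz), profile_pos⟩

lemma continuous_profile (hq : 0 < q) : Continuous (profile q b) := by
  by_cases hb : b = 1
  · rw [hb, funext profile_one]
    exact Real.continuous_exp.comp (continuous_abs.rpow_const fun _ => Or.inr hq.le).neg
  · rw [funext (profile_of_ne hb)]
    refine (continuous_const.max (continuous_profileBase hq)).rpow_const fun z => ?_
    rcases lt_or_gt_of_ne hb with h | h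
    · exact Or.inl (zero_lt_one.trans_le ((one_le_profileBase h.le z).trans (le_max_right _ _))).ne'
    · exact Or.inr (one_div_pos.2 (sub_pos.2 h)).le

/-- The algebraic fact that makes `∫ G^b` computable: this power is affine in `|z|^q`, also for `b =
1`, where both sides are `1`. -/
lemma profile_rpow_sub_one {z : ℝ} (hz : z ∈ profileSupport q b) :
    profile q b z ^ (b - 1) = profileBase q b z := by
  by_cases hb : b = 1
  · simp [hb, profileBase]
  · rw [profile_of_mem hb hz, ← Real.rpow_mul (le_of_lt hz),
      one_div_mul_cancel (sub_ne_zero.2 hb), Real.rpow_one]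

lemma hasDerivAt_abs_rpow_of_ne {z : ℝ} (hz : z ≠ 0) :
    HasDerivAt (fun x : ℝ => |x| ^ q) (q * |z| ^ (q - 2) * z) z := by
  refine ((hasDerivAt_abs hz).rpow_const (p := q) (Or.inl (abs_ne_zero.2 hz))).congr_deriv ?_
  have h : |z| ^ (q - 1) = |z| ^ (q - 2) * |z| := by
    rw [← Real.rpow_add_one (abs_ne_zero.2 hz)]; ring_nf
  have h' : ((SignType.sign z : SignType) : ℝ) * |z| = z := sign_mul_abs z
  rw [h]
  linear_combination q * |z| ^ (q - 2) * h'

/-- The differential equation `y' = -y^(2-b) (|z|^q)'` has the same form for all `b`, including the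
exponential case. Only for `q = 1` must the origin be avoided. -/
lemma hasDerivAt_profile {z : ℝ} (hz : z ∈ profileSupport q b) (h : 1 < q ∨ z ≠ 0) :
    HasDerivAt (profile q b) (-(profile q b z ^ (2 - b) * (q * |z| ^ (q - 2) * z))) z := by
  have habs : HasDerivAt (fun x : ℝ => |x| ^ q) (q * |z| ^ (q - 2) * z) z :=
    h.elim (fun h => hasDerivAt_abs_rpow z h) hasDerivAt_abs_rpow_of_ne
  by_cases hb : b = 1
  · subst hb
    rw [funext profile_one]
    refine habs.neg.exp.congr_deriv ?_
    norm_num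
  · have h1 : HasDerivAt (profileBase q b) (-((b - 1) * (q * |z| ^ (q - 2) * z))) z :=
      (habs.const_mul (b - 1)).const_sub 1
    have h2 : HasDerivAt (fun x => max 0 (profileBase q b x))
        (-((b - 1) * (q * |z| ^ (q - 2) * z))) z := by
      refine h1.congr_of_eventuallyEq ?_
      filter_upwards [h1.continuousAt.eventually_const_lt (show 0 < profileBase q b z from hz)]
        with x hx using max_eq_right hx.le
    have h0 : max 0 (profileBase q b z) = profileBase q b z := max_eq_right (le_of_lt hz)
    rw [funext (profile_of_ne hb)]
    refine (h2.rpow_const (p := 1 / (b - 1)) (Or.inl (by rw [h0]; exact ne_of_gt hz))).congr_deriv ?_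
    beta_reduce
    rw [h0, ← Real.rpow_mul (le_of_lt hz)]
    have hb' := sub_ne_zero.2 hb
    have he : 1 / (b - 1) * (2 - b) = 1 / (b - 1) - 1 := by field_simp; ring
    rw [he]
    field_simp

/-! ### Its moments -/

/-- Read off from the normalization of the Beta distribution. -/
lemma lintegral_beta {x y : ℝ} (hx : 0 < x) (hy : 0 < y) :
    ∫⁻ t in Ioo (0 : ℝ) 1, ENNReal.ofReal (t ^ (x - 1) * (1 - t) ^ (y - 1)) =
      ENNReal.ofReal (beta x y) := by
  have hpos := beta_pos hx hy
  have h := lintegral_betaPDF_eq_one hx hy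
  rw [lintegral_betaPDF] at h
  simp_rw [mul_assoc] at h
  simp_rw [ENNReal.ofReal_mul (one_div_pos.2 hpos).le] at h
  rw [lintegral_const_mul' _ _ ENNReal.ofReal_ne_top] at h
  calc _ = ENNReal.ofReal (beta x y) * (ENNReal.ofReal (1 / beta x y) *
        ∫⁻ t in Ioo (0 : ℝ) 1, ENNReal.ofReal (t ^ (x - 1) * (1 - t) ^ (y - 1))) := by
        rw [← mul_assoc, ← ENNReal.ofReal_mul hpos.le, mul_one_div_cancel hpos.ne',
          ENNReal.ofReal_one, one_mul]
    _ = _ := by rw [h, mul_one]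

lemma lintegral_Gamma {x : ℝ} (hx : 0 < x) :
    ∫⁻ t in Ioi (0 : ℝ), ENNReal.ofReal (t ^ (x - 1) * Real.exp (-t)) =
      ENNReal.ofReal (Real.Gamma x) := by
  rw [Real.Gamma_eq_integral hx, ofReal_integral_eq_lintegral_ofReal]
  · simp_rw [mul_comm]
  · exact Real.GammaIntegral_convergent hx
  · filter_upwards [ae_restrict_mem measurableSet_Ioi] with t ht
    exact mul_nonneg (Real.exp_pos _).le (Real.rpow_nonneg (le_of_lt ht) _)

lemma lintegral_Ioi_rpow_mul_comp_rpow (hq : 0 < q) (s : ℝ) (φ : ℝ → ℝ) :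
    ∫⁻ z in Ioi (0 : ℝ), ENNReal.ofReal (z ^ (s - 1) * φ (z ^ q)) =
      ENNReal.ofReal (1 / q) * ∫⁻ r in Ioi (0 : ℝ), ENNReal.ofReal (r ^ (s / q - 1) * φ r) := by
  have himg : (fun r : ℝ => r ^ (1 / q)) '' Ioi 0 = Ioi 0 := by
    ext z
    constructor
    · rintro ⟨r, hr, rfl⟩
      exact Real.rpow_pos_of_pos hr _
    · intro hz
      refine ⟨z ^ q, Real.rpow_pos_of_pos hz _, ?_⟩
      simp only
      rw [← Real.rpow_mul (le_of_lt hz), mul_one_div_cancel hq.ne', Real.rpow_one]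
  rw [← lintegral_const_mul' _ _ ENNReal.ofReal_ne_top]
  conv_lhs => rw [← himg]
  rw [lintegral_image_eq_lintegral_deriv_mul_of_monotoneOn measurableSet_Ioi
    (f' := fun r => 1 / q * r ^ (1 / q - 1))]
  · refine setLIntegral_congr_fun measurableSet_Ioi fun r hr => ?_
    have hr : 0 < r := hr
    rw [← ENNReal.ofReal_mul (by positivity), ← ENNReal.ofReal_mul (by positivity),
      ← Real.rpow_mul hr.le, ← Real.rpow_mul hr.le, one_div_mul_cancel hq.ne', Real.rpow_one]
    congr 1
    have : r ^ (s / q - 1) = r ^ (1 / q - 1) * r ^ (1 / q * (s - 1)) := by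
      rw [← Real.rpow_add hr]; congr 1; field_simp; ring
    rw [this]; ring
  · exact fun r hr => (Real.hasDerivAt_rpow_const (Or.inl (ne_of_gt hr))).hasDerivWithinAt
  · exact fun r hr t _ hrt => Real.rpow_le_rpow (le_of_lt hr) hrt (by positivity)

/-- The moments of the profile on the half-line. -/
noncomputable def halfMoment (q b s : ℝ) : ℝ :=
  if b = 1 then 1 / q * Real.Gamma (s / q)
  else 1 / q * (|1 - b| ^ (-(s / q)) *
    beta (s / q) (1 / |1 - b| + if b ≤ 1 then -(s / q) else 1))

/-- After `r = z^q` this is a Gamma integral for `b = 1`. For `b < 1` the substitution `r = x /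
((1-b)(1-x))` gives `1 + (1-b) r = 1/(1-x)`, and for `b > 1` the substitution `r = x / (b-1)` gives
`1 - (b-1) r = 1 - x`; both lead to a Beta integral. The hypothesis `s * (1 - b) < q` is convergence
at infinity. -/
lemma lintegral_Ioi_profile (hq : 0 < q) {s : ℝ} (hs : 0 < s)
    (hsb : s * (1 - b) < q) :
    ∫⁻ z in Ioi (0 : ℝ), ENNReal.ofReal (z ^ (s - 1) * profile q b z) =
      ENNReal.ofReal (halfMoment q b s) := by
  have hsq : 0 < s / q := div_pos hs hq
  have h0 : ∫⁻ z in Ioi (0 : ℝ), ENNReal.ofReal (z ^ (s - 1) * profile q b z) =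
      ∫⁻ z in Ioi (0 : ℝ), ENNReal.ofReal (z ^ (s - 1) * (fun r => qExp (2 - b) (-r)) (z ^ q)) :=
    setLIntegral_congr_fun measurableSet_Ioi fun z hz => by
      simp only [profile, abs_of_pos (show 0 < z from hz)]
  rw [h0, lintegral_Ioi_rpow_mul_comp_rpow hq s (fun r => qExp (2 - b) (-r))]
  by_cases hb : b = 1
  · rw [halfMoment, if_pos hb, ENNReal.ofReal_mul (by positivity), ← lintegral_Gamma hsq]
    simp only [qExp, hb, show (2 : ℝ) - 1 = 1 by norm_num, if_true]
  rw [halfMoment, if_neg hb, ENNReal.ofReal_mul (by positivity)]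
  congr 1
  have h2b : 2 - b ≠ 1 := fun h => hb (by linarith)
  have he : ∀ r, qExp (2 - b) (-r) = max 0 (1 - (b - 1) * r) ^ (1 / (b - 1)) := fun r => by
    rw [qExp, if_neg h2b]; ring_nf
  simp only [he]
  rcases lt_or_gt_of_ne hb with h | h
  · set c := 1 - b with hc
    have hc0 : 0 < c := by linarith
    rw [abs_of_pos hc0, if_pos h.le, ENNReal.ofReal_mul (by positivity),
      ← lintegral_beta hsq (by rw [← sub_eq_add_neg, sub_pos, div_lt_div_iff₀ hq hc0]; linarith),
      ← lintegral_const_mul' _ _ ENNReal.ofReal_ne_top]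
    have himg : (fun x : ℝ => x / (c * (1 - x))) '' Ioo 0 1 = Ioi 0 := by
      ext r
      constructor
      · rintro ⟨x, hx, rfl⟩
        exact div_pos hx.1 (mul_pos hc0 (sub_pos.2 hx.2))
      · intro hr
        have hr : 0 < r := hr
        refine ⟨c * r / (1 + c * r), ⟨by positivity, ?_⟩, ?_⟩
        · rw [div_lt_one (by positivity)]; linarith
        · have : 1 + c * r ≠ 0 := by positivity
          simp only
          rw [one_sub_div this]
          field_simp
          ring
    conv_lhs => rw [← himg]
    rw [lintegral_image_eq_lintegral_deriv_mul_of_monotoneOn measurableSet_Ioo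
      (f' := fun x => 1 / (c * (1 - x) ^ 2))]
    · refine setLIntegral_congr_fun measurableSet_Ioo fun x hx => ?_
      have h1x : 0 < 1 - x := sub_pos.2 hx.2
      have hx0 : 0 < x := hx.1
      have hbase : 1 - (b - 1) * (x / (c * (1 - x))) = (1 - x)⁻¹ := by
        rw [show b - 1 = -c by linarith]; field_simp; ring
      rw [hbase, max_eq_right (by positivity), ← ENNReal.ofReal_mul (by positivity),
        ← ENNReal.ofReal_mul (by positivity)]
      congr 1
      rw [Real.inv_rpow h1x.le, ← Real.rpow_neg h1x.le, show -(1 / (b - 1)) = 1 / c by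
        rw [show b - 1 = -c by linarith]; field_simp, Real.div_rpow hx0.le (by positivity),
        Real.mul_rpow hc0.le h1x.le, Real.rpow_sub_one hc0.ne',
        Real.rpow_neg hc0.le]
      have hexp : (1 - x) ^ (1 / c + -(s / q) - 1) =
          (1 - x) ^ (1 / c) / (1 - x) ^ (s / q - 1) / (1 - x) ^ 2 := by
        rw [← Real.rpow_sub h1x, ← Real.rpow_two, ← Real.rpow_sub h1x]
        ring_nf
      have hne : (1 - x) ^ (s / q - 1) ≠ 0 := (Real.rpow_pos_of_pos h1x _).ne'
      have hne' : c ^ (s / q) ≠ 0 := (Real.rpow_pos_of_pos hc0 _).ne'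
      rw [hexp]
      generalize (1 - x) ^ (s / q - 1) = A at hne ⊢
      generalize c ^ (s / q) = B at hne' ⊢
      generalize (1 - x) ^ (1 / c) = D
      field_simp
    · intro x hx
      have h1x : 0 < 1 - x := sub_pos.2 hx.2
      have hd : HasDerivAt (fun y : ℝ => c * (1 - y)) (c * (-1)) x :=
        ((hasDerivAt_id x).const_sub 1).const_mul c
      refine (((hasDerivAt_id x).div hd (by positivity)).congr_deriv ?_).hasDerivWithinAt
      simp only [id]
      field_simp
      ring
    · intro x hx y hy hxy
      have h1x : 0 < 1 - x := sub_pos.2 hx.2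
      have h1y : 0 < 1 - y := sub_pos.2 hy.2
      simp only
      rw [div_le_div_iff₀ (by positivity) (by positivity)]
      nlinarith
  · set c := b - 1 with hc
    have hc0 : 0 < c := by linarith
    rw [show |1 - b| = c by rw [abs_sub_comm, abs_of_pos hc0], if_neg (not_le.2 h),
      ENNReal.ofReal_mul (by positivity),
      ← lintegral_beta hsq (by positivity), ← lintegral_const_mul' _ _ ENNReal.ofReal_ne_top]
    have himg : (fun x : ℝ => x / c) '' Ioo 0 1 = Ioo 0 (1 / c) := by
      ext r
      constructor
      · rintro ⟨x, hx, rfl⟩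
        exact ⟨div_pos hx.1 hc0, div_lt_div_of_pos_right hx.2 hc0⟩
      · intro hr
        have := (lt_div_iff₀ hc0).1 hr.2
        exact ⟨r * c, ⟨mul_pos hr.1 hc0, this⟩, by simp only; field_simp⟩
    have hsplit : ∫⁻ r in Ioi (0 : ℝ),
        ENNReal.ofReal (r ^ (s / q - 1) * max 0 (1 - c * r) ^ (1 / c)) =
        ∫⁻ r in Ioo (0 : ℝ) (1 / c),
        ENNReal.ofReal (r ^ (s / q - 1) * max 0 (1 - c * r) ^ (1 / c)) := by
      rw [← lintegral_indicator measurableSet_Ioi, ← lintegral_indicator measurableSet_Ioo]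
      refine lintegral_congr fun r => ?_
      by_cases hr : r ∈ Ioo 0 (1 / c)
      · rw [indicator_of_mem hr, indicator_of_mem (show r ∈ Ioi 0 from hr.1)]
      rw [indicator_of_notMem hr]
      refine indicator_apply_eq_zero.2 fun hr0 => ?_
      have hr' : 1 / c ≤ r := not_lt.1 fun h => hr ⟨hr0, h⟩
      have := (div_le_iff₀ hc0).1 hr'
      rw [max_eq_left (by linarith), Real.zero_rpow (by positivity)]
      simp
    rw [hsplit, ← himg, lintegral_image_eq_lintegral_deriv_mul_of_monotoneOn measurableSet_Ioo
      (f' := fun x => 1 / c)]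
    · refine setLIntegral_congr_fun measurableSet_Ioo fun x hx => ?_
      have h1x : 0 < 1 - x := sub_pos.2 hx.2
      have hx0 : 0 < x := hx.1
      have hbase : 1 - c * (x / c) = 1 - x := by field_simp
      rw [hbase, max_eq_right (by positivity), ← ENNReal.ofReal_mul (by positivity),
        ← ENNReal.ofReal_mul (by positivity)]
      congr 1
      rw [Real.div_rpow hx0.le hc0.le, Real.rpow_sub_one hc0.ne', Real.rpow_neg hc0.le, add_sub_cancel_right]
      field_simp
    · exact fun x _ => ((hasDerivAt_id x).div_const c).hasDerivWithinAt
    · exact fun x _ y _ hxy => div_le_div_of_nonneg_right hxy hc0.le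

end Profile

section StretchedGaussian

variable {q b : ℝ}

/-! ### The stretched deformed Gaussian -/

/-- The condition `1 < b * (q + 1)`, assumed from here on, says that the `q`-th moment is finite: it
is the convergence condition of `lintegral_Ioi_profile` at `s = q + 1`. -/
lemma normConst_mul_halfMoment (hq : 1 ≤ q) (hb : 1 < b * (q + 1)) :
    0 < normConst q b ∧ normConst q b * (2 * halfMoment q b 1) = 1 := by
  have hq0 : 0 < q := by linarith
  have hb0 : 0 < b := pos_of_mul_pos_left (by linarith) (by linarith : (0 : ℝ) ≤ q + 1)
  have h1q : 0 < 1 / q := by positivity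
  by_cases h1 : b = 1
  · have hG := Real.Gamma_pos_of_pos h1q
    rw [normConst, if_pos h1, halfMoment, if_pos h1]
    exact ⟨by positivity, by field_simp⟩
  · have habs : 0 < |1 - b| := abs_pos.2 (sub_ne_zero.2 (Ne.symm h1))
    have harg : (1 / |1 - b| + if b ≤ 1 then -(1 / q) else 1) =
        b / |1 - b| + if b ≤ 1 then 1 - 1 / q else 0 := by
      split_ifs with h
      · have : b < 1 := lt_of_le_of_ne h h1
        rw [abs_of_pos (by linarith)]
        have : 1 - b ≠ 0 := by linarith
        field_simp
        ring
      · have : 0 < b - 1 := by linarith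
        rw [abs_sub_comm, abs_of_pos this]
        field_simp
        ring
    have hpos : 0 < b / |1 - b| + if b ≤ 1 then 1 - 1 / q else 0 := by
      have : 1 / q ≤ 1 := by rw [div_le_one hq0]; exact hq
      have h3 : 0 < b / |1 - b| := by positivity
      split_ifs <;> linarith
    have hB := beta_pos h1q hpos
    rw [normConst, if_neg h1, halfMoment, if_neg h1, harg]
    refine ⟨by positivity, ?_⟩
    rw [Real.rpow_neg habs.le]
    have := (Real.rpow_pos_of_pos habs (1 / q)).ne'
    have hB' := hB.ne'
    generalize beta (1 / q) (b / |1 - b| + if b ≤ 1 then 1 - 1 / q else 0) = B at hB' ⊢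
    field_simp

lemma normConst_pos (hq : 1 ≤ q) (hb : 1 < b * (q + 1)) : 0 < normConst q b :=
  (normConst_mul_halfMoment hq hb).1

/-- The functional equation of Gamma, applied to each Gamma factor that shifts. The factor `1 / (b *
q + b - 1)` becomes the `q`-th moment of the normalized density. -/
lemma halfMoment_succ (hq : 1 ≤ q) (hb : 1 < b * (q + 1)) :
    halfMoment q b (q + 1) = 1 / (b * q + b - 1) * halfMoment q b 1 := by
  have hq0 : 0 < q := by linarith
  have hb0 : 0 < b := pos_of_mul_pos_left (by linarith) (by linarith : (0 : ℝ) ≤ q + 1)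
  have h1q : 0 < 1 / q := by positivity
  have hs : (q + 1) / q = 1 / q + 1 := by rw [add_div, div_self hq0.ne', add_comm]
  have hG : Real.Gamma ((q + 1) / q) = 1 / q * Real.Gamma (1 / q) := by
    rw [hs, Real.Gamma_add_one h1q.ne']
  have hd : 0 < b * q + b - 1 := by linarith
  by_cases h1 : b = 1
  · rw [halfMoment, if_pos h1, halfMoment, if_pos h1, hG, h1,
      show 1 * q + 1 - 1 = q by ring]
  · rw [halfMoment, if_neg h1, halfMoment, if_neg h1]
    rcases lt_or_gt_of_ne h1 with h | h
    · have hc : 0 < 1 - b := by linarith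
      rw [abs_of_pos hc, if_pos h.le, if_pos h.le, beta, beta, hG, hs,
        show 1 / q + 1 + (1 / (1 - b) + -(1 / q + 1)) = 1 / (1 - b) by ring,
        show 1 / q + (1 / (1 - b) + -(1 / q)) = 1 / (1 - b) by ring,
        show -(1 / q + 1) = -(1 / q) - 1 by ring, Real.rpow_sub_one hc.ne',
        show 1 / (1 - b) + -(1 / q) = (1 / (1 - b) + (-(1 / q) - 1)) + 1 by ring]
      have hy : 1 / (1 - b) + (-(1 / q) - 1) = (b * q + b - 1) / (q * (1 - b)) := by
        field_simp; ring
      have hy0 : 0 < 1 / (1 - b) + (-(1 / q) - 1) := by rw [hy]; positivity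
      rw [Real.Gamma_add_one hy0.ne']
      generalize Real.Gamma (1 / (1 - b) + (-(1 / q) - 1)) = A
      rw [hy]
      generalize Real.Gamma (1 / (1 - b)) = B
      generalize (1 - b) ^ (-(1 / q)) = D
      generalize b * q + b - 1 = d at hd
      field_simp
    · have hc : 0 < b - 1 := by linarith
      rw [abs_sub_comm, abs_of_pos hc, if_neg (not_le.2 h), if_neg (not_le.2 h), beta, beta, hG, hs,
        show -(1 / q + 1) = -(1 / q) - 1 by ring, Real.rpow_sub_one hc.ne',
        show 1 / q + 1 + (1 / (b - 1) + 1) = 1 / q + (1 / (b - 1) + 1) + 1 by ring,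
        Real.Gamma_add_one (s := 1 / q + (1 / (b - 1) + 1)) (by positivity)]
      generalize Real.Gamma (1 / q + (1 / (b - 1) + 1)) = A
      generalize Real.Gamma (1 / (b - 1) + 1) = B
      generalize (b - 1) ^ (-(1 / q)) = D
      have hy : 1 / q + (1 / (b - 1) + 1) = (b * q + b - 1) / (q * (b - 1)) := by
        field_simp; ring
      rw [hy]
      generalize b * q + b - 1 = d at hd
      field_simp

lemma stretchedGaussian_eq (z : ℝ) :
    stretchedGaussian q b z = normConst q b * profile q b z := rfl

lemma continuous_stretchedGaussian (hq : 0 < q) : Continuous (stretchedGaussian q b) :=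
  continuous_const.mul (continuous_profile hq)

lemma lintegral_eq_two_mul_of_even {g : ℝ → ℝ≥0∞} (hg : ∀ x, g (-x) = g x) :
    ∫⁻ x, g x = 2 * ∫⁻ x in Ioi 0, g x := by
  rw [← lintegral_add_compl g (measurableSet_Ioi (a := (0 : ℝ))), compl_Ioi,
    ← setLIntegral_congr Iio_ae_eq_Iic, setLIntegral_Iio_eq, neg_zero, two_mul]
  simp only [hg]

lemma isDensity_stretchedGaussian (hq : 1 ≤ q) (hb : 1 < b * (q + 1)) :
    IsDensity (stretchedGaussian q b) := by
  have hq0 : 0 < q := by linarith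
  have hb0 : 0 < b := pos_of_mul_pos_left (by linarith) (by linarith : (0 : ℝ) ≤ q + 1)
  obtain ⟨hN, hNm⟩ := normConst_mul_halfMoment hq hb
  refine ⟨(continuous_stretchedGaussian hq0).measurable, fun z => mul_nonneg hN.le
    (profile_nonneg z), ?_⟩
  simp only [stretchedGaussian_eq, ENNReal.ofReal_mul hN.le]
  rw [lintegral_const_mul' _ _ ENNReal.ofReal_ne_top, lintegral_eq_two_mul_of_even
    (fun x => by rw [profile_neg])]
  have := lintegral_Ioi_profile (q := q) (b := b) hq0 one_pos (by nlinarith)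
  simp only [sub_self, Real.rpow_zero, one_mul] at this
  rw [this, show (2 : ℝ≥0∞) = ENNReal.ofReal 2 by norm_num, ← ENNReal.ofReal_mul (by norm_num),
    ← ENNReal.ofReal_mul hN.le, hNm, ENNReal.ofReal_one]

lemma lintegral_enorm_rpow_stretchedGaussian (hq : 1 ≤ q) (hb : 1 < b * (q + 1)) :
    ∫⁻ z, ‖z‖ₑ ^ q ∂densityMeasure (stretchedGaussian q b) =
      ENNReal.ofReal (1 / (b * q + b - 1)) := by
  have hq0 : 0 < q := by linarith
  have hd : 0 < b * q + b - 1 := by linarith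
  obtain ⟨hN, hNm⟩ := normConst_mul_halfMoment hq hb
  rw [(isDensity_stretchedGaussian hq hb).lintegral_densityMeasure]
  simp only [stretchedGaussian_eq, ENNReal.ofReal_mul hN.le, mul_assoc]
  rw [lintegral_const_mul' _ _ ENNReal.ofReal_ne_top, lintegral_eq_two_mul_of_even
    (fun x => by rw [profile_neg, enorm_neg])]
  have := lintegral_Ioi_profile (q := q) (b := b) (s := q + 1) hq0 (by linarith) (by linarith)
  rw [add_sub_cancel_right] at this
  have h2 : ∫⁻ z in Ioi (0 : ℝ), ENNReal.ofReal (profile q b z) * ‖z‖ₑ ^ q =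
      ENNReal.ofReal (halfMoment q b (q + 1)) := by
    rw [← this]
    refine setLIntegral_congr_fun measurableSet_Ioi fun z hz => ?_
    have hz : 0 < z := hz
    rw [Real.enorm_of_nonneg hz.le, ENNReal.ofReal_rpow_of_pos hz, mul_comm,
      ENNReal.ofReal_mul (by positivity)]
  rw [h2, halfMoment_succ hq hb, show (2 : ℝ≥0∞) = ENNReal.ofReal 2 by norm_num,
    ← ENNReal.ofReal_mul (by norm_num), ← ENNReal.ofReal_mul hN.le]
  congr 1
  linear_combination 1 / (b * q + b - 1) * hNm

lemma stretchedGaussian_pos (hq : 1 ≤ q) (hb : 1 < b * (q + 1)) {z : ℝ}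
    (hz : z ∈ profileSupport q b) : 0 < stretchedGaussian q b z :=
  mul_pos (normConst_pos hq hb) (profile_pos hz)

lemma stretchedGaussian_pos_iff (hq : 1 ≤ q) (hb : 1 < b * (q + 1)) {z : ℝ} :
    0 < stretchedGaussian q b z ↔ z ∈ profileSupport q b := by
  rw [stretchedGaussian_eq, mul_pos_iff_of_pos_left (normConst_pos hq hb), profile_pos_iff]

lemma ae_mem_profileSupport (hq : 1 ≤ q) (hb : 1 < b * (q + 1)) :
    ∀ᵐ z ∂densityMeasure (stretchedGaussian q b), z ∈ profileSupport q b :=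
  (isDensity_stretchedGaussian hq hb).ae_pos.mono fun _ hz => (stretchedGaussian_pos_iff hq hb).1 hz

/-- By `profile_rpow_sub_one` the integrand is `normConst^(b-1) (1 - (b-1)|z|^q)`, so the mass and
the `q`-th moment determine the integral. -/
lemma lintegral_stretchedGaussian_rpow (hq : 1 ≤ q) (hb : 1 < b * (q + 1)) :
    ∫⁻ z, ENNReal.ofReal (stretchedGaussian q b z ^ (b - 1))
        ∂densityMeasure (stretchedGaussian q b) =
      ENNReal.ofReal (normConst q b ^ (b - 1) * (b * q) / (b * q + b - 1)) := by
  have hq0 : 0 < q := by linarith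
  have hd : 0 < b * q + b - 1 := by linarith
  have hN := normConst_pos hq hb
  have := (isDensity_stretchedGaussian hq hb).isProbabilityMeasure
  set γ := densityMeasure (stretchedGaussian q b)
  have hmeas : Measurable fun z : ℝ => |z| ^ q := by fun_prop
  have hmom : ∫⁻ z, ENNReal.ofReal (|z| ^ q) ∂γ = ENNReal.ofReal (1 / (b * q + b - 1)) := by
    rw [← lintegral_enorm_rpow_stretchedGaussian hq hb]
    refine lintegral_congr fun z => ?_
    rw [Real.enorm_eq_ofReal_abs, ENNReal.ofReal_rpow_of_nonneg (abs_nonneg z) hq0.le]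
  have hint : Integrable (fun z : ℝ => |z| ^ q) γ := by
    refine ⟨hmeas.aestronglyMeasurable, ?_⟩
    rw [hasFiniteIntegral_iff_ofReal (ae_of_all _ fun z => by positivity), hmom]
    exact ENNReal.ofReal_lt_top
  have hI : ∫ z, |z| ^ q ∂γ = 1 / (b * q + b - 1) := by
    rw [integral_eq_lintegral_of_nonneg_ae (ae_of_all _ fun z => by positivity)
      hmeas.aestronglyMeasurable, hmom, ENNReal.toReal_ofReal (by positivity)]
  have hint' : Integrable (fun z => normConst q b ^ (b - 1) * profileBase q b z) γ :=
    ((integrable_const 1).sub (hint.const_mul (b - 1))).const_mul _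
  have h1 : ∫⁻ z, ENNReal.ofReal (stretchedGaussian q b z ^ (b - 1)) ∂γ =
      ∫⁻ z, ENNReal.ofReal (normConst q b ^ (b - 1) * profileBase q b z) ∂γ := by
    refine lintegral_congr_ae ?_
    filter_upwards [ae_mem_profileSupport hq hb] with z hz
    rw [stretchedGaussian_eq, Real.mul_rpow hN.le (profile_nonneg z), profile_rpow_sub_one hz]
  rw [h1, ← ofReal_integral_eq_lintegral_ofReal hint' ?_]
  · congr 1
    rw [integral_const_mul]
    simp only [profileBase]
    rw [integral_sub (integrable_const 1) (hint.const_mul (b - 1)), integral_const_mul, hI]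
    simp only [integral_const, probReal_univ, smul_eq_mul]
    rw [mul_div_assoc, show b * q / (b * q + b - 1) = 1 - (b - 1) / (b * q + b - 1) by
      rw [eq_sub_iff_add_eq, ← add_div, ← add_sub_assoc, div_self hd.ne']]
    ring
  · filter_upwards [ae_mem_profileSupport hq hb] with z hz
    exact mul_nonneg (by positivity) (le_of_lt hz)

lemma rpow_sub_two_mul_deriv_stretchedGaussian (hq : 1 ≤ q) (hb : 1 < b * (q + 1)) {z : ℝ}
    (hz : z ∈ profileSupport q b) (hz0 : z ≠ 0) :
    stretchedGaussian q b z ^ (b - 2) * deriv (stretchedGaussian q b) z =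
      -(q * normConst q b ^ (b - 1) * (|z| ^ (q - 2) * z)) := by
  have hN := normConst_pos hq hb
  have hd : HasDerivAt (stretchedGaussian q b) _ z :=
    (hasDerivAt_profile hz (Or.inr hz0)).const_mul (normConst q b)
  have hp := profile_pos hz
  rw [hd.deriv, stretchedGaussian_eq, Real.mul_rpow hN.le hp.le,
    show 2 - b = -(b - 2) by ring, Real.rpow_neg hp.le, show b - 1 = b - 2 + 1 by ring,
    Real.rpow_add_one hN.ne']
  have := (Real.rpow_pos_of_pos hp (b - 2)).ne'
  field_simp

lemma abs_abs_rpow_mul {z : ℝ} (hz : z ≠ 0) : |(|z| ^ (q - 2) * z)| = |z| ^ (q - 1) := by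
  rw [abs_mul, abs_of_nonneg (by positivity), ← Real.rpow_add_one (abs_ne_zero.2 hz)]
  ring_nf

/-- The powers of the profile cancel exactly when the Fisher exponent is `b`. What remains is
proportional to `|z|^(q-1)`, the function that is extremal in Hölder's inequality against `|z|`. -/
lemma score_stretchedGaussian (hq : 1 ≤ q) (hb : 1 < b * (q + 1)) :
    score b (stretchedGaussian q b) =ᵐ[densityMeasure (stretchedGaussian q b)]
      fun z => ENNReal.ofReal (q * normConst q b ^ (b - 1)) * ENNReal.ofReal (|z| ^ (q - 1)) := by
  have hN := normConst_pos hq hb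
  have h0 : ∀ᵐ z ∂densityMeasure (stretchedGaussian q b), z ≠ 0 :=
    (withDensity_absolutelyContinuous _ _).ae_le (Measure.ae_ne volume 0)
  filter_upwards [h0, ae_mem_profileSupport hq hb] with z hz0 hz
  rw [score, rpow_sub_two_mul_deriv_stretchedGaussian hq hb hz hz0, enorm_neg,
    ← ENNReal.ofReal_mul (by positivity), Real.enorm_eq_ofReal_abs, abs_mul,
    abs_abs_rpow_mul hz0, abs_of_nonneg (by positivity)]

lemma differentiableAt_stretchedGaussian (hq : 1 ≤ q) (hb : 1 < b * (q + 1)) {z : ℝ}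
    (hz : 0 < stretchedGaussian q b z) (hz0 : z ∉ ({0} : Set ℝ)) :
    DifferentiableAt ℝ (stretchedGaussian q b) z :=
  ((hasDerivAt_profile ((stretchedGaussian_pos_iff hq hb).1 hz)
    (Or.inr hz0)).const_mul _).differentiableAt

/-- The constant in the bounds for `stretchedGaussian ^ b` by its tails. -/
noncomputable def tailConst (q b : ℝ) : ℝ := b * (q * normConst q b ^ (b - 1))

lemma stretchedGaussian_rpow_le_Ioi (hq : 1 ≤ q) (hb : 1 < b * (q + 1)) (z : ℝ) :
    ENNReal.ofReal (stretchedGaussian q b z ^ b) ≤ ENNReal.ofReal (tailConst q b) *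
      ∫⁻ y in Ioi z, ENNReal.ofReal (|y| ^ (q - 1)) ∂densityMeasure (stretchedGaussian q b) := by
  have hb0 : 0 < b := pos_of_mul_pos_left (by linarith) (by linarith : (0 : ℝ) ≤ q + 1)
  have := (isDensity_stretchedGaussian hq hb).rpow_le_setLIntegral_Ioi
    (continuous_stretchedGaussian (by linarith)) (countable_singleton 0)
    (fun x hx hx0 => differentiableAt_stretchedGaussian hq hb hx hx0) hb0 z
  rwa [lintegral_congr_ae (ae_restrict_of_ae (score_stretchedGaussian hq hb)),
    lintegral_const_mul' _ _ ENNReal.ofReal_ne_top, ← mul_assoc, ← ENNReal.ofReal_mul hb0.le] at this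

lemma stretchedGaussian_neg (z : ℝ) : stretchedGaussian q b (-z) = stretchedGaussian q b z := by
  rw [stretchedGaussian_eq, stretchedGaussian_eq, profile_neg]

lemma setLIntegral_Iio_stretchedGaussian (hq : 1 ≤ q) (hb : 1 < b * (q + 1)) (z : ℝ) :
    ∫⁻ y in Iio z, ENNReal.ofReal (|y| ^ (q - 1)) ∂densityMeasure (stretchedGaussian q b) =
      ∫⁻ y in Ioi (-z), ENNReal.ofReal (|y| ^ (q - 1))
        ∂densityMeasure (stretchedGaussian q b) := by
  have hG := isDensity_stretchedGaussian hq hb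
  rw [hG.setLIntegral_densityMeasure _ measurableSet_Iio,
    hG.setLIntegral_densityMeasure _ measurableSet_Ioi, setLIntegral_Iio_eq]
  simp only [abs_neg, stretchedGaussian_neg]

lemma stretchedGaussian_rpow_le_Iio (hq : 1 ≤ q) (hb : 1 < b * (q + 1)) (z : ℝ) :
    ENNReal.ofReal (stretchedGaussian q b z ^ b) ≤ ENNReal.ofReal (tailConst q b) *
      ∫⁻ y in Iio z, ENNReal.ofReal (|y| ^ (q - 1)) ∂densityMeasure (stretchedGaussian q b) := by
  rw [setLIntegral_Iio_stretchedGaussian hq hb, ← stretchedGaussian_neg z]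
  exact stretchedGaussian_rpow_le_Ioi hq hb (-z)

/-- Finiteness of the tails, needed to make the next bounds strict. -/
lemma lintegral_abs_rpow_sub_one_ne_top (hq : 1 ≤ q) (hb : 1 < b * (q + 1)) :
    ∫⁻ z, ENNReal.ofReal (|z| ^ (q - 1)) ∂densityMeasure (stretchedGaussian q b) ≠ ∞ := by
  have := (isDensity_stretchedGaussian hq hb).isProbabilityMeasure
  have hq0 : 0 < q := by linarith
  refine ne_top_of_le_ne_top (b := ∫⁻ z, (1 + ‖z‖ₑ ^ q) ∂densityMeasure (stretchedGaussian q b)) ?_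
    (lintegral_mono fun z => ?_)
  · rw [lintegral_add_left measurable_const, lintegral_enorm_rpow_stretchedGaussian hq hb]
    simp
  · rw [Real.enorm_eq_ofReal_abs, ENNReal.ofReal_rpow_of_nonneg (abs_nonneg z) hq0.le,
      ← ENNReal.ofReal_one, ← ENNReal.ofReal_add zero_le_one (by positivity)]
    refine ENNReal.ofReal_le_ofReal ?_
    rcases le_total |z| 1 with h | h
    · have h1 : |z| ^ (q - 1) ≤ 1 := Real.rpow_le_one (abs_nonneg z) h (by linarith)
      have : 0 ≤ |z| ^ q := by positivity
      linarith
    · have h1 : |z| ^ (q - 1) ≤ |z| ^ q := Real.rpow_le_rpow_of_exponent_le h (by linarith)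
      linarith

/-- By symmetry the smaller tail beyond `-z` already suffices, and the part over `(z, -z]` is
positive. Taking the tail on the wrong side of the origin is thus wasteful, which fixes the signs in
the equality case. -/
lemma stretchedGaussian_rpow_lt_Ioi (hq : 1 ≤ q) (hb : 1 < b * (q + 1)) {z : ℝ}
    (hz : z ∈ profileSupport q b) (hz0 : z < 0) :
    ENNReal.ofReal (stretchedGaussian q b z ^ b) < ENNReal.ofReal (tailConst q b) *
      ∫⁻ y in Ioi z, ENNReal.ofReal (|y| ^ (q - 1)) ∂densityMeasure (stretchedGaussian q b) := by
  have hb0 : 0 < b := pos_of_mul_pos_left (by linarith) (by linarith : (0 : ℝ) ≤ q + 1)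
  have hN := normConst_pos hq hb
  have hG := isDensity_stretchedGaussian hq hb
  have hT : 0 < tailConst q b := by unfold tailConst; positivity
  have hmeas : Measurable fun y : ℝ => ENNReal.ofReal (|y| ^ (q - 1)) := by fun_prop
  have hfin : ∀ s : Set ℝ, ∫⁻ y in s, ENNReal.ofReal (|y| ^ (q - 1))
      ∂densityMeasure (stretchedGaussian q b) ≠ ∞ := fun s =>
    ne_top_of_le_ne_top (lintegral_abs_rpow_sub_one_ne_top hq hb) (setLIntegral_le_lintegral _ _)
  rw [← stretchedGaussian_neg]
  refine (stretchedGaussian_rpow_le_Ioi hq hb (-z)).trans_lt ?_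
  refine (ENNReal.mul_lt_mul_iff_right (by simpa using hT) ENNReal.ofReal_ne_top).2 ?_
  rw [← Ioc_union_Ioi_eq_Ioi (show z ≤ -z by linarith), lintegral_union measurableSet_Ioi
    (Ioc_disjoint_Ioi le_rfl), add_comm]
  refine ENNReal.lt_add_right (hfin _) ?_
  rw [hG.setLIntegral_densityMeasure _ measurableSet_Ioc]
  refine (setLIntegral_pos_iff (hG.measurable_ofReal.mul hmeas)).2 ?_ |>.ne'
  refine lt_of_lt_of_le ?_ (measure_mono (s := Ioo z 0) fun y hy => ⟨?_, ?_⟩)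
  · simpa using hz0
  · have hy0 : 0 < |y| := abs_pos.2 hy.2.ne
    have hyS : y ∈ profileSupport q b := mem_profileSupport_of_abs_le (by linarith) hz
      (by rw [abs_of_neg hz0, abs_of_neg hy.2]; linarith [hy.1])
    have := stretchedGaussian_pos hq hb hyS
    rw [Function.mem_support]
    exact mul_ne_zero (ENNReal.ofReal_pos.2 this).ne'
      (ENNReal.ofReal_pos.2 (Real.rpow_pos_of_pos hy0 _)).ne'
  · exact ⟨hy.1, by linarith [hy.2]⟩

lemma stretchedGaussian_rpow_lt_Iio (hq : 1 ≤ q) (hb : 1 < b * (q + 1)) {z : ℝ}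
    (hz : z ∈ profileSupport q b) (hz0 : 0 < z) :
    ENNReal.ofReal (stretchedGaussian q b z ^ b) < ENNReal.ofReal (tailConst q b) *
      ∫⁻ y in Iio z, ENNReal.ofReal (|y| ^ (q - 1)) ∂densityMeasure (stretchedGaussian q b) := by
  rw [setLIntegral_Iio_stretchedGaussian hq hb, ← stretchedGaussian_neg z]
  exact stretchedGaussian_rpow_lt_Ioi hq hb
    (mem_profileSupport_of_abs_le (by linarith) hz (abs_neg z).le) (by linarith)

/-! ### Integrals of the weights between the origin and a point, and the distribution function. -/

lemma setLIntegral_inv_le {f : ℝ → ℝ} (hf : IsDensity f) (z : ℝ) :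
    ∫⁻ y in uIcc 0 z, (ENNReal.ofReal (f y))⁻¹ ∂densityMeasure f ≤ ‖z‖ₑ := by
  rw [hf.setLIntegral_densityMeasure _ measurableSet_uIcc]
  refine (lintegral_mono fun y => ENNReal.mul_inv_le_one _).trans ?_
  rw [setLIntegral_const, one_mul, Real.volume_interval, sub_zero, Real.enorm_eq_ofReal_abs]

/-- `f · f^(-α) = f^(1-α)` on the support; off it the factor `f` kills the left integrand, whatever
`0 ^ (-α)` is. This is how the cumulative integral comes out of the exchange of integrals. -/
lemma setLIntegral_rpow_neg {f : ℝ → ℝ} (hf : IsDensity f) (α x : ℝ) :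
    ∫⁻ y in uIcc 0 x, ENNReal.ofReal (f y ^ (-α)) ∂densityMeasure f = absCumul α f x := by
  have hs : MeasurableSet {t | 0 < f t} := measurableSet_lt measurable_const hf.measurable
  rw [hf.setLIntegral_densityMeasure _ measurableSet_uIcc, absCumul]
  have hae : uIcc 0 x =ᵐ[volume] uIoc 0 x := by
    rw [uIcc, uIoc]; exact Ioc_ae_eq_Icc.symm
  rw [setLIntegral_congr hae, ← lintegral_indicator measurableSet_uIoc,
    ← lintegral_indicator (measurableSet_uIoc.inter hs)]
  refine lintegral_congr fun t => ?_
  by_cases h : t ∈ uIoc 0 x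
  · rcases (hf.nonneg t).eq_or_lt with h0 | h0
    · simp [h, ← h0]
    · rw [indicator_of_mem h, indicator_of_mem (show t ∈ uIoc 0 x ∩ {t | 0 < f t} from ⟨h, h0⟩),
        ← ENNReal.ofReal_mul h0.le, sub_eq_add_neg, Real.rpow_add h0, Real.rpow_one]
  · rw [indicator_of_notMem h, indicator_of_notMem fun h' => h h'.1]

lemma hasDerivAt_cdf {f : ℝ → ℝ} (hf : IsDensity f) (hc : Continuous f) (x : ℝ) :
    HasDerivAt (cdf (densityMeasure f)) (f x) x := by
  have := hf.isProbabilityMeasure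
  have hint : Integrable f := by
    refine ⟨hc.aestronglyMeasurable, ?_⟩
    rw [hasFiniteIntegral_iff_ofReal (ae_of_all _ hf.nonneg), hf.lintegral_eq_one]
    exact ENNReal.one_lt_top
  have heq : ⇑(cdf (densityMeasure f)) = fun y => (∫ t in Iic x, f t) + ∫ t in x..y, f t := by
    ext y
    rw [← intervalIntegral.integral_Iic_sub_Iic hint.integrableOn hint.integrableOn,
      cdf_eq_real, measureReal_def, densityMeasure, withDensity_apply _ measurableSet_Iic,
      integral_eq_lintegral_of_nonneg_ae (f := f) (μ := volume.restrict (Iic y))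
        (ae_of_all _ hf.nonneg) hc.aestronglyMeasurable]
    ring
  rw [heq]
  exact (intervalIntegral.integral_hasDerivAt_right (hc.intervalIntegrable _ _)
    hc.aestronglyMeasurable.stronglyMeasurableAtFilter hc.continuousAt).const_add _

end StretchedGaussian

/-! ### Hölder's inequality -/

lemma holderConjugate_dual {p : ℝ≥0∞} (hp : 1 ≤ p) : ENNReal.HolderConjugate p (dual p) := by
  refine ENNReal.holderConjugate_iff.2 ?_
  rw [dual, inv_inv]
  exact add_tsub_cancel_of_le (ENNReal.inv_le_one.2 hp)

lemma dual_ne_top {p : ℝ≥0∞} (hp : 1 < p) : dual p ≠ ∞ := by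
  rw [dual, ne_eq, ENNReal.inv_eq_top, tsub_eq_zero_iff_le, not_le]
  exact ENNReal.inv_lt_one.2 hp

lemma one_le_dual (p : ℝ≥0∞) : 1 ≤ dual p := by
  rw [dual, ENNReal.one_le_inv]
  exact tsub_le_self

lemma one_le_toReal_dual {p : ℝ≥0∞} (hp : 1 < p) : 1 ≤ (dual p).toReal := by
  rw [← ENNReal.toReal_one]
  exact ENNReal.toReal_mono (dual_ne_top hp) (one_le_dual p)

lemma eLpNorm_dual_eq {Ω : Type*} [MeasurableSpace Ω] {p : ℝ≥0∞} (hp : 1 < p) {ε : Type*}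
    [ENorm ε] (g : Ω → ε) (τ : Measure Ω) : eLpNorm g (dual p) τ =
      (∫⁻ x, ‖g x‖ₑ ^ (dual p).toReal ∂τ) ^ (1 / (dual p).toReal) :=
  eLpNorm_eq_lintegral_rpow_enorm_toReal (zero_lt_one.trans_le (one_le_dual p)).ne'
    (dual_ne_top hp)

lemma lintegral_enorm_mul_enorm_le {Ω : Type*} [MeasurableSpace Ω] {τ : Measure Ω} {p : ℝ≥0∞}
    (hp : 1 < p) {g z : Ω → ℝ} (hg : Measurable g) (hz : Measurable z) :
    ∫⁻ x, ‖g x‖ₑ * ‖z x‖ₑ ∂τ ≤ eLpNorm g p τ *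
      (∫⁻ x, ‖z x‖ₑ ^ (dual p).toReal ∂τ) ^ (1 / (dual p).toReal) := by
  have := holderConjugate_dual hp.le
  have h := eLpNorm_smul_le_mul_eLpNorm (p := p) (q := dual p) (r := 1) (μ := τ)
    hz.aestronglyMeasurable hg.aestronglyMeasurable
  rw [eLpNorm_one_eq_lintegral_enorm, eLpNorm_dual_eq hp] at h
  simpa only [Pi.smul_apply', smul_eq_mul, enorm_mul] using h

/-- Hölder with exponents `q / (q - 1)` and `q`. The case `q = 1` (that is, `p = ∞`) is separate,
the first factor being constantly `1`. -/
lemma lintegral_rpow_sub_one_mul_le {Ω : Type*} [MeasurableSpace Ω] {τ : Measure Ω} {q : ℝ}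
    (hq : 1 ≤ q) {z u : Ω → ℝ≥0∞} (hz : Measurable z) (hu : Measurable u) :
    ∫⁻ x, z x ^ (q - 1) * u x ∂τ ≤
      (∫⁻ x, z x ^ q ∂τ) ^ (1 - 1 / q) * (∫⁻ x, u x ^ q ∂τ) ^ (1 / q) := by
  rcases hq.eq_or_lt with h | h
  · simp [← h]
  · have hc : q.HolderConjugate (q / (q - 1)) := Real.HolderConjugate.conjExponent h
    have := ENNReal.lintegral_mul_rpow_le_lintegral_rpow_mul_lintegral_rpow hc (μ := τ)
      hu.aemeasurable hz.aemeasurable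
    rw [mul_comm ((∫⁻ x, z x ^ q ∂τ) ^ (1 - 1 / q))]
    convert this using 2
    · exact funext fun x => mul_comm _ _
    · congr 1
      have : q - 1 ≠ 0 := by linarith
      field_simp

/-! ### The pointwise inequality -/

/-- Add `exp u ≥ 1 + u` at `u = b log r` to `b` times the same at `u = -log r`; the logarithms
cancel. -/
lemma one_add_le_rpow_add {b r : ℝ} (hb : 0 < b) (hr : 0 < r) : 1 + b ≤ r ^ b + b * r⁻¹ := by
  rw [Real.rpow_def_of_pos hr]
  have h1 := Real.add_one_le_exp (Real.log r * b)
  have h2 := Real.add_one_le_exp (-Real.log r)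
  rw [Real.exp_neg, Real.exp_log hr] at h2
  nlinarith

lemma eq_one_of_rpow_add_eq {b r : ℝ} (hb : 0 < b) (hr : 0 < r) (h : 1 + b = r ^ b + b * r⁻¹) :
    r = 1 := by
  by_contra hne
  have hlog : Real.log r ≠ 0 := Real.log_ne_zero_of_pos_of_ne_one hr hne
  rw [Real.rpow_def_of_pos hr] at h
  have h1 := Real.add_one_lt_exp (mul_ne_zero hlog hb.ne')
  have h2 := Real.add_one_le_exp (-Real.log r)
  rw [Real.exp_neg, Real.exp_log hr] at h2
  nlinarith

/-- Reduces the two-density inequality to one variable, the ratio `y^α / (k g)`. In use, `y` and `g`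
are the values of `f` and of the stretched Gaussian at coupled points, and `k` is a scale still to
be chosen. -/
lemma transport_identity {b α k g y : ℝ} (hk : 0 < k) (hg : 0 < g) (hy : 0 < y) :
    y ^ (α * b) * g⁻¹ + b * k ^ (b + 1) * (y ^ (-α) * g ^ b) =
      k ^ b * g ^ (b - 1) * ((y ^ α / (k * g)) ^ b + b * (y ^ α / (k * g))⁻¹) := by
  have hyα := Real.rpow_pos_of_pos hy α
  rw [Real.div_rpow hyα.le (by positivity), ← Real.rpow_mul hy.le, Real.mul_rpow hk.le hg.le,
    Real.rpow_neg hy.le, Real.rpow_add_one hk.ne', Real.rpow_sub_one hg.ne']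
  have h1 := (Real.rpow_pos_of_pos hk b).ne'
  have h2 := (Real.rpow_pos_of_pos hg b).ne'
  field_simp

lemma transport_le {b α k g y : ℝ} (hb : 0 < b) (hk : 0 < k) (hg : 0 < g) (hy : 0 < y) :
    (1 + b) * k ^ b * g ^ (b - 1) ≤
      y ^ (α * b) * g⁻¹ + b * k ^ (b + 1) * (y ^ (-α) * g ^ b) := by
  have hyα := Real.rpow_pos_of_pos hy α
  rw [transport_identity hk hg hy]
  have := one_add_le_rpow_add hb (div_pos hyα (mul_pos hk hg))
  nlinarith [mul_pos (Real.rpow_pos_of_pos hk b) (Real.rpow_pos_of_pos hg (b - 1))]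

lemma eq_of_transport_eq {b α k g y : ℝ} (hb : 0 < b) (hk : 0 < k) (hg : 0 < g) (hy : 0 < y)
    (h : (1 + b) * k ^ b * g ^ (b - 1) =
      y ^ (α * b) * g⁻¹ + b * k ^ (b + 1) * (y ^ (-α) * g ^ b)) : y ^ α = k * g := by
  have hyα := Real.rpow_pos_of_pos hy α
  have hpos := mul_pos (Real.rpow_pos_of_pos hk b) (Real.rpow_pos_of_pos hg (b - 1))
  rw [transport_identity hk hg hy] at h
  have h' := eq_one_of_rpow_add_eq hb (div_pos hyα (mul_pos hk hg))
    (mul_left_cancel₀ hpos.ne' (by linear_combination h))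
  rwa [div_eq_one_iff_eq (by positivity)] at h'

/-! ### The transport inequality -/

lemma measurable_absCumul {f : ℝ → ℝ} (hf : Measurable f) (α : ℝ) : Measurable (absCumul α f) := by
  have hs : MeasurableSet {p : ℝ × ℝ | p.2 ∈ uIoc 0 p.1 ∩ {t | 0 < f t}} := by
    have h : {p : ℝ × ℝ | p.2 ∈ uIoc 0 p.1 ∩ {t | 0 < f t}} =
        ({p | min 0 p.1 < p.2} ∩ {p | p.2 ≤ max 0 p.1}) ∩ {p | 0 < f p.2} := by
      ext p; simp [uIoc]
    rw [h]
    exact ((measurableSet_lt (by fun_prop) (by fun_prop)).inter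
      (measurableSet_le (by fun_prop) (by fun_prop))).inter
      (measurableSet_lt measurable_const (hf.comp measurable_snd))
  have h : absCumul α f = fun x => ∫⁻ t, {p : ℝ × ℝ | p.2 ∈ uIoc 0 p.1 ∩ {t | 0 < f t}}.indicator
      (fun p => ENNReal.ofReal (f p.2 ^ (1 - α))) (x, t) := by
    ext x
    rw [absCumul, ← lintegral_indicator (measurableSet_uIoc.inter
      (measurableSet_lt measurable_const hf))]
    rfl
  rw [h]
  refine Measurable.lintegral_prod_right' (Measurable.indicator ?_ hs)
  exact ((hf.comp measurable_snd).pow_const _).ennreal_ofReal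

/-- The quantile function of a density. -/
noncomputable abbrev densityQuantile (f : ℝ → ℝ) : ℝ → ℝ := quantile (densityMeasure f)

/-! ### Hölder's inequality along the coupling. -/

section Transport

variable {p : ℝ≥0∞} {q b α : ℝ} {f : ℝ → ℝ}

/-- Hölder on the unit interval. The factors are functions of the two quantiles, so their norms are
norms with respect to the two densities. -/
lemma lintegral_score_mul_le (hp : 1 < p) (hqp : q = (dual p).toReal)
    (hb : 1 < b * (q + 1)) (hf : IsDensity f) (β : ℝ) :
    ∫⁻ t, score β f (densityQuantile f t) * ‖densityQuantile (stretchedGaussian q b) t‖ₑ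
        ∂unitMeasure ≤
      eLpNorm (fun x => f x ^ (β - 2) * deriv f x) p (densityMeasure f) *
        ENNReal.ofReal (1 / (b * q + b - 1)) ^ (1 / q) := by
  have hq : 1 ≤ q := hqp ▸ one_le_toReal_dual hp
  have hG := isDensity_stretchedGaussian hq hb
  have := hf.isProbabilityMeasure
  have := hG.isProbabilityMeasure
  have hm : Measurable fun x => f x ^ (β - 2) * deriv f x :=
    (hf.measurable.pow_const _).mul (measurable_deriv f)
  have h := lintegral_enorm_mul_enorm_le (τ := unitMeasure) hp
    (hm.comp (measurable_quantile (densityMeasure f)))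
    (measurable_quantile (densityMeasure (stretchedGaussian q b)))
  rw [← hqp, ← eLpNorm_map_measure hm.aestronglyMeasurable (measurable_quantile _).aemeasurable,
    map_quantile, lintegral_quantile _ (g := fun z => ‖z‖ₑ ^ q) (by fun_prop),
    lintegral_enorm_rpow_stretchedGaussian hq hb] at h
  exact h

lemma lintegral_rpow_mul_absCumul_le (hp : 1 < p) (hqp : q = (dual p).toReal)
    (hb : 1 < b * (q + 1)) (hf : IsDensity f) :
    ∫⁻ t, ENNReal.ofReal (|densityQuantile (stretchedGaussian q b) t| ^ (q - 1)) *
        absCumul α f (densityQuantile f t) ∂unitMeasure ≤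
      ENNReal.ofReal (1 / (b * q + b - 1)) ^ (1 - 1 / q) *
        eLpNorm (absCumul α f) (dual p) (densityMeasure f) := by
  have hq : 1 ≤ q := hqp ▸ one_le_toReal_dual hp
  have hG := isDensity_stretchedGaussian hq hb
  have := hf.isProbabilityMeasure
  have := hG.isProbabilityMeasure
  have hu := measurable_absCumul hf.measurable α
  have hmom : ∫⁻ t, ‖densityQuantile (stretchedGaussian q b) t‖ₑ ^ q ∂unitMeasure =
      ENNReal.ofReal (1 / (b * q + b - 1)) := by
    rw [lintegral_quantile _ (g := fun z => ‖z‖ₑ ^ q) (by fun_prop),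
      lintegral_enorm_rpow_stretchedGaussian hq hb]
  have h := lintegral_rpow_sub_one_mul_le (τ := unitMeasure) hq
    (z := fun t => ‖densityQuantile (stretchedGaussian q b) t‖ₑ)
    (measurable_quantile (densityMeasure (stretchedGaussian q b))).enorm
    (hu.comp (measurable_quantile (densityMeasure f)))
  have h2 : ∫⁻ t, (absCumul α f (densityQuantile f t)) ^ q ∂unitMeasure =
      ∫⁻ x, absCumul α f x ^ q ∂densityMeasure f :=
    lintegral_quantile _ (g := fun x => absCumul α f x ^ q) (hu.pow_const _)
  rw [hmom] at h
  simp only [Function.comp_apply] at h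
  rw [h2] at h
  rw [eLpNorm_dual_eq hp, ← hqp]
  simp only [enorm_eq_self]
  refine le_trans (le_of_eq (lintegral_congr fun t => ?_)) h
  rw [Real.enorm_eq_ofReal_abs, ENNReal.ofReal_rpow_of_nonneg (abs_nonneg _) (by linarith)]

end Transport

/-- The first term of the transport inequality. -/
noncomputable def transportFisher (q b α : ℝ) (f : ℝ → ℝ) (t : ℝ) : ℝ≥0∞ :=
  ENNReal.ofReal (f (densityQuantile f t) ^ (α * b)) *
    (ENNReal.ofReal (stretchedGaussian q b (densityQuantile (stretchedGaussian q b) t)))⁻¹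

/-- The second term of the transport inequality. -/
noncomputable def transportMoment (q b α : ℝ) (f : ℝ → ℝ) (t : ℝ) : ℝ≥0∞ :=
  ENNReal.ofReal (f (densityQuantile f t) ^ (-α)) *
    ENNReal.ofReal (stretchedGaussian q b (densityQuantile (stretchedGaussian q b) t) ^ b)

/-- The bound for `transportMoment` by a tail of the stretched deformed Gaussian. -/
noncomputable def transportTail (q b α : ℝ) (f : ℝ → ℝ) (t : ℝ) : ℝ≥0∞ :=
  ENNReal.ofReal (f (densityQuantile f t) ^ (-α)) *
    tailIntegral (densityMeasure (stretchedGaussian q b)) (fun z => ENNReal.ofReal (|z| ^ (q - 1)))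
      (densityQuantile f t) (densityQuantile (stretchedGaussian q b) t)

/-! ### The integrated transport inequality and its equality case. -/

section Transport

variable {p : ℝ≥0∞} {q b α : ℝ} {f : ℝ → ℝ}

lemma ae_densityQuantile {f : ℝ → ℝ} (hf : IsDensity f) {P : ℝ → Prop}
    (h : ∀ᵐ x ∂densityMeasure f, P x) : ∀ᵐ t ∂unitMeasure, P (densityQuantile f t) := by
  have := hf.isProbabilityMeasure
  rw [← map_quantile (densityMeasure f)] at h
  exact ae_of_ae_map (measurable_quantile _).aemeasurable h

lemma measurable_stretchedGaussian_quantile (hq : 1 ≤ q) :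
    Measurable fun t => stretchedGaussian q b (densityQuantile (stretchedGaussian q b) t) :=
  (continuous_stretchedGaussian (by linarith)).measurable.comp (measurable_quantile _)

lemma measurable_transportFisher (hq : 1 ≤ q) (hf : IsDensity f) :
    Measurable (transportFisher q b α f) :=
  ((hf.measurable.comp (measurable_quantile _)).pow_const _).ennreal_ofReal.mul
    (measurable_stretchedGaussian_quantile hq).ennreal_ofReal.inv

lemma measurable_transportMoment (hq : 1 ≤ q) (hf : IsDensity f) :
    Measurable (transportMoment q b α f) :=
  ((hf.measurable.comp (measurable_quantile _)).pow_const _).ennreal_ofReal.mul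
    ((measurable_stretchedGaussian_quantile hq).pow_const _).ennreal_ofReal

lemma measurable_tailIntegral {ν : Measure ℝ} [SFinite ν] {D : ℝ → ℝ≥0∞} (hD : Measurable D)
    {z x : ℝ → ℝ} (hz : Measurable z) (hx : Measurable x) :
    Measurable fun t => tailIntegral ν D (z t) (x t) := by
  have h1 : Measurable fun t => ∫⁻ y in Ioi (x t), D y ∂ν := by
    simp_rw [← lintegral_indicator measurableSet_Ioi]
    exact Measurable.lintegral_prod_right' (f := fun r : ℝ × ℝ => (Ioi (x r.1)).indicator D r.2)
      (Measurable.indicator (s := {r : ℝ × ℝ | x r.1 < r.2}) (hD.comp measurable_snd)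
        (measurableSet_lt (hx.comp measurable_fst) measurable_snd))
  have h2 : Measurable fun t => ∫⁻ y in Iio (x t), D y ∂ν := by
    simp_rw [← lintegral_indicator measurableSet_Iio]
    exact Measurable.lintegral_prod_right' (f := fun r : ℝ × ℝ => (Iio (x r.1)).indicator D r.2)
      (Measurable.indicator (s := {r : ℝ × ℝ | r.2 < x r.1}) (hD.comp measurable_snd)
        (measurableSet_lt measurable_snd (hx.comp measurable_fst)))
  exact Measurable.ite (measurableSet_lt measurable_const hz) h1 h2

lemma measurable_transportTail (hq : 1 ≤ q) (hb : 1 < b * (q + 1)) (hf : IsDensity f) :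
    Measurable (transportTail q b α f) := by
  have := (isDensity_stretchedGaussian hq hb).isProbabilityMeasure
  exact ((hf.measurable.comp (measurable_quantile _)).pow_const _).ennreal_ofReal.mul
    (measurable_tailIntegral (by fun_prop) (measurable_quantile _) (measurable_quantile _))

/-- `f(X)^(αb)` is bounded by the tail of the score of `f` on the side given by the sign of `Z`;
after the exchange of integrals the weight `1/G` integrates to at most `|Z|`. -/
lemma lintegral_transportFisher_le (hp : 1 < p) (hqp : q = (dual p).toReal)
    (hb : 1 < b * (q + 1)) (hα : 0 < α) (hf : IsDensity f) (hc : Continuous f)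
    (hd : ∀ x, 0 < f x → DifferentiableAt ℝ f x) :
    ∫⁻ t, transportFisher q b α f t ∂unitMeasure ≤ ENNReal.ofReal (α * b) *
      (eLpNorm (fun x => f x ^ (α * b - 2) * deriv f x) p (densityMeasure f) *
        ENNReal.ofReal (1 / (b * q + b - 1)) ^ (1 / q)) := by
  have hq : 1 ≤ q := hqp ▸ one_le_toReal_dual hp
  have hb0 : 0 < b := pos_of_mul_pos_left (by linarith) (by linarith : (0 : ℝ) ≤ q + 1)
  have hG := isDensity_stretchedGaussian hq hb
  have := hf.isProbabilityMeasure
  have := hG.isProbabilityMeasure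
  have hs := measurable_score hf.measurable (α * b)
  have hd' : ∀ x, 0 < f x → x ∉ (∅ : Set ℝ) → DifferentiableAt ℝ f x := fun x hx _ => hd x hx
  have hw : Measurable fun z => (ENNReal.ofReal (stretchedGaussian q b z))⁻¹ :=
    hG.measurable_ofReal.inv
  have hpt : ∀ t, transportFisher q b α f t ≤ ENNReal.ofReal (α * b) *
      ((ENNReal.ofReal (stretchedGaussian q b (densityQuantile (stretchedGaussian q b) t)))⁻¹ *
        tailIntegral (densityMeasure f) (score (α * b) f)
          (densityQuantile (stretchedGaussian q b) t) (densityQuantile f t)) := fun t => by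
    rw [transportFisher, mul_comm, mul_left_comm]
    gcongr
    rw [tailIntegral]
    split_ifs
    · exact hf.rpow_le_setLIntegral_Ioi hc countable_empty hd' (mul_pos hα hb0) _
    · exact hf.rpow_le_setLIntegral_Iio hc countable_empty hd' (mul_pos hα hb0) _
  refine (lintegral_mono hpt).trans ?_
  rw [lintegral_const_mul' _ _ ENNReal.ofReal_ne_top]
  gcongr
  refine ((lintegral_tailIntegral_le _ _ hs hw).trans (lintegral_mono fun s => ?_)).trans
    (lintegral_score_mul_le hp hqp hb hf (α * b))
  exact mul_le_mul_right (setLIntegral_inv_le hG _) _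

lemma transportMoment_le (hq : 1 ≤ q) (hb : 1 < b * (q + 1)) (t : ℝ) :
    transportMoment q b α f t ≤ ENNReal.ofReal (tailConst q b) * transportTail q b α f t := by
  rw [transportMoment, transportTail, mul_left_comm]
  gcongr
  rw [tailIntegral]
  split_ifs
  · exact stretchedGaussian_rpow_le_Ioi hq hb _
  · exact stretchedGaussian_rpow_le_Iio hq hb _

/-- The same exchange with the two densities interchanged: the tail belongs to the stretched
Gaussian, and the weight `f^(-α)` integrates to `absCumul α f`. -/
lemma lintegral_transportTail_le (hp : 1 < p) (hqp : q = (dual p).toReal)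
    (hb : 1 < b * (q + 1)) (hf : IsDensity f) :
    ∫⁻ t, transportTail q b α f t ∂unitMeasure ≤
      ENNReal.ofReal (1 / (b * q + b - 1)) ^ (1 - 1 / q) *
        eLpNorm (absCumul α f) (dual p) (densityMeasure f) := by
  have hq : 1 ≤ q := hqp ▸ one_le_toReal_dual hp
  have hG := isDensity_stretchedGaussian hq hb
  have := hf.isProbabilityMeasure
  have := hG.isProbabilityMeasure
  refine ((lintegral_tailIntegral_le (densityMeasure (stretchedGaussian q b)) (densityMeasure f)
    (D := fun z => ENNReal.ofReal (|z| ^ (q - 1))) (by fun_prop)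
    (hf.measurable.pow_const (-α)).ennreal_ofReal).trans (lintegral_mono fun s => ?_)).trans
    (lintegral_rpow_mul_absCumul_le (α := α) hp hqp hb hf)
  exact mul_le_mul_right (setLIntegral_rpow_neg hf α _).le _

lemma ae_quantiles_pos (hq : 1 ≤ q) (hb : 1 < b * (q + 1)) (hf : IsDensity f) :
    ∀ᵐ t ∂unitMeasure, 0 < f (densityQuantile f t) ∧
      0 < stretchedGaussian q b (densityQuantile (stretchedGaussian q b) t) :=
  (ae_densityQuantile hf hf.ae_pos).and (ae_densityQuantile (isDensity_stretchedGaussian hq hb)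
    (isDensity_stretchedGaussian hq hb).ae_pos)

lemma transportFisher_add (hb : 0 < b) {k t : ℝ} (hk : 0 < k) (hy : 0 < f (densityQuantile f t))
    (hg : 0 < stretchedGaussian q b (densityQuantile (stretchedGaussian q b) t)) :
    transportFisher q b α f t + ENNReal.ofReal (b * k ^ (b + 1)) * transportMoment q b α f t =
      ENNReal.ofReal (f (densityQuantile f t) ^ (α * b) *
        (stretchedGaussian q b (densityQuantile (stretchedGaussian q b) t))⁻¹ +
        b * k ^ (b + 1) * (f (densityQuantile f t) ^ (-α) *
          stretchedGaussian q b (densityQuantile (stretchedGaussian q b) t) ^ b)) := by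
  rw [transportFisher, transportMoment, ← ENNReal.ofReal_inv_of_pos hg,
    ← ENNReal.ofReal_mul (by positivity), ← ENNReal.ofReal_mul (by positivity),
    ← ENNReal.ofReal_mul (by positivity), ← ENNReal.ofReal_add (by positivity) (by positivity)]

lemma lintegral_stretchedGaussian_quantile_rpow (hq : 1 ≤ q) (hb : 1 < b * (q + 1)) :
    ∫⁻ t, ENNReal.ofReal (stretchedGaussian q b (densityQuantile (stretchedGaussian q b) t)
      ^ (b - 1)) ∂unitMeasure = ENNReal.ofReal (tailConst q b * (1 / (b * q + b - 1))) := by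
  have hG := isDensity_stretchedGaussian hq hb
  have := hG.isProbabilityMeasure
  rw [lintegral_quantile (densityMeasure (stretchedGaussian q b))
    (g := fun z => ENNReal.ofReal (stretchedGaussian q b z ^ (b - 1)))
    (hG.measurable.pow_const _).ennreal_ofReal, lintegral_stretchedGaussian_rpow hq hb, tailConst]
  congr 1
  ring

lemma lintegral_transport_le (hq : 1 ≤ q) (hb : 1 < b * (q + 1)) (hf : IsDensity f) {k : ℝ}
    (hk : 0 < k) :
    ENNReal.ofReal ((1 + b) * k ^ b * (tailConst q b * (1 / (b * q + b - 1)))) ≤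
      ∫⁻ t, transportFisher q b α f t ∂unitMeasure +
        ENNReal.ofReal (b * k ^ (b + 1)) * ∫⁻ t, transportMoment q b α f t ∂unitMeasure := by
  have hb0 : 0 < b := pos_of_mul_pos_left (by linarith) (by linarith : (0 : ℝ) ≤ q + 1)
  rw [ENNReal.ofReal_mul (by positivity), ← lintegral_stretchedGaussian_quantile_rpow hq hb,
    ← lintegral_const_mul' _ _ ENNReal.ofReal_ne_top,
    ← lintegral_const_mul' _ _ ENNReal.ofReal_ne_top,
    ← lintegral_add_left (measurable_transportFisher hq hf)]
  refine lintegral_mono_ae ?_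
  filter_upwards [ae_quantiles_pos hq hb hf] with t ht
  rw [transportFisher_add hb0 hk ht.1 ht.2, ← ENNReal.ofReal_mul (by positivity)]
  exact ENNReal.ofReal_le_ofReal (transport_le hb0 hk ht.2 ht.1)

/-- A vanishing norm would make `transportFisher` vanish almost everywhere, yet it is positive. With
the companion for `absCumul`, this excludes the indeterminate product `0 · ∞`. -/
lemma eLpNorm_score_ne_zero (hp : 1 < p) (hqp : q = (dual p).toReal)
    (hb : 1 < b * (q + 1)) (hα : 0 < α) (hf : IsDensity f) (hc : Continuous f)
    (hd : ∀ x, 0 < f x → DifferentiableAt ℝ f x) :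
    eLpNorm (fun x => f x ^ (α * b - 2) * deriv f x) p (densityMeasure f) ≠ 0 := by
  have hq : 1 ≤ q := hqp ▸ one_le_toReal_dual hp
  intro h
  have h1 := lintegral_transportFisher_le hp hqp hb hα hf hc hd
  rw [h, zero_mul, mul_zero, nonpos_iff_eq_zero,
    lintegral_eq_zero_iff (measurable_transportFisher hq hf)] at h1
  obtain ⟨t, ht0, ht⟩ := (h1.and (ae_quantiles_pos hq hb hf)).exists
  refine mul_ne_zero ?_ (ENNReal.inv_ne_zero.2 ENNReal.ofReal_ne_top) ht0
  exact (ENNReal.ofReal_pos.2 (Real.rpow_pos_of_pos ht.1 _)).ne'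

lemma eLpNorm_absCumul_ne_zero (hp : 1 < p) (hqp : q = (dual p).toReal)
    (hb : 1 < b * (q + 1)) (hf : IsDensity f) :
    eLpNorm (absCumul α f) (dual p) (densityMeasure f) ≠ 0 := by
  have hq : 1 ≤ q := hqp ▸ one_le_toReal_dual hp
  intro h
  have h1 := lintegral_transportTail_le (α := α) hp hqp hb hf
  rw [h, mul_zero, nonpos_iff_eq_zero,
    lintegral_eq_zero_iff (measurable_transportTail hq hb hf)] at h1
  obtain ⟨t, ht0, ht⟩ := (h1.and (ae_quantiles_pos hq hb hf)).exists
  have h2 := transportMoment_le (α := α) (f := f) hq hb t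
  rw [ht0, Pi.zero_apply, mul_zero, nonpos_iff_eq_zero] at h2
  exact mul_ne_zero (ENNReal.ofReal_pos.2 (Real.rpow_pos_of_pos ht.1 _)).ne'
    (ENNReal.ofReal_pos.2 (Real.rpow_pos_of_pos ht.2 _)).ne' h2

lemma tailConst_pos (hq : 1 ≤ q) (hb : 1 < b * (q + 1)) : 0 < tailConst q b := by
  have hb0 : 0 < b := pos_of_mul_pos_left (by linarith) (by linarith : (0 : ℝ) ≤ q + 1)
  have := normConst_pos hq hb
  unfold tailConst
  positivity

/-- The sharp constant, for the product of norms. -/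
noncomputable def sharpConst (q b α : ℝ) : ℝ :=
  tailConst q b / (α * b) * (1 / (b * q + b - 1)) ^ ((b + q - 1) / q)

/-- The sum of the two upper bounds at the optimal scale. -/
lemma upper_bounds_identity {q b β T μ a M : ℝ} (hq : 0 < q) (hμ : 0 < μ) (hβ : 0 < β)
    (hM : 0 < M) :
    β * (a * μ ^ (1 / q)) + b * (μ ^ (1 / q) / M) ^ (b + 1) * (T * (μ ^ (1 - 1 / q) * M)) -
        (1 + b) * (μ ^ (1 / q) / M) ^ b * (T * μ) =
      β * μ ^ (1 / q) / M ^ b * (a * M ^ b - T / β * μ ^ ((b + q - 1) / q)) := by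
  have hm : 0 < μ ^ (1 / q) := Real.rpow_pos_of_pos hμ _
  have h1 : μ ^ ((b + q - 1) / q) = (μ ^ (1 / q)) ^ b * μ / μ ^ (1 / q) := by
    rw [← Real.rpow_mul hμ.le, ← Real.rpow_add_one hμ.ne', ← Real.rpow_sub hμ]
    congr 1
    field_simp
  rw [h1, Real.rpow_sub hμ, Real.rpow_one, Real.rpow_add_one (by positivity),
    Real.div_rpow hm.le hM.le]
  have h2 := (Real.rpow_pos_of_pos hM b).ne'
  generalize μ ^ (1 / q) = m at hm
  generalize m ^ b = mb
  generalize M ^ b = Mb at h2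
  field_simp
  ring

lemma upper_bounds_toReal (hq : 1 ≤ q) (hb : 1 < b * (q + 1)) (hα : 0 < α) {a M k : ℝ}
    (ha : 0 ≤ a) (hM : 0 ≤ M) (hk : 0 < k) :
    ENNReal.ofReal (α * b) * (ENNReal.ofReal a *
        ENNReal.ofReal (1 / (b * q + b - 1)) ^ (1 / q)) +
      ENNReal.ofReal (b * k ^ (b + 1)) * (ENNReal.ofReal (tailConst q b) *
        (ENNReal.ofReal (1 / (b * q + b - 1)) ^ (1 - 1 / q) * ENNReal.ofReal M)) =
    ENNReal.ofReal (α * b * (a * (1 / (b * q + b - 1)) ^ (1 / q)) +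
      b * k ^ (b + 1) * (tailConst q b * ((1 / (b * q + b - 1)) ^ (1 - 1 / q) * M))) := by
  have hb0 : 0 < b := pos_of_mul_pos_left (by linarith) (by linarith : (0 : ℝ) ≤ q + 1)
  have hμ : 0 < 1 / (b * q + b - 1) := one_div_pos.2 (by linarith)
  have hT := tailConst_pos hq hb
  have h1q : 1 / q ≤ 1 := by rw [div_le_one (by linarith)]; exact hq
  rw [ENNReal.ofReal_rpow_of_nonneg hμ.le (by positivity),
    ENNReal.ofReal_rpow_of_nonneg hμ.le (by linarith)]
  generalize 1 / (b * q + b - 1) = μ at *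
  rw [← ENNReal.ofReal_mul ha, ← ENNReal.ofReal_mul (by positivity),
    ← ENNReal.ofReal_mul (by positivity), ← ENNReal.ofReal_mul hT.le,
    ← ENNReal.ofReal_mul (by positivity), ← ENNReal.ofReal_add (by positivity) (by positivity)]

theorem sharpConst_le (hp : 1 < p) (hqp : q = (dual p).toReal)
    (hb : 1 < b * (q + 1)) (hα : 0 < α) (hf : IsDensity f) (hc : Continuous f)
    (hd : ∀ x, 0 < f x → DifferentiableAt ℝ f x) :
    ENNReal.ofReal (sharpConst q b α) ≤
      eLpNorm (fun x => f x ^ (α * b - 2) * deriv f x) p (densityMeasure f) *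
        eLpNorm (absCumul α f) (dual p) (densityMeasure f) ^ b := by
  have hq : 1 ≤ q := hqp ▸ one_le_toReal_dual hp
  have hb0 : 0 < b := pos_of_mul_pos_left (by linarith) (by linarith : (0 : ℝ) ≤ q + 1)
  have hμ : 0 < 1 / (b * q + b - 1) := one_div_pos.2 (by linarith)
  have ha0 := eLpNorm_score_ne_zero hp hqp hb hα hf hc hd
  have hM0 := eLpNorm_absCumul_ne_zero (α := α) hp hqp hb hf
  have h1 := lintegral_transportFisher_le hp hqp hb hα hf hc hd
  have h2 := lintegral_transportTail_le (α := α) hp hqp hb hf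
  generalize eLpNorm (fun x => f x ^ (α * b - 2) * deriv f x) p (densityMeasure f) = a at *
  generalize eLpNorm (absCumul α f) (dual p) (densityMeasure f) = M at *
  by_cases ha : a = ∞
  · rw [ha, ENNReal.top_mul]
    · exact le_top
    · simp [ENNReal.rpow_eq_zero_iff, hM0, hb0.not_gt]
  by_cases hM : M = ∞
  · rw [hM, ENNReal.top_rpow_of_pos hb0, ENNReal.mul_top ha0]
    exact le_top
  obtain ⟨a, ha', rfl⟩ : ∃ a', 0 ≤ a' ∧ a = ENNReal.ofReal a' :=
    ⟨a.toReal, ENNReal.toReal_nonneg, (ENNReal.ofReal_toReal ha).symm⟩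
  obtain ⟨M, hM', rfl⟩ : ∃ M', 0 < M' ∧ M = ENNReal.ofReal M' :=
    ⟨M.toReal, ENNReal.toReal_pos hM0 hM, (ENNReal.ofReal_toReal hM).symm⟩
  -- The optimal scale. With `μ` the `q`-th moment and `T = tailConst q b`, it maximizes `(1 + b)
  -- k^b T μ - b k^(b+1) T μ^(1-1/q) M`, the resulting lower bound for the Fisher term.
  have hk : 0 < (1 / (b * q + b - 1)) ^ (1 / q) / M := by positivity
  have h3 := lintegral_transport_le (α := α) hq hb hf hk
  have h4 : ∫⁻ t, transportMoment q b α f t ∂unitMeasure ≤ ENNReal.ofReal (tailConst q b) *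
      (ENNReal.ofReal (1 / (b * q + b - 1)) ^ (1 - 1 / q) * ENNReal.ofReal M) := by
    refine (lintegral_mono fun t => transportMoment_le hq hb t).trans ?_
    rw [lintegral_const_mul' _ _ ENNReal.ofReal_ne_top]
    gcongr
  have h5 := h3.trans (add_le_add h1 (mul_le_mul_right h4 _))
  rw [upper_bounds_toReal hq hb hα ha' hM'.le hk, ENNReal.ofReal_le_ofReal_iff'] at h5
  have h6 := upper_bounds_identity (q := q) (b := b) (β := α * b) (T := tailConst q b)
    (a := a) (by linarith) hμ (by positivity) hM'
  have hT := tailConst_pos hq hb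
  have h8 : 0 < α * b * (1 / (b * q + b - 1)) ^ (1 / q) / M ^ b := by positivity
  have h7 : 0 ≤ a * M ^ b - sharpConst q b α := by
    refine nonneg_of_mul_nonneg_right (b := _) (a := _) ?_ h8
    rw [sharpConst, ← h6]
    rcases h5 with h5 | h5
    · linarith
    · exact absurd h5 (not_le.2 (by positivity))
  rw [ENNReal.ofReal_rpow_of_nonneg hM'.le hb0.le, ← ENNReal.ofReal_mul ha']
  exact ENNReal.ofReal_le_ofReal (by linarith)

lemma sharpConst_pos (hq : 1 ≤ q) (hb : 1 < b * (q + 1)) (hα : 0 < α) : 0 < sharpConst q b α := by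
  have hb0 : 0 < b := pos_of_mul_pos_left (by linarith) (by linarith : (0 : ℝ) ≤ q + 1)
  have hμ : 0 < 1 / (b * q + b - 1) := one_div_pos.2 (by linarith)
  have hT := tailConst_pos hq hb
  unfold sharpConst
  positivity

/-- At the optimal scale the sum of the upper bounds equals the integrated lower bound, so nothing
is lost in between. All quantities being finite, pointwise inequalities with equal integrals are
equalities almost everywhere. Equality in the transport inequality gives the relation between the
densities, equality in the tail bound gives the signs; the equality case of Hölder's inequality is
not needed. -/
theorem ae_eq_of_eq_sharpConst (hp : 1 < p) (hqp : q = (dual p).toReal)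
    (hb : 1 < b * (q + 1)) (hα : 0 < α) (hf : IsDensity f) (hc : Continuous f)
    (hd : ∀ x, 0 < f x → DifferentiableAt ℝ f x)
    (heq : eLpNorm (fun x => f x ^ (α * b - 2) * deriv f x) p (densityMeasure f) *
      eLpNorm (absCumul α f) (dual p) (densityMeasure f) ^ b =
        ENNReal.ofReal (sharpConst q b α)) :
    ∃ k, 0 < k ∧ ∀ᵐ t ∂unitMeasure, f (densityQuantile f t) ^ α =
        k * stretchedGaussian q b (densityQuantile (stretchedGaussian q b) t) ∧
      (0 < densityQuantile f t → 0 ≤ densityQuantile (stretchedGaussian q b) t) ∧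
      (densityQuantile f t ≤ 0 → densityQuantile (stretchedGaussian q b) t ≤ 0) := by
  have hq : 1 ≤ q := hqp ▸ one_le_toReal_dual hp
  have hb0 : 0 < b := pos_of_mul_pos_left (by linarith) (by linarith : (0 : ℝ) ≤ q + 1)
  have hμ : 0 < 1 / (b * q + b - 1) := one_div_pos.2 (by linarith)
  have hT := tailConst_pos hq hb
  have ha0 := eLpNorm_score_ne_zero hp hqp hb hα hf hc hd
  have hM0 := eLpNorm_absCumul_ne_zero (α := α) hp hqp hb hf
  have h1 := lintegral_transportFisher_le hp hqp hb hα hf hc hd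
  have h2 := lintegral_transportTail_le (α := α) hp hqp hb hf
  generalize eLpNorm (fun x => f x ^ (α * b - 2) * deriv f x) p (densityMeasure f) = a at *
  generalize eLpNorm (absCumul α f) (dual p) (densityMeasure f) = M at *
  have ha : a ≠ ∞ := by
    rintro rfl
    rw [ENNReal.top_mul (by simp [ENNReal.rpow_eq_zero_iff, hM0, hb0.not_gt])] at heq
    exact ENNReal.ofReal_ne_top heq.symm
  have hM : M ≠ ∞ := by
    rintro rfl
    rw [ENNReal.top_rpow_of_pos hb0, ENNReal.mul_top ha0] at heq
    exact ENNReal.ofReal_ne_top heq.symm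
  obtain ⟨a, ha', rfl⟩ : ∃ a', 0 ≤ a' ∧ a = ENNReal.ofReal a' :=
    ⟨a.toReal, ENNReal.toReal_nonneg, (ENNReal.ofReal_toReal ha).symm⟩
  obtain ⟨M, hM', rfl⟩ : ∃ M', 0 < M' ∧ M = ENNReal.ofReal M' :=
    ⟨M.toReal, ENNReal.toReal_pos hM0 hM, (ENNReal.ofReal_toReal hM).symm⟩
  set k := (1 / (b * q + b - 1)) ^ (1 / q) / M with hkdef
  have hk : 0 < k := by positivity
  have h3 := lintegral_transport_le (α := α) hq hb hf hk
  have hMT : ∫⁻ t, transportMoment q b α f t ∂unitMeasure ≤ ENNReal.ofReal (tailConst q b) *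
      ∫⁻ t, transportTail q b α f t ∂unitMeasure := by
    rw [← lintegral_const_mul' _ _ ENNReal.ofReal_ne_top]
    exact lintegral_mono fun t => transportMoment_le hq hb t
  have hTU := mul_le_mul_right h2 (ENNReal.ofReal (tailConst q b))
  have hsum : ENNReal.ofReal (α * b) * (ENNReal.ofReal a *
        ENNReal.ofReal (1 / (b * q + b - 1)) ^ (1 / q)) +
      ENNReal.ofReal (b * k ^ (b + 1)) * (ENNReal.ofReal (tailConst q b) *
        (ENNReal.ofReal (1 / (b * q + b - 1)) ^ (1 - 1 / q) * ENNReal.ofReal M)) =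
      ENNReal.ofReal ((1 + b) * k ^ b * (tailConst q b * (1 / (b * q + b - 1)))) := by
    rw [upper_bounds_toReal hq hb hα ha' hM'.le hk]
    congr 1
    rw [ENNReal.ofReal_rpow_of_nonneg hM'.le hb0.le, ← ENNReal.ofReal_mul ha',
      ENNReal.ofReal_eq_ofReal_iff (by positivity) (sharpConst_pos hq hb hα).le] at heq
    have h6 := upper_bounds_identity (q := q) (b := b) (β := α * b) (T := tailConst q b)
      (a := a) (by linarith) hμ (by positivity) hM'
    rw [heq, sharpConst, sub_self, mul_zero] at h6
    linarith
  have hc2 : ENNReal.ofReal (b * k ^ (b + 1)) ≠ 0 := by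
    simpa only [ne_eq, ENNReal.ofReal_eq_zero, not_le] using (by positivity : 0 < b * k ^ (b + 1))
  have hU1 : ENNReal.ofReal (α * b) * (ENNReal.ofReal a *
        ENNReal.ofReal (1 / (b * q + b - 1)) ^ (1 / q)) ≠ ∞ :=
    ENNReal.mul_ne_top ENNReal.ofReal_ne_top (ENNReal.mul_ne_top ENNReal.ofReal_ne_top
      (ENNReal.rpow_ne_top_of_nonneg (by positivity) ENNReal.ofReal_ne_top))
  -- Cancelling the finite bound of the Fisher term from the closed chain of inequalities isolates
  -- equality in the tail bound.
  have hTM : ENNReal.ofReal (tailConst q b) * ∫⁻ t, transportTail q b α f t ∂unitMeasure ≤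
      ∫⁻ t, transportMoment q b α f t ∂unitMeasure := by
    refine (ENNReal.mul_le_mul_iff_right hc2 ENNReal.ofReal_ne_top).1 ?_
    refine (ENNReal.add_le_add_iff_left hU1).1 ?_
    exact ((add_le_add_right (mul_le_mul_right hTU _) _).trans (hsum.le.trans h3)).trans
      (add_le_add_left h1 _)
  have hMfin : ∫⁻ t, transportMoment q b α f t ∂unitMeasure ≠ ∞ :=
    ne_top_of_le_ne_top (ENNReal.mul_ne_top ENNReal.ofReal_ne_top (ENNReal.mul_ne_top
      (ENNReal.rpow_ne_top_of_nonneg (by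
        have : 1 / q ≤ 1 := by rw [div_le_one (by linarith)]; exact hq
        linarith) ENNReal.ofReal_ne_top) ENNReal.ofReal_ne_top)) (hMT.trans hTU)
  have hae1 : transportMoment q b α f =ᵐ[unitMeasure]
      fun t => ENNReal.ofReal (tailConst q b) * transportTail q b α f t := by
    refine ae_eq_of_ae_le_of_lintegral_le (ae_of_all _ fun t => transportMoment_le hq hb t) hMfin
      ((measurable_transportTail hq hb hf).const_mul _).aemeasurable ?_
    rwa [lintegral_const_mul' _ _ ENNReal.ofReal_ne_top]
  have hle2 : (fun t => ENNReal.ofReal ((1 + b) * k ^ b) * ENNReal.ofReal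
      (stretchedGaussian q b (densityQuantile (stretchedGaussian q b) t) ^ (b - 1)))
      ≤ᵐ[unitMeasure] fun t => transportFisher q b α f t +
        ENNReal.ofReal (b * k ^ (b + 1)) * transportMoment q b α f t := by
    filter_upwards [ae_quantiles_pos hq hb hf] with t ht
    rw [transportFisher_add hb0 hk ht.1 ht.2, ← ENNReal.ofReal_mul (by positivity)]
    exact ENNReal.ofReal_le_ofReal (transport_le hb0 hk ht.2 ht.1)
  have hR : ∫⁻ t, ENNReal.ofReal ((1 + b) * k ^ b) * ENNReal.ofReal
      (stretchedGaussian q b (densityQuantile (stretchedGaussian q b) t) ^ (b - 1)) ∂unitMeasure =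
      ENNReal.ofReal ((1 + b) * k ^ b * (tailConst q b * (1 / (b * q + b - 1)))) := by
    rw [lintegral_const_mul' _ _ ENNReal.ofReal_ne_top,
      lintegral_stretchedGaussian_quantile_rpow hq hb, ← ENNReal.ofReal_mul (by positivity)]
  have hae2 := ae_eq_of_ae_le_of_lintegral_le hle2 (hR ▸ ENNReal.ofReal_ne_top)
    ((measurable_transportFisher hq hf).add
      ((measurable_transportMoment hq hf).const_mul _)).aemeasurable (by
    rw [lintegral_add_left (measurable_transportFisher hq hf),
      lintegral_const_mul' _ _ ENNReal.ofReal_ne_top, hR, ← hsum]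
    exact add_le_add h1 (mul_le_mul_right (hMT.trans hTU) _))
  refine ⟨k, hk, ?_⟩
  filter_upwards [hae1, hae2, ae_quantiles_pos hq hb hf] with t ht1 ht2 ht
  have hS := (stretchedGaussian_pos_iff hq hb).1 ht.2
  have hw0 : ENNReal.ofReal (f (densityQuantile f t) ^ (-α)) ≠ 0 :=
    (ENNReal.ofReal_pos.2 (Real.rpow_pos_of_pos ht.1 _)).ne'
  rw [transportMoment, transportTail, mul_left_comm,
    ENNReal.mul_right_inj hw0 ENNReal.ofReal_ne_top, tailIntegral] at ht1
  refine ⟨?_, fun hX => ?_, fun hX => ?_⟩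
  · rw [transportFisher_add hb0 hk ht.1 ht.2, ← ENNReal.ofReal_mul (by positivity),
      ENNReal.ofReal_eq_ofReal_iff] at ht2
    · exact eq_of_transport_eq hb0 hk ht.2 ht.1 ht2
    · have := ht.2
      positivity
    · have := ht.1
      have := ht.2
      positivity
  · rw [if_pos hX] at ht1
    exact le_of_not_gt fun hZ => (stretchedGaussian_rpow_lt_Ioi hq hb hS hZ).ne ht1
  · rw [if_neg (not_lt.2 hX)] at ht1
    exact le_of_not_gt fun hZ => (stretchedGaussian_rpow_lt_Iio hq hb hS hZ).ne ht1

end Transport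

/-! ### The extremal densities -/

/-- The map that transports the stretched deformed Gaussian to the extremal density. -/
noncomputable def escortMap (q b α z : ℝ) : ℝ := ∫ t in (0 : ℝ)..z, profile q b t ^ (1 - 1 / α)

/-- The image of the stretched deformed Gaussian under `escortMap`. -/
structure IsEscort (q b α : ℝ) (ρ : ℝ → ℝ) : Prop where
  eq_of_mem : ∀ z ∈ profileSupport q b,
    ρ (escortMap q b α z) = normConst q b * profile q b z ^ (1 / α)
  eq_zero : ∀ x, x ∉ escortMap q b α '' profileSupport q b → ρ x = 0

section Escort

variable {q b α : ℝ}

lemma continuousOn_profile_rpow (hq : 0 < q) (c : ℝ) :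
    ContinuousOn (fun z => profile q b z ^ c) (profileSupport q b) :=
  (continuous_profile hq).continuousOn.rpow_const fun _ hz => Or.inl (profile_pos hz).ne'

lemma hasDerivAt_escortMap (hq : 0 < q) {z : ℝ} (hz : z ∈ profileSupport q b) :
    HasDerivAt (escortMap q b α) (profile q b z ^ (1 - 1 / α)) z := by
  have hS := isOpen_profileSupport (b := b) hq
  have hc := continuousOn_profile_rpow (b := b) hq (1 - 1 / α)
  exact intervalIntegral.integral_hasDerivAt_right
    (hc.mono (uIcc_subset_profileSupport hq hz)).intervalIntegrable
    (hc.stronglyMeasurableAtFilter hS z hz) (hc.continuousAt (hS.mem_nhds hz))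

lemma continuousOn_escortMap (hq : 0 < q) :
    ContinuousOn (escortMap q b α) (profileSupport q b) := fun _ hz =>
  (hasDerivAt_escortMap hq hz).continuousAt.continuousWithinAt

lemma strictMonoOn_escortMap (hq : 0 < q) :
    StrictMonoOn (escortMap q b α) (profileSupport q b) :=
  strictMonoOn_of_hasDerivAt_pos (isOpen_profileSupport hq) (ordConnected_profileSupport hq)
    (fun _ hz => hasDerivAt_escortMap hq hz) fun _ hz => Real.rpow_pos_of_pos (profile_pos hz) _

lemma escortMap_zero : escortMap q b α 0 = 0 := intervalIntegral.integral_same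

end Escort

/-! ### Rigidity -/

section Rigidity

variable {q b α : ℝ} {f : ℝ → ℝ}

lemma IsDensity.exists_pos {f : ℝ → ℝ} (hf : IsDensity f) : ∃ x, 0 < f x := by
  by_contra! h
  have := hf.lintegral_eq_one
  simp [ENNReal.ofReal_of_nonpos (h _)] at this

/-- A value `0` or `1` would be a global extremum of the distribution function, where its derivative
`f x` must vanish. -/
lemma cdf_mem_Ioo {f : ℝ → ℝ} (hf : IsDensity f) (hc : Continuous f) {x : ℝ} (hx : 0 < f x) :
    cdf (densityMeasure f) x ∈ Ioo (0 : ℝ) 1 := by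
  have hd := hasDerivAt_cdf hf hc x
  refine ⟨lt_of_le_of_ne (cdf_nonneg _ _) fun h => hx.ne' ?_,
    lt_of_le_of_ne (cdf_le_one _ _) fun h => hx.ne' ?_⟩
  · exact IsLocalMin.hasDerivAt_eq_zero (Eventually.of_forall fun y => h ▸ cdf_nonneg _ y) hd
  · exact IsLocalMax.hasDerivAt_eq_zero (Eventually.of_forall fun y => h ▸ cdf_le_one _ y) hd

lemma continuous_cdf {f : ℝ → ℝ} (hf : IsDensity f) (hc : Continuous f) :
    Continuous (cdf (densityMeasure f)) :=
  continuous_iff_continuousAt.2 fun x => (hasDerivAt_cdf hf hc x).continuousAt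

lemma exists_mem_Ioo_of_ae {P : ℝ → Prop} (h : ∀ᵐ x, P x) {O : Set ℝ} (hO : IsOpen O)
    (hne : O.Nonempty) : ∃ x ∈ O, P x := by
  by_contra! hcon
  exact (hO.measure_pos volume hne).ne' (measure_mono_null (fun x hx => hcon x hx) h)

lemma strictMonoOn_cdf_stretchedGaussian (hq : 1 ≤ q) (hb : 1 < b * (q + 1)) :
    StrictMonoOn (cdf (densityMeasure (stretchedGaussian q b))) (profileSupport q b) :=
  strictMonoOn_of_hasDerivAt_pos (isOpen_profileSupport (by linarith))
    (ordConnected_profileSupport (by linarith))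
    (fun _ _ => hasDerivAt_cdf (isDensity_stretchedGaussian hq hb)
      (continuous_stretchedGaussian (by linarith)) _) fun _ hz => stretchedGaussian_pos hq hb hz

/-- True for almost every parameter, hence for some on either side of `t`; monotonicity and order
connectedness of the support fill the gap. -/
lemma quantile_mem_profileSupport (hq : 1 ≤ q) (hb : 1 < b * (q + 1)) {t : ℝ}
    (ht : t ∈ Ioo (0 : ℝ) 1) :
    densityQuantile (stretchedGaussian q b) t ∈ profileSupport q b := by
  have h := ae_densityQuantile (isDensity_stretchedGaussian hq hb) (ae_mem_profileSupport hq hb)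
  rw [unitMeasure, ae_restrict_iff' measurableSet_Ioo] at h
  obtain ⟨t₁, ht₁, h₁⟩ := exists_mem_Ioo_of_ae h isOpen_Ioo (nonempty_Ioo.2 ht.1)
  obtain ⟨t₂, ht₂, h₂⟩ := exists_mem_Ioo_of_ae h isOpen_Ioo (nonempty_Ioo.2 ht.2)
  have ht₁' : t₁ ∈ Ioo (0 : ℝ) 1 := ⟨ht₁.1, ht₁.2.trans ht.2⟩
  have ht₂' : t₂ ∈ Ioo (0 : ℝ) 1 := ⟨ht.1.trans ht₂.1, ht₂.2⟩
  exact (ordConnected_profileSupport (by linarith)).out (h₁ ht₁') (h₂ ht₂')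
    ⟨monotoneOn_quantile _ ht₁' ht ht₁.2.le, monotoneOn_quantile _ ht ht₂' ht₂.1.le⟩

lemma quantile_cdf_stretchedGaussian (hq : 1 ≤ q) (hb : 1 < b * (q + 1)) {z : ℝ}
    (hz : z ∈ profileSupport q b) :
    densityQuantile (stretchedGaussian q b)
      (cdf (densityMeasure (stretchedGaussian q b)) z) = z := by
  have hG := isDensity_stretchedGaussian hq hb
  have hGc := continuous_stretchedGaussian (q := q) (b := b) (by linarith)
  have ht := cdf_mem_Ioo hG hGc (stretchedGaussian_pos hq hb hz)
  exact (strictMonoOn_cdf_stretchedGaussian hq hb).injOn (quantile_mem_profileSupport hq hb ht) hz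
    (cdf_quantile _ (continuous_cdf hG hGc) ht)

lemma hasDerivAt_quantile_stretchedGaussian (hq : 1 ≤ q) (hb : 1 < b * (q + 1)) {t : ℝ}
    (ht : t ∈ Ioo (0 : ℝ) 1) :
    HasDerivAt (densityQuantile (stretchedGaussian q b))
      (stretchedGaussian q b (densityQuantile (stretchedGaussian q b) t))⁻¹ t := by
  have hG := isDensity_stretchedGaussian hq hb
  have hGc := continuous_stretchedGaussian (q := q) (b := b) (by linarith)
  have hz := quantile_mem_profileSupport hq hb ht
  have hcdf := cdf_quantile _ (continuous_cdf hG hGc) ht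
  refine HasDerivAt.of_local_left_inverse
    (f := cdf (densityMeasure (stretchedGaussian q b))) ?_ (hasDerivAt_cdf hG hGc _)
    (stretchedGaussian_pos hq hb hz).ne' ?_
  · refine continuousAt_of_monotoneOn_of_image_mem_nhds (monotoneOn_quantile _)
      (isOpen_Ioo.mem_nhds ht) (mem_of_superset
        ((isOpen_profileSupport (by linarith)).mem_nhds hz) fun z hz => ?_)
    exact ⟨_, cdf_mem_Ioo hG hGc (stretchedGaussian_pos hq hb hz),
      quantile_cdf_stretchedGaussian hq hb hz⟩
  · filter_upwards [isOpen_Ioo.mem_nhds ht] with s hs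
    exact cdf_quantile _ (continuous_cdf hG hGc) hs

/-- `Z ∘ F` has derivative `f / G(Z ∘ F)`, and `f` is a constant times `profile(Z ∘ F)^(1/α)`.
Composing with `escortMap`, whose derivative is `profile^(1-1/α)`, therefore gives a function of
constant slope. The sign conditions remove the translation. -/
theorem eq_rescale_of_ae_eq (hq : 1 ≤ q) (hb : 1 < b * (q + 1)) (hα : 0 < α) (hf : IsDensity f)
    (hc : Continuous f) {ρ : ℝ → ℝ} (hρ : IsEscort q b α ρ) {k : ℝ} (hk : 0 < k)
    (h : ∀ᵐ t ∂unitMeasure, f (densityQuantile f t) ^ α =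
        k * stretchedGaussian q b (densityQuantile (stretchedGaussian q b) t) ∧
      (0 < densityQuantile f t → 0 ≤ densityQuantile (stretchedGaussian q b) t) ∧
      (densityQuantile f t ≤ 0 → densityQuantile (stretchedGaussian q b) t ≤ 0)) :
    ∃ κ : ℝ, 0 < κ ∧ f = rescale κ ρ := by
  have hq0 : 0 < q := by linarith
  have hG := isDensity_stretchedGaussian hq hb
  have hGc := continuous_stretchedGaussian (q := q) (b := b) hq0
  have hN := normConst_pos hq hb
  have := hf.isProbabilityMeasure
  have := hG.isProbabilityMeasure
  have hFc := continuous_cdf hf hc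
  set F := cdf (densityMeasure f) with hF
  set Z := densityQuantile (stretchedGaussian q b) with hZ
  set U : Set ℝ := {x | F x ∈ Ioo (0 : ℝ) 1} with hU
  have hUo : IsOpen U := isOpen_Ioo.preimage hFc
  have hUc : U.OrdConnected := ordConnected_Ioo.preimage_mono (monotone_cdf _)
  have hmeasζ : Measurable fun x => Z (F x) := (measurable_quantile _).comp hFc.measurable
  -- the almost everywhere identities on the line
  have hae : ∀ᵐ x, 0 < f x → f x ^ α = k * stretchedGaussian q b (Z (F x)) ∧
      (0 < x → 0 ≤ Z (F x)) ∧ (x ≤ 0 → Z (F x) ≤ 0) := by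
    rw [← hf.ae_densityMeasure_iff, ← map_quantile (densityMeasure f),
      ae_map_iff (measurable_quantile _).aemeasurable]
    · filter_upwards [h, ae_unitMeasure_mem] with t ht ht01
      rwa [hF, cdf_quantile _ hFc ht01]
    · refine (measurableSet_eq_fun (hf.measurable.pow_const _)
        ((hGc.measurable.comp hmeasζ).const_mul k)).inter (MeasurableSet.inter ?_ ?_)
      · simp_rw [imp_iff_not_or]
        exact (measurableSet_lt measurable_const measurable_id).compl.union
          (measurableSet_le measurable_const hmeasζ)
      · simp_rw [imp_iff_not_or]
        exact (measurableSet_le measurable_id measurable_const).compl.union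
          (measurableSet_le hmeasζ measurable_const)
  have hζS : ∀ x ∈ U, Z (F x) ∈ profileSupport q b := fun x hx =>
    quantile_mem_profileSupport hq hb hx
  have hζd : ∀ x ∈ U, HasDerivAt (fun y => Z (F y))
      ((stretchedGaussian q b (Z (F x)))⁻¹ * f x) x := fun x hx =>
    (hasDerivAt_quantile_stretchedGaussian hq hb hx).comp x (hasDerivAt_cdf hf hc x)
  have hgc : ∀ x ∈ U, ContinuousAt (fun y => k * stretchedGaussian q b (Z (F y))) x := fun x hx =>
    continuousAt_const.mul (hGc.continuousAt.comp (hζd x hx).continuousAt)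
  have hfc : Continuous fun x => f x ^ α := hc.rpow_const fun _ => Or.inr hα.le
  have hVo : IsOpen {x | 0 < f x} := isOpen_lt continuous_const hc
  have hVU : {x | 0 < f x} ⊆ U := fun x hx => cdf_mem_Ioo hf hc hx
  have hEqV : EqOn (fun x => f x ^ α) (fun y => k * stretchedGaussian q b (Z (F y)))
      {x | 0 < f x} := by
    refine Measure.eqOn_open_of_ae_eq (μ := volume) ?_ hVo hfc.continuousOn
      fun x hx => (hgc x (hVU hx)).continuousWithinAt
    rw [EventuallyEq, ae_restrict_iff' hVo.measurableSet]
    exact hae.mono fun x hx hx0 => (hx hx0).1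
  -- The support is open, and relatively closed in the interval `U`: at a limit point in `U` the
  -- identity persists by continuity, and its right side is positive.
  have hUV : U ⊆ {x | 0 < f x} := by
    refine hUc.isPreconnected.subset_of_closure_inter_subset hVo
      (hf.exists_pos.imp fun x hx => ⟨hVU hx, hx⟩) ?_
    rintro x ⟨hx, hxU⟩
    have hfr := (mem_closure_iff_frequently.1 hx).mono fun y hy => sub_eq_zero.2 (hEqV hy)
    have hlim : Tendsto (fun y => f y ^ α - k * stretchedGaussian q b (Z (F y))) (𝓝 x) (𝓝 _) :=
      (hfc.continuousAt.sub (hgc x hxU)).tendsto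
    have h0 : f x ^ α - k * stretchedGaussian q b (Z (F x)) = 0 :=
      isClosed_singleton.mem_of_frequently_of_tendsto (s := {0}) hfr hlim
    have hpos := mul_pos hk (stretchedGaussian_pos hq hb (hζS x hxU))
    refine lt_of_le_of_ne (hf.nonneg x) fun hx0 => ?_
    rw [← hx0, Real.zero_rpow hα.ne'] at h0
    linarith
  have hfU : ∀ x ∈ U, f x = (k * normConst q b) ^ (1 / α) * profile q b (Z (F x)) ^ (1 / α) := by
    intro x hx
    have h1 := hEqV (hUV hx)
    simp only [stretchedGaussian_eq] at h1
    rw [← Real.mul_rpow (by positivity) (profile_nonneg _), mul_assoc, ← h1,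
      ← Real.rpow_mul (hf.nonneg x), mul_one_div_cancel hα.ne', Real.rpow_one]
  -- The constant slope of `escortMap (Z (F x))`.
  set κ := (k * normConst q b) ^ (1 / α) / normConst q b with hκ
  have hκ0 : 0 < κ := by positivity
  have hWd : ∀ x ∈ U, HasDerivAt (fun y => escortMap q b α (Z (F y)) - κ * y) 0 x := by
    intro x hx
    have hp := profile_pos (hζS x hx)
    refine (((hasDerivAt_escortMap hq0 (hζS x hx)).comp x (hζd x hx)).sub
      ((hasDerivAt_id x).const_mul κ)).congr_deriv ?_
    rw [hfU x hx, stretchedGaussian_eq, Real.rpow_sub hp, Real.rpow_one, hκ]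
    have := (Real.rpow_pos_of_pos hp (1 / α)).ne'
    field_simp
    ring
  have hconst : ∀ x ∈ U, ∀ y ∈ U, escortMap q b α (Z (F x)) - κ * x =
      escortMap q b α (Z (F y)) - κ * y := fun x hx y hy =>
    hUo.is_const_of_deriv_eq_zero hUc.isPreconnected
      (fun x hx => (hWd x hx).differentiableAt.differentiableWithinAt)
      (fun x hx => (hWd x hx).deriv) hx hy
  have hsurj : ∀ z ∈ profileSupport q b, ∃ x ∈ U, Z (F x) = z := by
    intro z hz
    have ht := cdf_mem_Ioo hG hGc (stretchedGaussian_pos hq hb hz)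
    refine ⟨densityQuantile f (cdf (densityMeasure (stretchedGaussian q b)) z), ?_, ?_⟩
    · change F _ ∈ Ioo (0 : ℝ) 1
      rwa [hF, cdf_quantile _ hFc ht]
    · rw [hF, cdf_quantile _ hFc ht]
      exact quantile_cdf_stretchedGaussian hq hb hz
  have hmono := strictMonoOn_escortMap (q := q) (b := b) (α := α) hq0
  have h0S := zero_mem_profileSupport (b := b) hq0
  obtain ⟨x₀, hx₀, hZ₀⟩ := hsurj 0 h0S
  have hWx : ∀ x ∈ U, escortMap q b α (Z (F x)) = κ * (x - x₀) := by
    intro x hx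
    have := hconst x hx x₀ hx₀
    rw [hZ₀, escortMap_zero] at this
    linarith
  -- If `x₀ ≠ 0`, then between `0` and `x₀` the sign of `Z (F x)` prescribed by `x` contradicts that
  -- of `κ (x - x₀)`.
  have hx₀0 : x₀ = 0 := by
    rcases lt_trichotomy x₀ 0 with hlt | heq | hgt
    · obtain ⟨x, hx, hP⟩ := exists_mem_Ioo_of_ae hae (O := U ∩ Ioo x₀ 0) (hUo.inter isOpen_Ioo) (by
        have := inter_mem (mem_nhdsWithin_of_mem_nhds (hUo.mem_nhds hx₀))
          (Ioo_mem_nhdsGT hlt)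
        exact Filter.nonempty_of_mem this)
      have h1 := (hP (hUV hx.1)).2.2 hx.2.2.le
      have h2 := (hmono.le_iff_le (hζS x hx.1) h0S).2 h1
      rw [hWx x hx.1, escortMap_zero] at h2
      have := mul_pos hκ0 (sub_pos.2 hx.2.1)
      linarith
    · exact heq
    · obtain ⟨x, hx, hP⟩ := exists_mem_Ioo_of_ae hae (O := U ∩ Ioo 0 x₀) (hUo.inter isOpen_Ioo) (by
        have := inter_mem (mem_nhdsWithin_of_mem_nhds (hUo.mem_nhds hx₀))
          (Ioo_mem_nhdsLT hgt)
        exact Filter.nonempty_of_mem this)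
      have h1 := (hP (hUV hx.1)).2.1 hx.2.1
      have h2 := (hmono.le_iff_le h0S (hζS x hx.1)).2 h1
      rw [hWx x hx.1, escortMap_zero] at h2
      have := mul_pos hκ0 (sub_pos.2 hx.2.2)
      linarith
  simp only [hx₀0, sub_zero] at hWx
  refine ⟨κ, hκ0, funext fun x => ?_⟩
  rw [rescale]
  by_cases hx : x ∈ U
  · rw [← hWx x hx, hρ.eq_of_mem _ (hζS x hx), hfU x hx, hκ]
    field_simp
  · rw [hρ.eq_zero, mul_zero]
    · exact le_antisymm (not_lt.1 fun h => hx (hVU h)) (hf.nonneg x)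
    · rintro ⟨z, hz, hzx⟩
      obtain ⟨y, hy, rfl⟩ := hsurj z hz
      rw [hWx y hy] at hzx
      exact hx (mul_left_cancel₀ hκ0.ne' hzx ▸ hy)

end Rigidity

/-! ### Properties of the extremal densities -/

section Extremal

variable {q b α κ : ℝ} {ρ : ℝ → ℝ}

lemma hasDerivAt_scaledEscortMap (hq : 0 < q) {z : ℝ} (hz : z ∈ profileSupport q b) (κ : ℝ) :
    HasDerivAt (fun z => escortMap q b α z / κ) (profile q b z ^ (1 - 1 / α) / κ) z :=
  (hasDerivAt_escortMap hq hz).div_const κ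

lemma strictMonoOn_scaledEscortMap (hq : 0 < q) (hκ : 0 < κ) :
    StrictMonoOn (fun z => escortMap q b α z / κ) (profileSupport q b) := fun _ hx _ hy hxy =>
  div_lt_div_of_pos_right (strictMonoOn_escortMap hq hx hy hxy) hκ

lemma continuousOn_scaledEscortMap (hq : 0 < q) (κ : ℝ) :
    ContinuousOn (fun z => escortMap q b α z / κ) (profileSupport q b) :=
  (continuousOn_escortMap hq).div_const κ

lemma isOpen_image_scaledEscortMap (hq : 0 < q) (hκ : 0 < κ) :
    IsOpen ((fun z => escortMap q b α z / κ) '' profileSupport q b) :=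
  isOpen_image_of_strictMonoOn (isOpen_profileSupport hq) (ordConnected_profileSupport hq)
    (strictMonoOn_scaledEscortMap hq hκ) (continuousOn_scaledEscortMap hq κ)

lemma IsEscort.rescale_eq (hρ : IsEscort q b α ρ) (hκ : 0 < κ) {z : ℝ}
    (hz : z ∈ profileSupport q b) :
    rescale κ ρ (escortMap q b α z / κ) = κ * normConst q b * profile q b z ^ (1 / α) := by
  rw [rescale, mul_div_cancel₀ _ hκ.ne', hρ.eq_of_mem z hz, mul_assoc]

lemma IsEscort.rescale_eq_zero (hρ : IsEscort q b α ρ) (hκ : 0 < κ) {x : ℝ}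
    (hx : x ∉ (fun z => escortMap q b α z / κ) '' profileSupport q b) : rescale κ ρ x = 0 := by
  rw [rescale, hρ.eq_zero, mul_zero]
  rintro ⟨z, hz, hzx⟩
  exact hx ⟨z, hz, by simp only [hzx]; field_simp⟩

lemma IsEscort.rescale_nonneg (hρ : IsEscort q b α ρ) (hq : 1 ≤ q) (hb : 1 < b * (q + 1))
    (hκ : 0 < κ) (x : ℝ) : 0 ≤ rescale κ ρ x := by
  by_cases hx : x ∈ (fun z => escortMap q b α z / κ) '' profileSupport q b
  · obtain ⟨z, hz, rfl⟩ := hx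
    rw [hρ.rescale_eq hκ hz]
    have := normConst_pos hq hb
    have := profile_pos hz
    positivity
  · exact (hρ.rescale_eq_zero hκ hx).ge

/-- The inverse of the transport map. -/
noncomputable def escortInv (q b α κ : ℝ) : ℝ → ℝ :=
  Function.invFunOn (fun z => escortMap q b α z / κ) (profileSupport q b)

lemma escortInv_apply (hq : 0 < q) (hκ : 0 < κ) {z : ℝ} (hz : z ∈ profileSupport q b) :
    escortInv q b α κ (escortMap q b α z / κ) = z :=
  invFunOn_image_eq (strictMonoOn_scaledEscortMap hq hκ) hz

lemma hasDerivAt_escortInv (hq : 0 < q) (hκ : 0 < κ) {z : ℝ} (hz : z ∈ profileSupport q b) :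
    HasDerivAt (escortInv q b α κ) (profile q b z ^ (1 - 1 / α) / κ)⁻¹
      (escortMap q b α z / κ) :=
  hasDerivAt_invFunOn (isOpen_profileSupport hq) (ordConnected_profileSupport hq)
    (strictMonoOn_scaledEscortMap hq hκ) (continuousOn_scaledEscortMap hq κ) hz
    (hasDerivAt_scaledEscortMap hq hz κ)
    (div_pos (Real.rpow_pos_of_pos (profile_pos hz) _) hκ).ne'

lemma IsEscort.rescale_eqOn (hρ : IsEscort q b α ρ) (hq : 0 < q) (hκ : 0 < κ) :
    EqOn (rescale κ ρ)
      (fun x => κ * normConst q b * profile q b (escortInv q b α κ x) ^ (1 / α))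
      ((fun z => escortMap q b α z / κ) '' profileSupport q b) := by
  rintro _ ⟨z, hz, rfl⟩
  simp only [hρ.rescale_eq hκ hz, escortInv_apply hq hκ hz]

lemma IsEscort.continuousOn_rescale (hρ : IsEscort q b α ρ) (hq : 0 < q) (hκ : 0 < κ) :
    ContinuousOn (rescale κ ρ) ((fun z => escortMap q b α z / κ) '' profileSupport q b) := by
  refine ContinuousOn.congr ?_ (hρ.rescale_eqOn hq hκ)
  rintro _ ⟨z, hz, rfl⟩
  refine ContinuousAt.continuousWithinAt (continuousAt_const.mul
    (ContinuousAt.rpow_const ((continuous_profile hq).continuousAt.comp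
      (hasDerivAt_escortInv hq hκ hz).continuousAt) (Or.inl ?_)))
  simp only [escortInv_apply hq hκ hz]
  exact (profile_pos hz).ne'

lemma IsEscort.measurable_rescale (hρ : IsEscort q b α ρ) (hq : 0 < q) (hκ : 0 < κ) :
    Measurable (rescale κ ρ) := by
  classical
  have hO := isOpen_image_scaledEscortMap (b := b) (α := α) hq hκ
  have h := (hρ.continuousOn_rescale hq hκ).measurable_piecewise (g := fun _ => 0)
    continuousOn_const hO.measurableSet
  convert h using 1
  ext x
  by_cases hx : x ∈ (fun z => escortMap q b α z / κ) '' profileSupport q b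
  · rw [piecewise_eq_of_mem _ _ _ hx]
  · rw [piecewise_eq_of_notMem _ _ _ hx, hρ.rescale_eq_zero hκ hx]

/-- Change of variables `x = escortMap z / κ`: density times Jacobian is `κ N profile^(1/α) ·
profile^(1-1/α) / κ`, the stretched Gaussian itself (`N = normConst q b`). -/
lemma IsEscort.lintegral_rescale_mul (hρ : IsEscort q b α ρ) (hq : 1 ≤ q)
    (hb : 1 < b * (q + 1)) (hκ : 0 < κ) (g : ℝ → ℝ≥0∞) :
    ∫⁻ x, ENNReal.ofReal (rescale κ ρ x) * g x =
      ∫⁻ z, ENNReal.ofReal (stretchedGaussian q b z) * g (escortMap q b α z / κ) := by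
  have hq0 : 0 < q := by linarith
  have hN := normConst_pos hq hb
  have hS := (isOpen_profileSupport (b := b) hq0).measurableSet
  have hO := (isOpen_image_scaledEscortMap (b := b) (α := α) hq0 hκ).measurableSet
  have h1 : ∫⁻ x, ENNReal.ofReal (rescale κ ρ x) * g x =
      ∫⁻ x in (fun z => escortMap q b α z / κ) '' profileSupport q b,
        ENNReal.ofReal (rescale κ ρ x) * g x := by
    rw [← lintegral_indicator hO]
    refine lintegral_congr fun x => ?_
    by_cases hx : x ∈ (fun z => escortMap q b α z / κ) '' profileSupport q b
    · rw [indicator_of_mem hx]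
    · rw [indicator_of_notMem hx, hρ.rescale_eq_zero hκ hx, ENNReal.ofReal_zero, zero_mul]
  have h2 : ∫⁻ z, ENNReal.ofReal (stretchedGaussian q b z) * g (escortMap q b α z / κ) =
      ∫⁻ z in profileSupport q b,
        ENNReal.ofReal (stretchedGaussian q b z) * g (escortMap q b α z / κ) := by
    rw [← lintegral_indicator hS]
    refine lintegral_congr fun z => ?_
    by_cases hz : z ∈ profileSupport q b
    · rw [indicator_of_mem hz]
    · rw [indicator_of_notMem hz, stretchedGaussian_eq, profile_eq_zero hz, mul_zero,
        ENNReal.ofReal_zero, zero_mul]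
  rw [h1, h2, lintegral_image_eq_lintegral_deriv_mul_of_monotoneOn hS
    (fun z hz => (hasDerivAt_scaledEscortMap hq0 hz κ).hasDerivWithinAt)
    (strictMonoOn_scaledEscortMap hq0 hκ).monotoneOn]
  refine setLIntegral_congr_fun hS fun z hz => ?_
  have hp := profile_pos hz
  rw [hρ.rescale_eq hκ hz, ← mul_assoc, ← ENNReal.ofReal_mul (by positivity), stretchedGaussian_eq]
  congr 2
  rw [Real.rpow_sub hp, Real.rpow_one]
  have := (Real.rpow_pos_of_pos hp (1 / α)).ne'
  field_simp

lemma IsEscort.isDensity_rescale (hρ : IsEscort q b α ρ) (hq : 1 ≤ q) (hb : 1 < b * (q + 1))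
    (hκ : 0 < κ) : IsDensity (rescale κ ρ) where
  measurable := hρ.measurable_rescale (by linarith) hκ
  nonneg := hρ.rescale_nonneg hq hb hκ
  lintegral_eq_one := by
    have := hρ.lintegral_rescale_mul hq hb hκ fun _ => 1
    simpa [(isDensity_stretchedGaussian hq hb).lintegral_eq_one] using this

lemma IsEscort.lintegral_densityMeasure_rescale (hρ : IsEscort q b α ρ) (hq : 1 ≤ q)
    (hb : 1 < b * (q + 1)) (hκ : 0 < κ) (g : ℝ → ℝ≥0∞) :
    ∫⁻ x, g x ∂densityMeasure (rescale κ ρ) =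
      ∫⁻ z, g (escortMap q b α z / κ) ∂densityMeasure (stretchedGaussian q b) := by
  rw [(hρ.isDensity_rescale hq hb hκ).lintegral_densityMeasure,
    (isDensity_stretchedGaussian hq hb).lintegral_densityMeasure,
    hρ.lintegral_rescale_mul hq hb hκ]

lemma aemeasurable_escortMap (hq : 1 ≤ q) (hb : 1 < b * (q + 1)) :
    AEMeasurable (fun z => escortMap q b α z / κ) (densityMeasure (stretchedGaussian q b)) := by
  have hq0 : 0 < q := by linarith
  rw [← Measure.restrict_eq_self_of_ae_mem (ae_mem_profileSupport hq hb)]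
  exact (continuousOn_scaledEscortMap hq0 κ).aemeasurable
    (isOpen_profileSupport hq0).measurableSet

lemma IsEscort.map_escortMap (hρ : IsEscort q b α ρ) (hq : 1 ≤ q) (hb : 1 < b * (q + 1))
    (hκ : 0 < κ) :
    (densityMeasure (stretchedGaussian q b)).map (fun z => escortMap q b α z / κ) =
      densityMeasure (rescale κ ρ) := by
  ext s hs
  rw [← lintegral_indicator_one hs, lintegral_map' (measurable_one.indicator hs).aemeasurable
    (aemeasurable_escortMap hq hb), ← lintegral_indicator_one hs,
    hρ.lintegral_densityMeasure_rescale hq hb hκ]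

lemma IsEscort.hasDerivAt_rescale (hρ : IsEscort q b α ρ) (hq : 1 ≤ q) (hκ : 0 < κ) {z : ℝ}
    (hz : z ∈ profileSupport q b) (h : 1 < q ∨ z ≠ 0) :
    HasDerivAt (rescale κ ρ)
      (-(κ ^ 2 * normConst q b / α * profile q b z ^ (2 / α - b) * (q * |z| ^ (q - 2) * z)))
      (escortMap q b α z / κ) := by
  have hq0 : 0 < q := by linarith
  have hp := profile_pos hz
  have hinv := hasDerivAt_escortInv (α := α) hq0 hκ hz
  have hO := (isOpen_image_scaledEscortMap (b := b) (α := α) hq0 hκ).mem_nhds ⟨z, hz, rfl⟩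
  have hd : HasDerivAt (profile q b) (-(profile q b z ^ (2 - b) * (q * |z| ^ (q - 2) * z)))
      (escortInv q b α κ (escortMap q b α z / κ)) := by
    rw [escortInv_apply hq0 hκ hz]
    exact hasDerivAt_profile hz h
  have h1 : HasDerivAt (fun x => κ * normConst q b * profile q b (escortInv q b α κ x) ^ (1 / α))
      _ (escortMap q b α z / κ) :=
    ((hd.comp _ hinv).rpow_const (p := 1 / α) (Or.inl (by
      simp only [Function.comp_apply, escortInv_apply hq0 hκ hz]
      exact hp.ne'))).const_mul (κ * normConst q b)
  refine (h1.congr_of_eventuallyEq ((hρ.rescale_eqOn hq0 hκ).eventuallyEq_of_mem hO)).congr_deriv ?_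
  simp only [Function.comp_apply, escortInv_apply hq0 hκ hz]
  have he : profile q b z ^ (2 / α - b) =
      profile q b z ^ (2 - b) * profile q b z ^ (1 / α - 1) / profile q b z ^ (1 - 1 / α) := by
    rw [← Real.rpow_add hp, ← Real.rpow_sub hp]
    congr 1
    ring
  rw [he]
  field_simp

/-- In the coordinate `z` all powers of the profile cancel, leaving the score as a multiple of
`|z|^(q-1)`. Together with `absCumul_rescale`, this is equality in both applications of Hölder. -/
lemma IsEscort.rpow_mul_deriv_rescale (hρ : IsEscort q b α ρ) (hq : 1 ≤ q)
    (hb : 1 < b * (q + 1)) (hα : 0 < α) (hκ : 0 < κ) {z : ℝ} (hz : z ∈ profileSupport q b)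
    (hz0 : z ≠ 0) :
    ‖rescale κ ρ (escortMap q b α z / κ) ^ (α * b - 2) *
        deriv (rescale κ ρ) (escortMap q b α z / κ)‖ =
      ‖κ ^ (α * b) * normConst q b ^ (α * b - 1) * q / α * |z| ^ (q - 1)‖ := by
  have hN := normConst_pos hq hb
  have hp := profile_pos hz
  rw [(hρ.hasDerivAt_rescale hq hκ hz (Or.inr hz0)).deriv, hρ.rescale_eq hκ hz,
    Real.norm_eq_abs, Real.norm_eq_abs, abs_mul _ (|z| ^ (q - 1)), ← abs_abs_rpow_mul hz0, abs_abs,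
    ← abs_mul, ← abs_neg]
  congr 1
  have he : (profile q b z ^ (1 / α)) ^ (α * b - 2) * profile q b z ^ (2 / α - b) = 1 := by
    rw [← Real.rpow_mul hp.le, ← Real.rpow_add hp]
    rw [show 1 / α * (α * b - 2) + (2 / α - b) = 0 by field_simp; ring, Real.rpow_zero]
  rw [Real.mul_rpow (by positivity) (by positivity), Real.mul_rpow hκ.le hN.le,
    show κ ^ (α * b) = κ ^ (α * b - 2) * κ ^ 2 by
      rw [← Real.rpow_two, ← Real.rpow_add hκ]; ring_nf,
    show normConst q b ^ (α * b - 1) = normConst q b ^ (α * b - 2) * normConst q b by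
      rw [← Real.rpow_add_one hN.ne']; ring_nf]
  linear_combination κ ^ (α * b - 2) * normConst q b ^ (α * b - 2) * κ ^ 2 * normConst q b / α *
    (q * |z| ^ (q - 2) * z) * he

/-- `(q - 1) p = q` reduces this to the `q`-th moment; for `p = ∞` the function is constantly `1`.
-/
lemma eLpNorm_abs_rpow_sub_one {p : ℝ≥0∞} (hp : 1 < p) (hqp : q = (dual p).toReal)
    (hb : 1 < b * (q + 1)) :
    eLpNorm (fun z : ℝ => |z| ^ (q - 1)) p (densityMeasure (stretchedGaussian q b)) =
      ENNReal.ofReal (1 / (b * q + b - 1)) ^ (1 - 1 / q) := by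
  have hq : 1 ≤ q := hqp ▸ one_le_toReal_dual hp
  have hG := isDensity_stretchedGaussian hq hb
  have := hG.isProbabilityMeasure
  by_cases htop : p = ∞
  · have : q = 1 := by rw [hqp, htop]; simp [dual]
    subst this
    rw [htop]
    simp [eLpNorm_const _ ENNReal.top_ne_zero (IsProbabilityMeasure.ne_zero _)]
  · have hp0 : p ≠ 0 := (zero_lt_one.trans hp).ne'
    have hpr : 1 < p.toReal := by
      rw [← ENNReal.toReal_one]
      exact (ENNReal.toReal_lt_toReal ENNReal.one_ne_top htop).2 hp
    have hinv : 1 / q = 1 - 1 / p.toReal := by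
      rw [hqp, dual, ENNReal.toReal_inv, one_div, inv_inv, ENNReal.toReal_sub_of_le
        (ENNReal.inv_le_one.2 hp.le) ENNReal.one_ne_top, ENNReal.toReal_one, ENNReal.toReal_inv,
        one_div]
    have hqp' : (q - 1) * p.toReal = q := by
      have hq0 : q ≠ 0 := by linarith
      have hp0' : p.toReal ≠ 0 := by linarith
      field_simp at hinv
      linarith
    rw [eLpNorm_eq_lintegral_rpow_enorm_toReal hp0 htop,
      ← lintegral_enorm_rpow_stretchedGaussian hq hb, show 1 - 1 / q = 1 / p.toReal by linarith]
    congr 1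
    refine lintegral_congr fun z => ?_
    rw [Real.enorm_of_nonneg (by positivity), Real.enorm_eq_ofReal_abs,
      ← ENNReal.ofReal_rpow_of_nonneg (abs_nonneg z) (by linarith), ← ENNReal.rpow_mul, hqp']

lemma IsEscort.eLpNorm_score (hρ : IsEscort q b α ρ) {p : ℝ≥0∞} (hp : 1 < p)
    (hqp : q = (dual p).toReal) (hb : 1 < b * (q + 1)) (hα : 0 < α) (hκ : 0 < κ) :
    eLpNorm (fun x => rescale κ ρ x ^ (α * b - 2) * deriv (rescale κ ρ) x) p
        (densityMeasure (rescale κ ρ)) =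
      ENNReal.ofReal (κ ^ (α * b) * normConst q b ^ (α * b - 1) * q / α *
        (1 / (b * q + b - 1)) ^ (1 - 1 / q)) := by
  have hq : 1 ≤ q := hqp ▸ one_le_toReal_dual hp
  have hμ : 0 < 1 / (b * q + b - 1) := one_div_pos.2 (by linarith)
  have hN := normConst_pos hq hb
  have hm : Measurable fun x => rescale κ ρ x ^ (α * b - 2) * deriv (rescale κ ρ) x :=
    ((hρ.measurable_rescale (by linarith) hκ).pow_const _).mul (measurable_deriv _)
  rw [← hρ.map_escortMap hq hb hκ, eLpNorm_map_measure hm.aestronglyMeasurable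
    (aemeasurable_escortMap hq hb)]
  have h0 : ∀ᵐ z ∂densityMeasure (stretchedGaussian q b), z ≠ 0 :=
    (withDensity_absolutelyContinuous _ _).ae_le (Measure.ae_ne volume 0)
  rw [eLpNorm_congr_norm_ae (g := (κ ^ (α * b) * normConst q b ^ (α * b - 1) * q / α) •
      fun z : ℝ => |z| ^ (q - 1)), eLpNorm_const_smul, eLpNorm_abs_rpow_sub_one hp hqp hb,
    Real.enorm_of_nonneg (by positivity), ENNReal.ofReal_rpow_of_pos hμ,
    ← ENNReal.ofReal_mul (by positivity)]
  filter_upwards [h0, ae_mem_profileSupport hq hb] with z hz0 hz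
  exact hρ.rpow_mul_deriv_rescale hq hb hα hκ hz hz0

/-- Pulled back to `z`, the weight `(rescale κ ρ)^(-α)` is a multiple of `1/profile`, which
integrates against the stretched Gaussian to length. -/
lemma IsEscort.absCumul_rescale (hρ : IsEscort q b α ρ) (hq : 1 ≤ q)
    (hb : 1 < b * (q + 1)) (hα : 0 < α) (hκ : 0 < κ) {z : ℝ} (hz : z ∈ profileSupport q b) :
    absCumul α (rescale κ ρ) (escortMap q b α z / κ) =
      ENNReal.ofReal (κ ^ (-α) * normConst q b ^ (1 - α)) * ‖z‖ₑ := by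
  have hq0 : 0 < q := by linarith
  have hN := normConst_pos hq hb
  have hG := isDensity_stretchedGaussian hq hb
  have hf := hρ.isDensity_rescale hq hb hκ
  have hmono := strictMonoOn_scaledEscortMap (q := q) (b := b) (α := α) hq0 hκ
  have h0S := zero_mem_profileSupport (b := b) hq0
  have hT0 : escortMap q b α 0 / κ = 0 := by rw [escortMap_zero, zero_div]
  rw [← setLIntegral_rpow_neg hf, ← lintegral_indicator measurableSet_uIcc,
    hρ.lintegral_densityMeasure_rescale hq hb hκ]
  have h1 : ∫⁻ y, (uIcc 0 (escortMap q b α z / κ)).indicator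
      (fun x => ENNReal.ofReal (rescale κ ρ x ^ (-α))) (escortMap q b α y / κ)
      ∂densityMeasure (stretchedGaussian q b) =
      ∫⁻ y in uIcc 0 z, ENNReal.ofReal ((κ * normConst q b) ^ (-α) * (profile q b y)⁻¹)
        ∂densityMeasure (stretchedGaussian q b) := by
    rw [← lintegral_indicator measurableSet_uIcc]
    refine lintegral_congr_ae ?_
    filter_upwards [ae_mem_profileSupport hq hb] with y hy
    have hp := profile_pos hy
    have hiff : escortMap q b α y / κ ∈ uIcc 0 (escortMap q b α z / κ) ↔ y ∈ uIcc 0 z := by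
      have e1 := hmono.le_iff_le h0S hy
      have e2 := hmono.le_iff_le hy hz
      have e3 := hmono.le_iff_le hz hy
      have e4 := hmono.le_iff_le hy h0S
      simp only [hT0] at e1 e2 e3 e4
      rw [mem_uIcc, mem_uIcc, e1, e2, e3, e4]
    by_cases hyz : y ∈ uIcc 0 z
    · rw [indicator_of_mem (hiff.2 hyz), indicator_of_mem hyz, hρ.rescale_eq hκ hy,
        Real.mul_rpow (by positivity) (by positivity), ← Real.rpow_mul hp.le,
        show 1 / α * -α = -1 by field_simp, Real.rpow_neg_one]
    · rw [indicator_of_notMem fun h => hyz (hiff.1 h), indicator_of_notMem hyz]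
  rw [h1, hG.setLIntegral_densityMeasure _ measurableSet_uIcc]
  have h2 : ∫⁻ y in uIcc 0 z, ENNReal.ofReal (stretchedGaussian q b y) *
      ENNReal.ofReal ((κ * normConst q b) ^ (-α) * (profile q b y)⁻¹) =
      ∫⁻ _ in uIcc 0 z, ENNReal.ofReal (κ ^ (-α) * normConst q b ^ (1 - α)) := by
    refine setLIntegral_congr_fun measurableSet_uIcc fun y hy => ?_
    have hp := profile_pos (uIcc_subset_profileSupport hq0 hz hy)
    rw [stretchedGaussian_eq, ← ENNReal.ofReal_mul (by positivity), Real.mul_rpow hκ.le hN.le,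
      show 1 - α = -α + 1 by ring, Real.rpow_add_one hN.ne']
    congr 1
    field_simp
  rw [h2, setLIntegral_const, Real.volume_interval, sub_zero, Real.enorm_eq_ofReal_abs]

lemma IsEscort.eLpNorm_absCumul (hρ : IsEscort q b α ρ) {p : ℝ≥0∞} (hp : 1 < p)
    (hqp : q = (dual p).toReal) (hb : 1 < b * (q + 1)) (hα : 0 < α) (hκ : 0 < κ) :
    eLpNorm (absCumul α (rescale κ ρ)) (dual p) (densityMeasure (rescale κ ρ)) =
      ENNReal.ofReal (κ ^ (-α) * normConst q b ^ (1 - α) *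
        (1 / (b * q + b - 1)) ^ (1 / q)) := by
  have hq : 1 ≤ q := hqp ▸ one_le_toReal_dual hp
  have hμ : 0 < 1 / (b * q + b - 1) := one_div_pos.2 (by linarith)
  have hN := normConst_pos hq hb
  have hq0 : 0 < q := by linarith
  rw [eLpNorm_dual_eq hp, ← hqp, hρ.lintegral_densityMeasure_rescale hq hb hκ]
  have h1 : ∫⁻ z, ‖absCumul α (rescale κ ρ) (escortMap q b α z / κ)‖ₑ ^ q
      ∂densityMeasure (stretchedGaussian q b) =
      ENNReal.ofReal (κ ^ (-α) * normConst q b ^ (1 - α)) ^ q *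
        ENNReal.ofReal (1 / (b * q + b - 1)) := by
    rw [← lintegral_enorm_rpow_stretchedGaussian hq hb, ← lintegral_const_mul' _ _
      (ENNReal.rpow_ne_top_of_nonneg hq0.le ENNReal.ofReal_ne_top)]
    refine lintegral_congr_ae ?_
    filter_upwards [ae_mem_profileSupport hq hb] with z hz
    rw [hρ.absCumul_rescale hq hb hα hκ hz, enorm_eq_self, ENNReal.mul_rpow_of_nonneg _ _ hq0.le]
  rw [h1, ENNReal.mul_rpow_of_nonneg _ _ (by positivity), ← ENNReal.rpow_mul,
    mul_one_div_cancel hq0.ne', ENNReal.rpow_one, ENNReal.ofReal_rpow_of_pos hμ,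
    ← ENNReal.ofReal_mul (by positivity)]

theorem IsEscort.eq_sharpConst (hρ : IsEscort q b α ρ) {p : ℝ≥0∞} (hp : 1 < p)
    (hqp : q = (dual p).toReal) (hb : 1 < b * (q + 1)) (hα : 0 < α) (hκ : 0 < κ) :
    eLpNorm (fun x => rescale κ ρ x ^ (α * b - 2) * deriv (rescale κ ρ) x) p
        (densityMeasure (rescale κ ρ)) *
      eLpNorm (absCumul α (rescale κ ρ)) (dual p) (densityMeasure (rescale κ ρ)) ^ b =
      ENNReal.ofReal (sharpConst q b α) := by
  have hq : 1 ≤ q := hqp ▸ one_le_toReal_dual hp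
  have hb0 : 0 < b := pos_of_mul_pos_left (by linarith) (by linarith : (0 : ℝ) ≤ q + 1)
  have hμ : 0 < 1 / (b * q + b - 1) := one_div_pos.2 (by linarith)
  have hN := normConst_pos hq hb
  have hq0 : 0 < q := by linarith
  rw [hρ.eLpNorm_score hp hqp hb hα hκ, hρ.eLpNorm_absCumul hp hqp hb hα hκ,
    ENNReal.ofReal_rpow_of_pos (by positivity), ← ENNReal.ofReal_mul (by positivity), sharpConst,
    tailConst]
  congr 1
  generalize 1 / (b * q + b - 1) = μ at hμ
  rw [Real.mul_rpow (by positivity) (by positivity), Real.mul_rpow (by positivity) (by positivity),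
    ← Real.rpow_mul hμ.le, ← Real.rpow_mul hκ.le, ← Real.rpow_mul hN.le]
  have h1 : μ ^ ((b + q - 1) / q) = μ ^ (1 - 1 / q) * μ ^ (1 / q * b) := by
    rw [← Real.rpow_add hμ]; congr 1; field_simp; ring
  have h2 : κ ^ (α * b) * κ ^ (-(α * b)) = 1 := by
    rw [← Real.rpow_add hκ, add_neg_cancel, Real.rpow_zero]
  have h3 : normConst q b ^ (b - 1) =
      normConst q b ^ (α * b - 1) * normConst q b ^ ((1 - α) * b) := by
    rw [← Real.rpow_add hN]; congr 1; ring
  rw [h1, h3]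
  field_simp
  linear_combination h2

/-! ### Regularity -/

lemma profile_le_of_abs_le (hq : 0 < q) {y z : ℝ} (h : |y| ≤ |z|) :
    profile q b z ≤ profile q b y := by
  have h1 : |y| ^ q ≤ |z| ^ q := Real.rpow_le_rpow (abs_nonneg _) h hq.le
  by_cases hz : z ∈ profileSupport q b
  swap
  · rw [profile_eq_zero hz]; exact profile_nonneg _
  have hy := mem_profileSupport_of_abs_le hq hz h
  by_cases hb : b = 1
  · subst hb
    rw [profile_one, profile_one]
    exact Real.exp_le_exp.2 (by linarith)
  · rw [profile_of_mem hb hz, profile_of_mem hb hy]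
    rcases lt_or_gt_of_ne hb with h2 | h2
    · refine Real.rpow_le_rpow_of_nonpos hy ?_ (one_div_neg.2 (sub_neg.2 h2)).le
      unfold profileBase
      nlinarith
    · refine Real.rpow_le_rpow (le_of_lt hz) ?_ (one_div_pos.2 (sub_pos.2 h2)).le
      unfold profileBase
      nlinarith

lemma isCompact_profile_ge (hq : 1 ≤ q) (hb : 1 < b * (q + 1)) {δ : ℝ} (hδ : 0 < δ) :
    IsCompact {z | δ ≤ profile q b z} := by
  have hq0 : 0 < q := by linarith
  have hN := normConst_pos hq hb
  obtain ⟨y, hy0, hy⟩ := (isDensity_stretchedGaussian hq hb).exists_gt_le 0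
    (show 0 < normConst q b * (δ / 2) by positivity)
  rw [stretchedGaussian_eq, mul_le_mul_iff_right₀ hN] at hy
  refine isCompact_Icc.of_isClosed_subset (s := Icc (-y) y)
    (isClosed_le continuous_const (continuous_profile hq0)) fun z hz => ?_
  refine abs_le.1 (le_of_not_gt fun h => ?_)
  have h1 : δ ≤ profile q b z := hz
  have h2 := profile_le_of_abs_le (b := b) hq0 (y := y) (z := z) (by rw [abs_of_pos hy0]; exact h.le)
  linarith

/-- Only points outside the image of the support need care. There the density vanishes, and its
superlevel sets, being images of compact superlevel sets of the profile, are closed and miss the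
point. -/
lemma IsEscort.continuous_rescale (hρ : IsEscort q b α ρ) (hq : 1 ≤ q) (hb : 1 < b * (q + 1))
    (hα : 0 < α) (hκ : 0 < κ) : Continuous (rescale κ ρ) := by
  have hq0 : 0 < q := by linarith
  have hN := normConst_pos hq hb
  refine continuous_iff_continuousAt.2 fun x => ?_
  by_cases hx : x ∈ (fun z => escortMap q b α z / κ) '' profileSupport q b
  · exact (hρ.continuousOn_rescale hq0 hκ).continuousAt
      ((isOpen_image_scaledEscortMap hq0 hκ).mem_nhds hx)
  have h0 := hρ.rescale_eq_zero hκ hx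
  rw [ContinuousAt, h0]
  refine tendsto_order.2 ⟨fun a ha => Eventually.of_forall fun y =>
    ha.trans_le (hρ.rescale_nonneg hq hb hκ y), fun ε hε => ?_⟩
  -- Chosen so that `rescale κ ρ ≥ ε` at the image of `z` means `profile q b z ≥ δ`.
  set δ := (ε / (κ * normConst q b)) ^ α with hδ
  have hδ0 : 0 < δ := by positivity
  have hsub : {z | δ ≤ profile q b z} ⊆ profileSupport q b := fun z hz =>
    profile_pos_iff.1 (hδ0.trans_le hz)
  have hK := (isCompact_profile_ge hq hb hδ0).image_of_continuousOn
    ((continuousOn_scaledEscortMap (α := α) hq0 κ).mono hsub)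
  have hxK : x ∉ (fun z => escortMap q b α z / κ) '' {z | δ ≤ profile q b z} := fun h =>
    hx (image_mono hsub h)
  filter_upwards [hK.isClosed.isOpen_compl.mem_nhds hxK] with y hy
  by_contra! hle
  have hyT : y ∈ (fun z => escortMap q b α z / κ) '' profileSupport q b := by
    by_contra h
    rw [hρ.rescale_eq_zero hκ h] at hle
    linarith
  obtain ⟨z, hz, rfl⟩ := hyT
  refine hy ⟨z, ?_, rfl⟩
  change δ ≤ profile q b z
  rw [hρ.rescale_eq hκ hz] at hle
  have h1 : ε / (κ * normConst q b) ≤ profile q b z ^ (1 / α) := by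
    rw [div_le_iff₀ (by positivity)]
    linarith
  have h2 := Real.rpow_le_rpow (by positivity) h1 hα.le
  rwa [← Real.rpow_mul (profile_nonneg z), one_div_mul_cancel hα.ne', Real.rpow_one] at h2

lemma continuous_abs_rpow_mul (hq : 1 < q) : Continuous fun z : ℝ => q * |z| ^ (q - 2) * z := by
  have h := (contDiff_norm_rpow (E := ℝ) hq).continuous_deriv le_rfl
  convert h using 1
  ext z
  simp only [Real.norm_eq_abs]
  exact (hasDerivAt_abs_rpow z hq).deriv.symm

lemma IsEscort.contDiffOn_rescale (hρ : IsEscort q b α ρ) (hq : 1 < q) (hκ : 0 < κ) :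
    ContDiffOn ℝ 1 (rescale κ ρ) ((fun z => escortMap q b α z / κ) '' profileSupport q b) := by
  have hq0 : 0 < q := by linarith
  have hO := isOpen_image_scaledEscortMap (b := b) (α := α) hq0 hκ
  rw [show (1 : WithTop ℕ∞) = 0 + 1 by simp, contDiffOn_succ_iff_deriv_of_isOpen hO]
  refine ⟨?_, by simp, contDiffOn_zero.2 ?_⟩
  · rintro _ ⟨z, hz, rfl⟩
    exact (hρ.hasDerivAt_rescale hq.le hκ hz
      (Or.inl hq)).differentiableAt.differentiableWithinAt
  · have hcont : ContinuousOn (fun x => -(κ ^ 2 * normConst q b / α *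
        profile q b (escortInv q b α κ x) ^ (2 / α - b) *
          (q * |escortInv q b α κ x| ^ (q - 2) * escortInv q b α κ x)))
        ((fun z => escortMap q b α z / κ) '' profileSupport q b) := by
      rintro _ ⟨z, hz, rfl⟩
      have hc := (hasDerivAt_escortInv (α := α) hq0 hκ hz).continuousAt
      refine ContinuousAt.continuousWithinAt ((ContinuousAt.mul (continuousAt_const.mul
        (ContinuousAt.rpow_const ((continuous_profile hq0).continuousAt.comp hc) (Or.inl ?_)))
        ((continuous_abs_rpow_mul hq).continuousAt.comp hc)).neg)
      simp only [Function.comp_apply, escortInv_apply hq0 hκ hz]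
      exact (profile_pos hz).ne'
    refine hcont.congr ?_
    rintro _ ⟨z, hz, rfl⟩
    simp only [(hρ.hasDerivAt_rescale hq.le hκ hz (Or.inl hq)).deriv, escortInv_apply hq0 hκ hz]

lemma rescale_one (f : ℝ → ℝ) : rescale 1 f = f := by
  ext x
  simp [rescale]

lemma IsEscort.isC1Density (hρ : IsEscort q b α ρ) (hq : 1 < q) (hb : 1 < b * (q + 1))
    (hα : 0 < α) : IsC1Density ρ := by
  rw [← rescale_one ρ]
  refine ⟨hρ.isDensity_rescale hq.le hb one_pos, hρ.continuous_rescale hq.le hb hα one_pos,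
    (hρ.contDiffOn_rescale hq one_pos).mono fun x hx => ?_⟩
  by_contra h
  exact ne_of_gt hx (hρ.rescale_eq_zero one_pos h)

end Extremal

/-! ### The minimizing densities are extremal -/

lemma profile_rpow_of_mem {q b : ℝ} (hb : b ≠ 1) {z : ℝ} (hz : z ∈ profileSupport q b) (c : ℝ) :
    profile q b z ^ c = profileBase q b z ^ (1 / (b - 1) * c) := by
  rw [profile_of_mem hb hz, ← Real.rpow_mul (le_of_lt hz)]

lemma isEscort_stretchedGaussian {q b : ℝ} : IsEscort q b 1 (stretchedGaussian q b) := by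
  have h : ∀ z, escortMap q b 1 z = z := fun z => by simp [escortMap]
  refine ⟨fun z _ => ?_, fun x hx => ?_⟩
  · rw [h, stretchedGaussian_eq, div_one, Real.rpow_one]
  · rw [stretchedGaussian_eq, profile_eq_zero, mul_zero]
    exact fun hxS => hx ⟨x, hxS, h x⟩

/-! ### Generalized trigonometric densities (`lam ≠ 1`, `lam ≠ β`). -/

section Trig

variable {q b α κ v : ℝ} {h : ℝ → ℝ}

/-- Substitute `t = κ s`. The function `h` stands for `1 - |t|^q` or `1 + |t|^q`, so both families
are treated at once: the generalized inverse sine or hyperbolic sine is `escortMap` up to scale. -/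
lemma trig_integral_eq (hq : 0 < q) (hb : b ≠ 1)
    (hh : ∀ z, h (κ * z) = profileBase q b z) (hv : -(1 / v) = 1 / (b - 1) * (1 - 1 / α)) {z : ℝ}
    (hz : z ∈ profileSupport q b) :
    ∫ t in (0 : ℝ)..(κ * z), h t ^ (-(1 / v)) = κ * escortMap q b α z := by
  have h1 := intervalIntegral.mul_integral_comp_mul_left (a := 0) (b := z)
    (f := fun t => h t ^ (-(1 / v))) κ
  rw [mul_zero] at h1
  rw [← h1, escortMap]
  congr 1
  refine intervalIntegral.integral_congr fun s hs => ?_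
  rw [hh, profile_rpow_of_mem hb (uIcc_subset_profileSupport hq hz hs), hv]

lemma trig_support (hκ : 0 < κ) (hh : ∀ z, h (κ * z) = profileBase q b z) :
    {t | 0 < h t} = (fun z => κ * z) '' profileSupport q b := by
  ext t
  constructor
  · intro ht
    refine ⟨t / κ, ?_, mul_div_cancel₀ t hκ.ne'⟩
    change 0 < profileBase q b (t / κ)
    rw [← hh, mul_div_cancel₀ t hκ.ne']
    exact ht
  · rintro ⟨z, hz, rfl⟩
    change 0 < h (κ * z)
    rw [hh]
    exact hz

lemma trig_mem_image_iff (hq : 0 < q) (hb : b ≠ 1) (hκ : 0 < κ)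
    (hh : ∀ z, h (κ * z) = profileBase q b z) (hv : -(1 / v) = 1 / (b - 1) * (1 - 1 / α)) {y : ℝ} :
    κ * y ∈ (fun x => ∫ t in (0 : ℝ)..x, h t ^ (-(1 / v))) '' {t | 0 < h t} ↔
      y ∈ escortMap q b α '' profileSupport q b := by
  rw [trig_support hκ hh, image_image]
  constructor
  · rintro ⟨z, hz, hzy⟩
    simp only [trig_integral_eq hq hb hh hv hz] at hzy
    exact ⟨z, hz, mul_left_cancel₀ hκ.ne' hzy⟩
  · rintro ⟨z, hz, rfl⟩
    exact ⟨z, hz, trig_integral_eq hq hb hh hv hz⟩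

lemma trig_deriv_invFunOn (hq : 0 < q) (hb : b ≠ 1) (hκ : 0 < κ)
    (hh : ∀ z, h (κ * z) = profileBase q b z) (hhc : Continuous h)
    (hv : -(1 / v) = 1 / (b - 1) * (1 - 1 / α)) {z : ℝ} (hz : z ∈ profileSupport q b) :
    deriv (Function.invFunOn (fun x => ∫ t in (0 : ℝ)..x, h t ^ (-(1 / v))) {t | 0 < h t})
      (κ * escortMap q b α z) = profileBase q b z ^ (1 / v) := by
  have hmem : ∀ t, 0 < h t → t / κ ∈ profileSupport q b := fun t ht => by
    change 0 < profileBase q b (t / κ)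
    rwa [← hh, mul_div_cancel₀ t hκ.ne']
  have hO : IsOpen {t | 0 < h t} := isOpen_lt continuous_const hhc
  have hoc : ({t | 0 < h t} : Set ℝ).OrdConnected := by
    refine ⟨fun x hx y hy w hw => ?_⟩
    have := (ordConnected_profileSupport hq).out (hmem x hx) (hmem y hy)
      ⟨div_le_div_of_nonneg_right hw.1 hκ.le, div_le_div_of_nonneg_right hw.2 hκ.le⟩
    change 0 < profileBase q b (w / κ) at this
    rwa [← hh, mul_div_cancel₀ w hκ.ne'] at this
  have heq : EqOn (fun x => ∫ t in (0 : ℝ)..x, h t ^ (-(1 / v)))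
      (fun x => κ * escortMap q b α (x / κ)) {t | 0 < h t} := fun t ht => by
    have := trig_integral_eq hq hb hh hv (hmem t ht)
    rwa [mul_div_cancel₀ t hκ.ne'] at this
  have hd : ∀ t ∈ {t | 0 < h t}, HasDerivAt (fun x => ∫ t in (0 : ℝ)..x, h t ^ (-(1 / v)))
      (profile q b (t / κ) ^ (1 - 1 / α)) t := fun t ht => by
    refine HasDerivAt.congr_of_eventuallyEq ?_ (heq.eventuallyEq_of_mem (hO.mem_nhds ht))
    refine (((hasDerivAt_escortMap hq (hmem t ht)).comp t
      ((hasDerivAt_id t).div_const κ)).const_mul κ).congr_deriv ?_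
    field_simp
  have hpos : ∀ t ∈ {t | 0 < h t}, 0 < profile q b (t / κ) ^ (1 - 1 / α) := fun t ht =>
    Real.rpow_pos_of_pos (profile_pos (hmem t ht)) _
  have hzt : κ * z ∈ {t | 0 < h t} := by
    rw [trig_support hκ hh]
    exact ⟨z, hz, rfl⟩
  have := hasDerivAt_invFunOn hO hoc (strictMonoOn_of_hasDerivAt_pos hO hoc hd hpos)
    (fun t ht => (hd t ht).continuousAt.continuousWithinAt) hzt (hd _ hzt) (hpos _ hzt).ne'
  simp only [trig_integral_eq hq hb hh hv hz] at this
  rw [this.deriv, mul_div_cancel_left₀ z hκ.ne', profile_rpow_of_mem hb hz, ← hv,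
    Real.rpow_neg (le_of_lt hz), inv_inv]

end Trig

lemma isEscort_trigDensity {q β lam : ℝ} (hq : 0 < q) (hα : 0 < 1 + β - lam) (h1 : lam ≠ 1)
    (h2 : β ≠ lam) :
    IsEscort q (β / (1 + β - lam)) (1 + β - lam) (trigDensity q β lam) := by
  set α := 1 + β - lam with hαdef
  set b := β / α with hbdef
  have hb1 : b - 1 = (lam - 1) / α := by rw [hbdef]; field_simp; linarith
  have h1' : lam - 1 ≠ 0 := sub_ne_zero.2 h1
  have h2' : β - lam ≠ 0 := sub_ne_zero.2 h2
  have hb : b ≠ 1 := fun h => div_ne_zero h1' hα.ne' (by rw [← hb1, h, sub_self])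
  have hκ : 0 < kappa q β lam :=
    Real.rpow_pos_of_pos (abs_pos.2 (div_ne_zero h1' hα.ne')) _
  -- This is why `kappa` has its value: it turns `1 ∓ |κ z|^q` into `profileBase q b z`.
  have hκq : kappa q β lam ^ q = |b - 1| := by
    rw [kappa, ← hαdef, ← hb1, ← Real.rpow_mul (abs_nonneg _), one_div_mul_cancel hq.ne',
      Real.rpow_one]
  have habs : ∀ z, |kappa q β lam * z| ^ q = |b - 1| * |z| ^ q := fun z => by
    rw [abs_mul, Real.mul_rpow (abs_nonneg _) (abs_nonneg _), abs_of_pos hκ, hκq]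
  have hexp : 1 / (b - 1) * (1 - 1 / α) = (β - lam) / (lam - 1) := by
    rw [hb1]; field_simp; rw [hαdef]; ring
  have hexp' : 1 / (b - 1) * (1 / α) = 1 / (lam - 1) := by
    rw [hb1]; field_simp
  have hpow : ∀ z ∈ profileSupport q b, ∀ v : ℝ, 1 / v = -((β - lam) / (lam - 1)) →
      (profileBase q b z ^ (1 / v)) ^ (1 / (lam - β)) = profile q b z ^ (1 / α) := by
    intro z hz v hv
    rw [profile_rpow_of_mem hb hz, hexp', ← Real.rpow_mul (le_of_lt hz), hv]
    congr 1
    have : lam - β ≠ 0 := fun h => h2' (by linarith)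
    field_simp
    ring
  rcases lt_or_gt_of_ne h1 with hlt | hgt
  · have hh : ∀ z, (fun t : ℝ => 1 + |t| ^ q) (kappa q β lam * z) = profileBase q b z := fun z => by
      have : b - 1 < 0 := by rw [hb1]; exact div_neg_of_neg_of_pos (by linarith) hα
      simp only [habs, abs_of_neg this, profileBase]
      ring
    have hv : -(1 / ((1 - lam) / (β - lam))) = 1 / (b - 1) * (1 - 1 / α) := by
      rw [hexp, one_div_div, ← div_neg, neg_sub]
    have huniv : {t : ℝ | 0 < 1 + |t| ^ q} = univ := eq_univ_of_forall fun t => by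
      change 0 < 1 + |t| ^ q
      positivity
    have hiff := fun y => trig_mem_image_iff (h := fun t : ℝ => 1 + |t| ^ q) (y := y) hq hb hκ hh hv
    have hdv := fun z hz => trig_deriv_invFunOn (h := fun t : ℝ => 1 + |t| ^ q) (z := z) hq hb hκ hh
      (continuous_const.add (continuous_abs.rpow_const fun _ => Or.inr hq.le)) hv hz
    rw [huniv] at hdv
    simp only [huniv, image_univ] at hiff
    change ∀ y, kappa q β lam * y ∈ range (gArsinh ((1 - lam) / (β - lam)) q) ↔ _ at hiff
    refine ⟨fun z hz => ?_, fun x hx => ?_⟩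
    · rw [trigDensity, if_pos hlt, if_pos ((hiff _).2 ⟨z, hz, rfl⟩), normConst₃, ← hαdef, ← hbdef]
      congr 1
      rw [← hpow z hz ((1 - lam) / (β - lam)) (by rw [← hexp, ← hv, neg_neg]), ← hdv z hz]
      rfl
    · rw [trigDensity, if_pos hlt, if_neg fun h => hx ((hiff x).1 h)]
  · have hh : ∀ z, (fun t : ℝ => 1 - |t| ^ q) (kappa q β lam * z) = profileBase q b z := fun z => by
      have : 0 < b - 1 := by rw [hb1]; exact div_pos (by linarith) hα
      simp only [habs, abs_of_pos this, profileBase]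
    have hv : -(1 / ((lam - 1) / (lam - β))) = 1 / (b - 1) * (1 - 1 / α) := by
      rw [hexp, one_div_div, ← neg_div, neg_sub]
    have hIoo : {t : ℝ | 0 < 1 - |t| ^ q} = Ioo (-1) 1 := by
      ext t
      change 0 < 1 - |t| ^ q ↔ t ∈ Ioo (-1) 1
      have := Real.rpow_lt_rpow_iff (abs_nonneg t) zero_le_one hq
      rw [Real.one_rpow] at this
      rw [sub_pos, this, abs_lt]
      rfl
    have hiff := fun y => trig_mem_image_iff (h := fun t : ℝ => 1 - |t| ^ q) (y := y) hq hb hκ hh hv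
    have hdv := fun z hz => trig_deriv_invFunOn (h := fun t : ℝ => 1 - |t| ^ q) (z := z) hq hb hκ hh
      (continuous_const.sub (continuous_abs.rpow_const fun _ => Or.inr hq.le)) hv hz
    rw [hIoo] at hdv
    simp only [hIoo] at hiff
    change ∀ y, kappa q β lam * y ∈ gArcsin ((lam - 1) / (lam - β)) q '' Ioo (-1) 1 ↔ _ at hiff
    refine ⟨fun z hz => ?_, fun x hx => ?_⟩
    · rw [trigDensity, if_neg hgt.not_gt, if_pos ((hiff _).2 ⟨z, hz, rfl⟩), normConst₃, ← hαdef,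
        ← hbdef]
      congr 1
      rw [← hpow z hz ((lam - 1) / (lam - β)) (by rw [← hexp, ← hv, neg_neg]), ← hdv z hz]
      rfl
    · rw [trigDensity, if_neg hgt.not_gt, if_neg fun h => hx ((hiff x).1 h)]

/-! ### The case `lam = 1`: incomplete Gamma functions. -/

section IncGamma

variable {ε a : ℝ}

lemma intervalIntegrable_incGamma (ha : 0 < a) (x y : ℝ) :
    IntervalIntegrable (fun t : ℝ => t ^ (a - 1) * Real.exp (-(ε * t))) volume x y :=
  (intervalIntegral.intervalIntegrable_rpow' (by linarith)).mul_continuousOn (by fun_prop)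

lemma strictMonoOn_incGamma (ha : 0 < a) : StrictMonoOn (incGamma ε a) (Ici 0) := by
  intro x hx y _ hxy
  have h := intervalIntegral.integral_interval_sub_left
    (intervalIntegrable_incGamma (ε := ε) ha 0 y) (intervalIntegrable_incGamma (ε := ε) ha 0 x)
  rw [← sub_pos, incGamma, incGamma, h]
  exact intervalIntegral.intervalIntegral_pos_of_pos_on (intervalIntegrable_incGamma ha x y)
    (fun t ht => mul_pos (Real.rpow_pos_of_pos (lt_of_le_of_lt hx ht.1) _) (Real.exp_pos _)) hxy

lemma continuous_incGamma (ha : 0 < a) : Continuous (incGamma ε a) :=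
  intervalIntegral.continuous_primitive (intervalIntegrable_incGamma ha) 0

lemma hasDerivAt_incGamma (ha : 0 < a) {x : ℝ} (hx : 0 < x) :
    HasDerivAt (incGamma ε a) (x ^ (a - 1) * Real.exp (-(ε * x))) x := by
  have hc : ContinuousOn (fun t : ℝ => t ^ (a - 1) * Real.exp (-(ε * t))) (Ioi 0) :=
    (continuousOn_id.rpow_const fun t ht => Or.inl (ne_of_gt ht)).mul (by fun_prop)
  exact intervalIntegral.integral_hasDerivAt_right (intervalIntegrable_incGamma ha 0 x)
    (hc.stronglyMeasurableAtFilter isOpen_Ioi x hx) (hc.continuousAt (Ioi_mem_nhds hx))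

/-- The substitution `t = θ s^q`, carried out by differentiating in `s > 0`; continuity at `0` takes
care of the singularity of `t^(1/q-1)`. -/
lemma incGamma_mul_rpow {q θ : ℝ} (hq : 0 < q) (hθ : 0 < θ) {z : ℝ} (hz : 0 ≤ z) :
    incGamma ε (1 / q) (θ * z ^ q) =
      q * θ ^ (1 / q) * ∫ t in (0 : ℝ)..z, Real.exp (-(ε * θ * |t| ^ q)) := by
  have ha : 0 < 1 / q := by positivity
  have hcont : Continuous fun t : ℝ => q * θ ^ (1 / q) * Real.exp (-(ε * θ * |t| ^ q)) :=
    continuous_const.mul (Real.continuous_exp.comp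
      (continuous_const.mul (continuous_abs.rpow_const fun _ => Or.inr hq.le)).neg)
  have h := intervalIntegral.integral_eq_sub_of_hasDerivAt_of_le hz
    (f := fun s => incGamma ε (1 / q) (θ * s ^ q))
    (f' := fun t => q * θ ^ (1 / q) * Real.exp (-(ε * θ * |t| ^ q)))
    ((continuous_incGamma ha).comp (continuous_const.mul
      (Real.continuous_rpow_const hq.le))).continuousOn (fun s hs => ?_)
    (hcont.intervalIntegrable _ _)
  · rw [intervalIntegral.integral_const_mul] at h
    rw [h, Real.zero_rpow hq.ne', mul_zero]
    simp [incGamma]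
  · have hs : 0 < s := hs.1
    have hsq := Real.rpow_pos_of_pos hs q
    refine ((hasDerivAt_incGamma ha (by positivity)).comp s
      ((Real.hasDerivAt_rpow_const (Or.inl hs.ne')).const_mul θ)).congr_deriv ?_
    rw [abs_of_pos hs, Real.mul_rpow hθ.le hsq.le, ← Real.rpow_mul hs.le,
      show q * (1 / q - 1) = 1 - q by field_simp, Real.rpow_sub_one hθ.ne',
      Real.rpow_sub_one hs.ne', Real.rpow_sub hs, Real.rpow_one, ← mul_assoc]
    field_simp

end IncGamma

/-- Here `b = 1`, `α = β`, and `escortMap` integrates `exp(-(1 - 1/β)|t|^q)`. The implicit variable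
of the definition is `τ = θ|z|^q` with `θ = |β-1|/β`, so `exp(-τ/|β-1|)` is `profile^(1/β)`. -/
lemma isEscort_gammaDensity {q β : ℝ} (hq : 0 < q) (hβ : 0 < β) (h1 : β ≠ 1) :
    IsEscort q 1 β (gammaDensity q β) := by
  have hβ1 : β - 1 ≠ 0 := sub_ne_zero.2 h1
  have hβ1' : 0 < |β - 1| := abs_pos.2 hβ1
  set θ := |β - 1| / β with hθ
  have hθ0 : 0 < θ := by positivity
  set ε : ℝ := if 1 < β then 1 else -1 with hε
  have hεθ : ε * θ = 1 - 1 / β := by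
    rw [hε, hθ]
    split_ifs with h
    · rw [abs_of_pos (by linarith)]; field_simp
    · rw [abs_of_nonpos (by linarith)]; field_simp
  have hcoef : q / |β / (β - 1)| ^ (1 / q) = q * θ ^ (1 / q) := by
    rw [abs_div, abs_of_pos hβ, hθ, Real.div_rpow hβ.le hβ1'.le, Real.div_rpow hβ1'.le hβ.le]
    field_simp
  have hW : ∀ z, escortMap q 1 β z = ∫ t in (0 : ℝ)..z, Real.exp (-(ε * θ * |t| ^ q)) := fun z => by
    refine intervalIntegral.integral_congr fun t _ => ?_
    rw [profile_one, ← Real.exp_mul, hεθ]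
    ring_nf
  have hWneg : ∀ z, escortMap q 1 β (-z) = -escortMap q 1 β z := fun z => by
    have := intervalIntegral.integral_comp_neg (a := 0) (b := z)
      (fun t : ℝ => Real.exp (-(ε * θ * |t| ^ q)))
    simp only [abs_neg, neg_zero] at this
    rw [hW, hW, this, intervalIntegral.integral_symm]
  have hWnonneg : ∀ z, 0 ≤ z → 0 ≤ escortMap q 1 β z := fun z hz => by
    rw [hW]
    exact intervalIntegral.integral_nonneg hz fun t _ => (Real.exp_pos _).le
  have hWabs : ∀ z, |escortMap q 1 β z| = escortMap q 1 β |z| := fun z => by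
    rcases le_total 0 z with h | h
    · rw [abs_of_nonneg h, abs_of_nonneg (hWnonneg z h)]
    · rw [abs_of_nonpos h, hWneg, abs_of_nonpos]
      have := hWnonneg (-z) (by linarith)
      rw [hWneg] at this
      linarith
  have hinc : ∀ z, 0 ≤ z → incGamma ε (1 / q) (θ * z ^ q) =
      q / |β / (β - 1)| ^ (1 / q) * escortMap q 1 β z := fun z hz => by
    rw [incGamma_mul_rpow hq hθ0 hz, hcoef, hW]
  have hS : profileSupport q 1 = univ := profileSupport_eq_univ le_rfl
  refine ⟨fun z _ => ?_, fun x hx => ?_⟩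
  · have harg : q / |β / (β - 1)| ^ (1 / q) * |escortMap q 1 β z| =
        incGamma ε (1 / q) (θ * |z| ^ q) := by
      rw [hinc _ (abs_nonneg z), hWabs]
    have hmem : θ * |z| ^ q ∈ Ici (0 : ℝ) := by
      change 0 ≤ θ * |z| ^ q
      positivity
    simp only [gammaDensity]
    rw [← hε, harg, if_pos ⟨_, hmem, rfl⟩,
      invFunOn_image_eq (strictMonoOn_incGamma (by positivity)) hmem, normConst₃,
      show β / (1 + β - 1) = 1 by rw [add_sub_cancel_left, div_self hβ.ne'], profile_one,
      ← Real.exp_mul, hθ]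
    congr 2
    field_simp
  · simp only [gammaDensity]
    rw [← hε, if_neg]
    rintro ⟨τ, hτ, hτx⟩
    have hτ : 0 ≤ τ := hτ
    refine hx ?_
    rw [hS, image_univ]
    have hz : 0 ≤ (τ / θ) ^ (1 / q) := by positivity
    have h2 := hinc _ hz
    rw [← Real.rpow_mul (by positivity), one_div_mul_cancel hq.ne', Real.rpow_one,
      mul_div_cancel₀ _ hθ0.ne', hτx] at h2
    have hne : q / |β / (β - 1)| ^ (1 / q) ≠ 0 := by
      rw [hcoef]; positivity
    have h3 := mul_left_cancel₀ hne h2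
    rcases abs_choice x with h | h
    · exact ⟨(τ / θ) ^ (1 / q), by rw [← h3, h]⟩
    · exact ⟨-(τ / θ) ^ (1 / q), by rw [hWneg, ← h3, h, neg_neg]⟩

theorem isEscort_minDensity {p : ℝ≥0∞} (hp : 1 < p) {β lam : ℝ} (hβ : 0 < β)
    (hα : 0 < 1 + β - lam) :
    IsEscort (dual p).toReal (β / (1 + β - lam)) (1 + β - lam) (minDensity p β lam) := by
  have hq : 0 < (dual p).toReal := zero_lt_one.trans_le (one_le_toReal_dual hp)
  rw [minDensity, if_neg hp.ne']
  split_ifs with h1 h2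
  · subst h1
    rw [add_sub_cancel_right, div_one]
    exact isEscort_stretchedGaussian
  · subst h2
    rw [add_sub_cancel_left, div_self hβ.ne']
    exact isEscort_gammaDensity hq hβ h1
  · exact isEscort_trigDensity hq hα h2 h1

/-! ### The exponent one: cumulative masses -/

section Masses

variable {α β : ℝ} {f : ℝ → ℝ} {M : ℝ≥0∞}

/-- The integral of `f ^ (1 - α)` over the positive part of the support. -/
noncomputable def rightMass (α : ℝ) (f : ℝ → ℝ) : ℝ≥0∞ :=
  ∫⁻ t in Ioi 0 ∩ {t | 0 < f t}, ENNReal.ofReal (f t ^ (1 - α))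

lemma absCumul_of_nonneg {x : ℝ} (hx : 0 ≤ x) : absCumul α f x =
    ∫⁻ t in Ioc 0 x ∩ {t | 0 < f t}, ENNReal.ofReal (f t ^ (1 - α)) := by
  rw [absCumul, uIoc_of_le hx]

lemma setLIntegral_inter_pos (hf : Measurable f) (g : ℝ → ℝ≥0∞) (s : Set ℝ) :
    ∫⁻ t in s ∩ {t | 0 < f t}, g t = ∫⁻ t in s, {t | 0 < f t}.indicator g t := by
  rw [inter_comm, ← Measure.restrict_restrict (measurableSet_lt measurable_const hf),
    lintegral_indicator (measurableSet_lt measurable_const hf)]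

/-- The positive part of the support is covered, up to a null set, by the intervals `(0, x)` with
`x` a point where the bound holds. Countably many suffice and they are nested, so monotone
convergence applies. -/
lemma rightMass_le (hf : Measurable f) (h : ∀ᵐ x, 0 < f x → absCumul α f x ≤ M) :
    rightMass α f ≤ M := by
  let T : Set ℝ := {x | 0 < x ∧ 0 < f x ∧ absCumul α f x ≤ M}
  obtain ⟨S, hST, hSc, hS⟩ := TopologicalSpace.isOpen_biUnion_countable T (fun x => Ioo 0 x)
    fun x _ => isOpen_Ioo
  -- Only a largest element of `T` can be missed.
  have hsub : (T \ ⋃ x ∈ T, Ioo 0 x).Subsingleton := by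
    have key : ∀ x ∈ T \ ⋃ x ∈ T, Ioo 0 x, ∀ y ∈ T, y ≤ x := fun x hx y hy =>
      le_of_not_gt fun hxy => hx.2 (mem_biUnion hy ⟨hx.1.1, hxy⟩)
    exact fun x hx y hy => le_antisymm (key y hy x hx.1) (key x hx y hy.1)
  have hnull : ∀ᵐ x, x ∉ T \ ⋃ x ∈ T, Ioo 0 x :=
    measure_eq_zero_iff_ae_notMem.1 (hsub.measure_zero volume)
  have hcover : (Ioi 0 ∩ {t | 0 < f t} : Set ℝ) ≤ᵐ[volume] (⋃ x : S, Ioo 0 (x : ℝ) : Set ℝ) := by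
    filter_upwards [h, hnull] with x hx hx' hxs
    have hxT : x ∈ T := ⟨hxs.1, hxs.2, hx hxs.2⟩
    have : x ∈ ⋃ x ∈ T, Ioo 0 x := by_contra fun h => hx' ⟨hxT, h⟩
    rwa [← hS, biUnion_eq_iUnion] at this
  have hdir : Directed (· ⊆ ·) fun x : S => Ioo 0 (x : ℝ) :=
    (show Monotone fun x : S => Ioo 0 (x : ℝ) from
      fun x y hxy => Ioo_subset_Ioo_right hxy).directed_le
  have : Countable S := hSc.to_subtype
  calc rightMass α f = ∫⁻ t in Ioi 0 ∩ {t | 0 < f t},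
        {t | 0 < f t}.indicator (fun t => ENNReal.ofReal (f t ^ (1 - α))) t := by
        rw [← setLIntegral_inter_pos hf, inter_assoc, inter_self, rightMass]
    _ ≤ ∫⁻ t in ⋃ x : S, Ioo 0 (x : ℝ),
        {t | 0 < f t}.indicator (fun t => ENNReal.ofReal (f t ^ (1 - α))) t :=
      lintegral_mono' (Measure.restrict_mono_ae hcover) le_rfl
    _ ≤ M := by
      rw [setLIntegral_iUnion_of_directed _ hdir]
      refine iSup_le fun x => ?_
      have hx := hST x.2
      refine le_trans ?_ hx.2.2
      rw [absCumul_of_nonneg hx.1.le, ← setLIntegral_inter_pos hf]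
      exact lintegral_mono_set (inter_subset_inter_left _ Ioo_subset_Ioc_self)

lemma absCumul_comp_neg (hf : Measurable f) (x : ℝ) :
    absCumul α (fun x => f (-x)) x = absCumul α f (-x) := by
  have hm : MeasurableSet {t | 0 < f t} := measurableSet_lt measurable_const hf
  have hm' : MeasurableSet {t | 0 < f (-t)} :=
    measurableSet_lt measurable_const (hf.comp measurable_neg)
  rw [absCumul, absCumul, ← lintegral_indicator (measurableSet_uIoc.inter hm),
    ← lintegral_indicator (measurableSet_uIoc.inter hm'), ← lintegral_neg_eq_self]
  refine lintegral_congr_ae ?_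
  have h0 : ∀ᵐ t : ℝ, t ≠ 0 := measure_eq_zero_iff_ae_notMem.1 (measure_singleton 0)
  have hx : ∀ᵐ t : ℝ, t ≠ -x := measure_eq_zero_iff_ae_notMem.1 (measure_singleton (-x))
  filter_upwards [h0, hx] with t h0 hx
  have : -t ∈ uIoc 0 x ↔ t ∈ uIoc 0 (-x) := by
    rw [mem_uIoc, mem_uIoc]
    constructor
    · rintro (⟨h1, h2⟩ | ⟨h1, h2⟩)
      · exact Or.inr ⟨lt_of_le_of_ne (by linarith) hx.symm, by linarith⟩
      · exact Or.inl ⟨lt_of_le_of_ne (by linarith) h0.symm, by linarith⟩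
    · rintro (⟨h1, h2⟩ | ⟨h1, h2⟩)
      · exact Or.inr ⟨lt_of_le_of_ne (by linarith) fun h => hx (by linarith), by linarith⟩
      · exact Or.inl ⟨lt_of_le_of_ne (by linarith) fun h => h0 (by linarith), by linarith⟩
  have hiff : -t ∈ uIoc 0 x ∩ {t | 0 < f (-t)} ↔ t ∈ uIoc 0 (-x) ∩ {t | 0 < f t} := by
    refine and_congr this ?_
    change 0 < f (- -t) ↔ 0 < f t
    rw [neg_neg]
  by_cases ht : t ∈ uIoc 0 (-x) ∩ {t | 0 < f t}
  · rw [indicator_of_mem (hiff.2 ht), indicator_of_mem ht, neg_neg]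
  · rw [indicator_of_notMem (mt hiff.1 ht), indicator_of_notMem ht]

lemma rightMass_comp_neg_le (hf : Measurable f) (h : ∀ᵐ x, 0 < f x → absCumul α f x ≤ M) :
    rightMass α (fun x => f (-x)) ≤ M := by
  refine rightMass_le (hf.comp measurable_neg) ?_
  filter_upwards [(Measure.measurePreserving_neg volume).quasiMeasurePreserving.ae h] with x hx hx0
  rw [absCumul_comp_neg hf]
  exact hx hx0

lemma rightMass_comp_neg (hf : Measurable f) : rightMass α (fun x => f (-x)) =
    ∫⁻ t in Iio 0 ∩ {t | 0 < f t}, ENNReal.ofReal (f t ^ (1 - α)) := by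
  rw [rightMass, setLIntegral_inter_pos hf,
    setLIntegral_inter_pos (f := fun x => f (-x)) (hf.comp measurable_neg), setLIntegral_Iio_eq,
    neg_zero]
  rfl

lemma rightMass_add (hf : Measurable f) : rightMass α (fun x => f (-x)) + rightMass α f =
    ∫⁻ t in {t | 0 < f t}, ENNReal.ofReal (f t ^ (1 - α)) := by
  rw [rightMass_comp_neg hf, rightMass, setLIntegral_inter_pos hf, setLIntegral_inter_pos hf,
    ← lintegral_indicator (measurableSet_lt measurable_const hf),
    setLIntegral_congr Iio_ae_eq_Iic, ← compl_Iic, lintegral_add_compl _ measurableSet_Iic]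

lemma ofReal_eq_indicator (hf : IsDensity f) (t : ℝ) : ENNReal.ofReal (f t) =
    {t | 0 < f t}.indicator
      (fun t => ENNReal.ofReal (f t ^ α) * ENNReal.ofReal (f t ^ (1 - α))) t := by
  rcases (hf.nonneg t).eq_or_lt with h | h
  · rw [indicator_of_notMem (by simp [← h]), ← h, ENNReal.ofReal_zero]
  · rw [indicator_of_mem (show t ∈ {t | 0 < f t} from h), ← ENNReal.ofReal_mul (by positivity),
      ← Real.rpow_add h, add_sub_cancel, Real.rpow_one]

lemma IsDensity.setLIntegral_rpow_mul (hf : IsDensity f) (α : ℝ) :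
    ∫⁻ t in {t | 0 < f t}, ENNReal.ofReal (f t ^ α) * ENNReal.ofReal (f t ^ (1 - α)) = 1 := by
  rw [← hf.lintegral_eq_one, ← lintegral_indicator (measurableSet_lt measurable_const hf.measurable)]
  exact lintegral_congr fun t => (ofReal_eq_indicator hf t).symm

lemma IsDensity.rightMass_add_ne_zero (hf : IsDensity f) :
    rightMass α (fun x => f (-x)) + rightMass α f ≠ 0 := by
  rw [rightMass_add hf.measurable]
  intro h
  rw [lintegral_eq_zero_iff (hf.measurable.pow_const _).ennreal_ofReal] at h
  have := hf.setLIntegral_rpow_mul α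
  rw [lintegral_congr_ae (g := 0) (h.mono fun t ht => by simp only [ht, Pi.zero_apply, mul_zero])]
    at this
  simp at this

/-- The bound on the product, in terms of `C = sup f`. -/
lemma IsDensity.one_le_mul (hf : IsDensity f) (hα : 0 < α) {C : ℝ} (hC : ∀ x, f x ≤ C) :
    1 ≤ ENNReal.ofReal (C ^ α) * (rightMass α (fun x => f (-x)) + rightMass α f) := by
  rw [rightMass_add hf.measurable, ← hf.setLIntegral_rpow_mul α,
    ← lintegral_const_mul _ (hf.measurable.pow_const _).ennreal_ofReal]
  exact lintegral_mono fun t => mul_le_mul_left (ENNReal.ofReal_le_ofReal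
    (Real.rpow_le_rpow (hf.nonneg t) (hC t) hα.le)) _

lemma IsDensity.ae_eq_of_mul_eq (hf : IsDensity f) (hα : 0 < α) {C : ℝ} (hC : ∀ x, f x ≤ C)
    (h : ENNReal.ofReal (C ^ α) * (rightMass α (fun x => f (-x)) + rightMass α f) ≤ 1) :
    ∀ᵐ x, 0 < f x → f x = C := by
  have hm : MeasurableSet {t | 0 < f t} := measurableSet_lt measurable_const hf.measurable
  rw [rightMass_add hf.measurable, ← hf.setLIntegral_rpow_mul α,
    ← lintegral_const_mul _ (hf.measurable.pow_const _).ennreal_ofReal] at h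
  have key := ae_eq_of_ae_le_of_lintegral_le (ae_of_all _ fun t => mul_le_mul_left
    (ENNReal.ofReal_le_ofReal (Real.rpow_le_rpow (hf.nonneg t) (hC t) hα.le)) _)
    (by rw [hf.setLIntegral_rpow_mul]; exact ENNReal.one_ne_top)
    ((hf.measurable.pow_const _).ennreal_ofReal.const_mul _).aemeasurable h
  have key := (ae_restrict_iff' hm).1 key
  filter_upwards [key] with x hx hx0
  have h1 := hx hx0
  have hC0 : 0 < C := lt_of_lt_of_le hx0 (hC x)
  rw [ENNReal.mul_left_inj (by simpa using Real.rpow_pos_of_pos hx0 _) ENNReal.ofReal_ne_top,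
    ENNReal.ofReal_eq_ofReal_iff (by positivity) (by positivity)] at h1
  exact (Real.rpow_left_inj hx0.le hC0.le hα.ne').1 h1

end Masses

/-! ### The exponent one: the inequality -/

section SupBound

variable {α β : ℝ} {f : ℝ → ℝ} {a M : ℝ≥0∞}

lemma ae_absCumul_le (hf : IsDensity f) (α : ℝ) : ∀ᵐ x, 0 < f x →
    absCumul α f x ≤ eLpNorm (absCumul α f) ∞ (densityMeasure f) := by
  rw [← hf.ae_densityMeasure_iff, eLpNorm_exponent_top]
  exact ae_le_eLpNormEssSup

lemma rpow_mul_rpow_eq {C m : ℝ} (hC : 0 < C) (hm : 0 ≤ m) (hα : 0 < α) (hβ : 0 < β) :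
    (2 * (C ^ β / β)) ^ (1 / β) * m ^ (1 / α) =
      2 ^ (1 / β - 1 / α) * β ^ (-(1 / β)) * (C ^ α * (2 * m)) ^ (1 / α) := by
  have hCβ := Real.rpow_pos_of_pos hC β
  have hCα := Real.rpow_pos_of_pos hC α
  rw [Real.mul_rpow zero_le_two (by positivity), Real.div_rpow hCβ.le hβ.le,
    Real.mul_rpow hCα.le (by positivity), Real.mul_rpow zero_le_two hm, ← Real.rpow_mul hC.le,
    ← Real.rpow_mul hC.le, mul_one_div_cancel hβ.ne', mul_one_div_cancel hα.ne', Real.rpow_one,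
    Real.rpow_sub two_pos, Real.rpow_neg hβ.le]
  have h2 := Real.rpow_pos_of_pos two_pos (1 / α)
  field_simp

/-- Expresses the information `a` through a height `C` bounding `f`, which need not be the supremum.
-/
lemma exists_sup (hf : IsDensity f) (hβ : 0 < β)
    (ha : ∀ x, ENNReal.ofReal (2 * (f x ^ β / β)) ≤ a) (hatop : a ≠ ∞) :
    ∃ C : ℝ, 0 < C ∧ a = ENNReal.ofReal (2 * (C ^ β / β)) ∧ ∀ x, f x ≤ C := by
  have hle : ∀ x, f x ≤ (β * a.toReal / 2) ^ (1 / β) := fun x => by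
    have h := (ENNReal.ofReal_le_iff_le_toReal hatop).1 (ha x)
    have hfx := hf.nonneg x
    have h1 : f x ^ β ≤ β * a.toReal / 2 := by
      rw [← mul_div_assoc, div_le_iff₀ hβ] at h
      linarith
    have h2 := Real.rpow_le_rpow (by positivity) h1 (one_div_nonneg.2 hβ.le)
    rwa [← Real.rpow_mul hfx, mul_one_div_cancel hβ.ne', Real.rpow_one] at h2
  obtain ⟨x, hx⟩ := hf.exists_pos
  refine ⟨_, hx.trans_le (hle x), ?_, hle⟩
  have : 0 ≤ a.toReal := ENNReal.toReal_nonneg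
  rw [← Real.rpow_mul (by positivity), one_div_mul_cancel hβ.ne', Real.rpow_one]
  conv_lhs => rw [← ENNReal.ofReal_toReal hatop]
  congr 1
  field_simp

lemma masses_le (hf : IsDensity f) (hM : ∀ᵐ x, 0 < f x → absCumul α f x ≤ M) :
    rightMass α (fun x => f (-x)) + rightMass α f ≤ 2 * M := by
  rw [two_mul]
  exact add_le_add (rightMass_comp_neg_le hf.measurable hM) (rightMass_le hf.measurable hM)

lemma mul_rpow_eq_of_sup (hα : 0 < α) (hβ : 0 < β) {C : ℝ} (hC : 0 < C) (hM : M ≠ ∞) :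
    ENNReal.ofReal (2 * (C ^ β / β)) ^ (1 / β) * M ^ (1 / α) =
      ENNReal.ofReal (2 ^ (1 / β - 1 / α) * β ^ (-(1 / β))) *
        (ENNReal.ofReal (C ^ α) * (2 * M)) ^ (1 / α) := by
  have hCβ := Real.rpow_pos_of_pos hC β
  have hCα := Real.rpow_pos_of_pos hC α
  obtain ⟨m, hm, rfl⟩ : ∃ m : ℝ, 0 ≤ m ∧ M = ENNReal.ofReal m :=
    ⟨M.toReal, ENNReal.toReal_nonneg, (ENNReal.ofReal_toReal hM).symm⟩
  have h2 : (2 : ℝ≥0∞) = ENNReal.ofReal 2 := by simp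
  rw [h2, ← ENNReal.ofReal_mul zero_le_two, ← ENNReal.ofReal_mul hCα.le,
    ENNReal.ofReal_rpow_of_nonneg (by positivity) (by positivity),
    ENNReal.ofReal_rpow_of_nonneg hm (by positivity),
    ENNReal.ofReal_rpow_of_nonneg (by positivity) (by positivity),
    ← ENNReal.ofReal_mul (by positivity), ← ENNReal.ofReal_mul (by positivity),
    rpow_mul_rpow_eq hC hm hα hβ]

/-- Only a bound on the height and a bound on the cumulative integral enter, so this serves both
forms of the Fisher information. By `mul_rpow_eq_of_sup` the claim is `1 ≤ C^α · 2M`. -/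
lemma ofReal_le_mul_of_sup_le (hf : IsDensity f) (hα : 0 < α) (hβ : 0 < β)
    (ha : ∀ x, ENNReal.ofReal (2 * (f x ^ β / β)) ≤ a)
    (hM : ∀ᵐ x, 0 < f x → absCumul α f x ≤ M) :
    ENNReal.ofReal (2 ^ (1 / β - 1 / α) * β ^ (-(1 / β))) ≤ a ^ (1 / β) * M ^ (1 / α) := by
  have hβ' : 0 < 1 / β := by positivity
  have hα' : 0 < 1 / α := by positivity
  have ha0 : a ≠ 0 := by
    obtain ⟨x, hx⟩ := hf.exists_pos
    refine (lt_of_lt_of_le ?_ (ha x)).ne'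
    have := Real.rpow_pos_of_pos hx β
    exact ENNReal.ofReal_pos.2 (by positivity)
  have hM0 : M ≠ 0 := by
    rintro rfl
    exact hf.rightMass_add_ne_zero (by simpa using masses_le hf hM)
  by_cases hat : a = ∞
  · rw [hat, ENNReal.top_rpow_of_pos hβ', ENNReal.top_mul
      (by rw [ne_eq, ENNReal.rpow_eq_zero_iff_of_pos hα']; exact hM0)]
    exact le_top
  by_cases hMt : M = ∞
  · rw [hMt, ENNReal.top_rpow_of_pos hα', ENNReal.mul_top
      (by rw [ne_eq, ENNReal.rpow_eq_zero_iff_of_pos hβ']; exact ha0)]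
    exact le_top
  obtain ⟨C, hC, rfl, hfC⟩ := exists_sup hf hβ ha hat
  rw [mul_rpow_eq_of_sup hα hβ hC hMt]
  refine le_mul_of_one_le_right' (ENNReal.one_le_rpow ?_ hα')
  exact (hf.one_le_mul hα hfC).trans (by gcongr; exact masses_le hf hM)

/-- Equality means `C^α · 2M = 1`. Then the two masses, each at most `M`, sum to at least `2M`, so
both equal `M`, and `f^α ≤ C^α` is an equality almost everywhere on the support. -/
lemma exists_of_mul_eq (hf : IsDensity f) (hα : 0 < α) (hβ : 0 < β)
    (ha : ∀ x, ENNReal.ofReal (2 * (f x ^ β / β)) ≤ a)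
    (hM : ∀ᵐ x, 0 < f x → absCumul α f x ≤ M)
    (h : a ^ (1 / β) * M ^ (1 / α) = ENNReal.ofReal (2 ^ (1 / β - 1 / α) * β ^ (-(1 / β)))) :
    ∃ C : ℝ, 0 < C ∧ a = ENNReal.ofReal (2 * (C ^ β / β)) ∧ (∀ x, f x ≤ C) ∧
      (∀ᵐ x, 0 < f x → f x = C) ∧ rightMass α (fun x => f (-x)) = rightMass α f := by
  have hβ' : 0 < 1 / β := by positivity
  have hα' : 0 < 1 / α := by positivity
  have ha0 : a ≠ 0 := by
    obtain ⟨x, hx⟩ := hf.exists_pos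
    refine (lt_of_lt_of_le ?_ (ha x)).ne'
    have := Real.rpow_pos_of_pos hx β
    exact ENNReal.ofReal_pos.2 (by positivity)
  have hM0 : M ≠ 0 := by
    rintro rfl
    exact hf.rightMass_add_ne_zero (by simpa using masses_le hf hM)
  have hat : a ≠ ∞ := by
    rintro rfl
    rw [ENNReal.top_rpow_of_pos hβ', ENNReal.top_mul
      (by rw [ne_eq, ENNReal.rpow_eq_zero_iff_of_pos hα']; exact hM0)] at h
    exact ENNReal.ofReal_ne_top h.symm
  have hMt : M ≠ ∞ := by
    rintro rfl
    rw [ENNReal.top_rpow_of_pos hα', ENNReal.mul_top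
      (by rw [ne_eq, ENNReal.rpow_eq_zero_iff_of_pos hβ']; exact ha0)] at h
    exact ENNReal.ofReal_ne_top h.symm
  obtain ⟨C, hC, rfl, hfC⟩ := exists_sup hf hβ ha hat
  have hCα := Real.rpow_pos_of_pos hC α
  rw [mul_rpow_eq_of_sup hα hβ hC hMt] at h
  have h1 : ENNReal.ofReal (C ^ α) * (2 * M) = 1 := by
    have hK : ENNReal.ofReal (2 ^ (1 / β - 1 / α) * β ^ (-(1 / β))) ≠ 0 := by
      rw [ne_eq, ENNReal.ofReal_eq_zero, not_le]
      positivity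
    have h2 := (ENNReal.mul_right_inj hK ENNReal.ofReal_ne_top).1 (h.trans (mul_one _).symm)
    exact ENNReal.rpow_left_injective hα'.ne' (h2.trans (ENNReal.one_rpow _).symm)
  have hm := masses_le hf hM
  have hle := hf.one_le_mul hα hfC
  have hC0 : ENNReal.ofReal (C ^ α) ≠ 0 := by simpa using hCα
  refine ⟨C, hC, rfl, hfC, hf.ae_eq_of_mul_eq hα hfC ?_, ?_⟩
  · rw [← h1]
    gcongr
  · have hL := rightMass_comp_neg_le hf.measurable hM
    have hR := rightMass_le hf.measurable hM
    have h2 : M + M ≤ rightMass α (fun x => f (-x)) + rightMass α f := by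
      rw [← two_mul, ← ENNReal.mul_le_mul_iff_right hC0 ENNReal.ofReal_ne_top, h1]
      exact hle
    have hL' : M ≤ rightMass α fun x => f (-x) :=
      (ENNReal.add_le_add_iff_right hMt).1 (h2.trans (by gcongr))
    have hR' : M ≤ rightMass α f := (ENNReal.add_le_add_iff_left hMt).1 (h2.trans (by gcongr))
    rw [le_antisymm hL hL', le_antisymm hR hR']

/-! ### The exponent one: differentiable densities -/

lemma ofReal_le_eLpNorm_score (hf : IsDensity f) (hc : Continuous f)
    (hd : ∀ x, 0 < f x → DifferentiableAt ℝ f x) (hβ : 0 < β) (x : ℝ) :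
    ENNReal.ofReal (2 * (f x ^ β / β)) ≤
      eLpNorm (fun x => f x ^ (β - 2) * deriv f x) 1 (densityMeasure f) := by
  rw [eLpNorm_one_eq_lintegral_enorm]
  change _ ≤ ∫⁻ x, score β f x ∂densityMeasure f
  have h1 := hf.rpow_le_setLIntegral_Ioi hc countable_empty (fun x hx _ => hd x hx) hβ x
  have h2 := hf.rpow_le_setLIntegral_Iio hc countable_empty (fun x hx _ => hd x hx) hβ x
  have hβ0 : ENNReal.ofReal β ≠ 0 := by simpa using hβ
  have h3 : ∫⁻ y in Iio x, score β f y ∂densityMeasure f +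
      ∫⁻ y in Ioi x, score β f y ∂densityMeasure f ≤ ∫⁻ x, score β f x ∂densityMeasure f := by
    rw [← lintegral_add_compl (μ := densityMeasure f) (score β f) (measurableSet_Iic (a := x)),
      compl_Iic]
    exact add_le_add (lintegral_mono_set (Iio_subset_Iic_self (a := x))) le_rfl
  refine le_trans ?_ h3
  have hfx := Real.rpow_nonneg (hf.nonneg x) β
  rw [← ENNReal.mul_le_mul_iff_right hβ0 ENNReal.ofReal_ne_top, ← ENNReal.ofReal_mul hβ.le, mul_add,
    show β * (2 * (f x ^ β / β)) = f x ^ β + f x ^ β by field_simp; ring,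
    ENNReal.ofReal_add hfx hfx]
  exact add_le_add h2 h1

/-- A continuous density takes intermediate values, on an open set of positive measure. Hence for `p
= 1` no continuously differentiable density attains the bound. -/
lemma IsDensity.not_ae_eq_const (hf : IsDensity f) (hc : Continuous f) {C : ℝ} (hC : 0 < C)
    (h : ∀ᵐ x, 0 < f x → f x = C) : False := by
  obtain ⟨x, hx⟩ := exists_mem_Ioo_of_ae h (isOpen_lt continuous_const hc) hf.exists_pos
  have hx : f x = C := hx.2 hx.1
  obtain ⟨y, -, hy⟩ := hf.exists_gt_le x (half_pos hC)
  obtain ⟨z, hz⟩ : 3 / 4 * C ∈ range f :=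
    mem_range_of_exists_le_of_exists_ge hc ⟨y, by linarith⟩ ⟨x, by linarith⟩
  obtain ⟨w, hw, hw'⟩ := exists_mem_Ioo_of_ae h (isOpen_Ioo.preimage hc : IsOpen (f ⁻¹' Ioo 0 C))
    ⟨z, by rw [mem_preimage, hz]; constructor <;> linarith⟩
  exact hw.2.ne (hw' hw.1)

end SupBound

/-! ### The exponent one: densities of bounded variation -/

section BoundedVariation

variable {α β : ℝ} {f : ℝ → ℝ}

lemma IsDensity.le_eVariationOn_Ici (hf : IsDensity f) (hβ : 0 < β) (x : ℝ) :
    ENNReal.ofReal (f x ^ β / β) ≤ eVariationOn (fun x => f x ^ β / β) (Ici x) := by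
  have key : ∀ δ > 0, ENNReal.ofReal (f x ^ β / β - δ ^ β / β) ≤
      eVariationOn (fun x => f x ^ β / β) (Ici x) := fun δ hδ => by
    obtain ⟨y, hxy, hy⟩ := hf.exists_gt_le x hδ
    refine le_trans ?_ (eVariationOn.edist_le _ self_mem_Ici (mem_Ici.2 hxy.le))
    rw [edist_dist, Real.dist_eq]
    refine ENNReal.ofReal_le_ofReal (le_trans ?_ (le_abs_self _))
    have := Real.rpow_le_rpow (hf.nonneg y) hy hβ.le
    gcongr
  have hlim : Tendsto (fun δ : ℝ => ENNReal.ofReal (f x ^ β / β - δ ^ β / β)) (𝓝[>] 0)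
      (𝓝 (ENNReal.ofReal (f x ^ β / β - 0 ^ β / β))) :=
    ENNReal.tendsto_ofReal (tendsto_const_nhds.sub
      (((Real.continuousAt_rpow_const 0 β (Or.inr hβ.le)).tendsto.mono_left
        nhdsWithin_le_nhds).div_const β))
  rw [Real.zero_rpow hβ.ne', zero_div, sub_zero] at hlim
  exact le_of_tendsto hlim (by filter_upwards [self_mem_nhdsWithin] with δ hδ using key δ hδ)

lemma eVariationOn_comp_neg (g : ℝ → ℝ) (s : Set ℝ) :
    eVariationOn (fun x => g (-x)) (Neg.neg '' s) = eVariationOn g s := by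
  have := eVariationOn.comp_eq_of_antitoneOn g (t := Neg.neg '' s) Neg.neg
    (fun x _ y _ hxy => neg_le_neg hxy)
  rw [← image_comp] at this
  simpa [Function.comp_def] using this

lemma IsDensity.le_eVariationOn_Iic (hf : IsDensity f) (hβ : 0 < β) (x : ℝ) :
    ENNReal.ofReal (f x ^ β / β) ≤ eVariationOn (fun x => f x ^ β / β) (Iic x) := by
  have := hf.comp_neg.le_eVariationOn_Ici hβ (-x)
  rw [← eVariationOn_comp_neg _ (Iic x)]
  simpa using this

lemma IsDensity.le_eVariationOn_univ (hf : IsDensity f) (hβ : 0 < β) {u v w : ℝ} (huv : u ≤ v)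
    (hvw : v ≤ w) :
    ENNReal.ofReal (f u ^ β / β) + edist (f u ^ β / β) (f v ^ β / β) +
      edist (f v ^ β / β) (f w ^ β / β) + ENNReal.ofReal (f w ^ β / β) ≤
        eVariationOn (fun x => f x ^ β / β) univ := by
  have hU : (univ : Set ℝ) = ((Iic u ∪ Icc u v) ∪ Icc v w) ∪ Ici w := by
    rw [Iic_union_Icc_eq_Iic huv, Iic_union_Icc_eq_Iic hvw, Iic_union_Ici]
  have h1 : IsGreatest (Iic u ∪ Icc u v) v := by
    rw [Iic_union_Icc_eq_Iic huv]; exact isGreatest_Iic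
  have h2 : IsGreatest ((Iic u ∪ Icc u v) ∪ Icc v w) w := by
    rw [Iic_union_Icc_eq_Iic huv, Iic_union_Icc_eq_Iic hvw]; exact isGreatest_Iic
  rw [hU, eVariationOn.union _ h2 isLeast_Ici, eVariationOn.union _ h1 (isLeast_Icc hvw),
    eVariationOn.union _ isGreatest_Iic (isLeast_Icc huv)]
  exact add_le_add (add_le_add (add_le_add (hf.le_eVariationOn_Iic hβ u)
    (eVariationOn.edist_le _ (left_mem_Icc.2 huv) (right_mem_Icc.2 huv)))
    (eVariationOn.edist_le _ (left_mem_Icc.2 hvw) (right_mem_Icc.2 hvw)))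
    (hf.le_eVariationOn_Ici hβ w)

lemma IsDensity.ofReal_le_eVariationOn (hf : IsDensity f) (hβ : 0 < β) (x : ℝ) :
    ENNReal.ofReal (2 * (f x ^ β / β)) ≤ eVariationOn (fun x => f x ^ β / β) univ := by
  have h := hf.le_eVariationOn_univ hβ (le_refl x) (le_refl x)
  have := div_nonneg (Real.rpow_nonneg (hf.nonneg x) β) hβ.le
  rw [edist_self, add_zero, add_zero, ← ENNReal.ofReal_add this this, ← two_mul] at h
  exact h

/-- Rising to level `C` and returning to `0` uses up the whole variation; leaving the level in
between would cost more. -/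
lemma IsDensity.ordConnected_of_eVariationOn (hf : IsDensity f) (hβ : 0 < β) {C : ℝ} (hC : 0 < C)
    (h : eVariationOn (fun x => f x ^ β / β) univ = ENNReal.ofReal (2 * (C ^ β / β))) :
    {x | f x = C}.OrdConnected := by
  refine ⟨fun u hu w hw v hv => ?_⟩
  have hu : f u = C := hu
  have hw : f w = C := hw
  have h1 := hf.le_eVariationOn_univ hβ hv.1 hv.2
  have hCβ : 0 ≤ C ^ β / β := by positivity
  rw [h, hu, hw, two_mul, ENNReal.ofReal_add hCβ hCβ] at h1
  by_contra hne
  have hpos : 0 < edist (C ^ β / β) (f v ^ β / β) := by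
    rw [edist_pos]
    intro h2
    have h2 : C ^ β = f v ^ β := by field_simp at h2; exact h2
    exact hne ((Real.rpow_left_inj hC.le (hf.nonneg v) hβ.ne').1 h2).symm
  have h3 : ENNReal.ofReal (C ^ β / β) + (ENNReal.ofReal (C ^ β / β) + edist (C ^ β / β) (f v ^ β / β))
      ≤ ENNReal.ofReal (C ^ β / β) + ENNReal.ofReal (C ^ β / β) := by
    refine le_trans ?_ h1
    rw [← add_assoc, add_right_comm]
    exact add_le_add le_self_add le_rfl
  exact absurd ((ENNReal.add_le_add_iff_left ENNReal.ofReal_ne_top).1 h3)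
    (not_le.2 (ENNReal.lt_add_right ENNReal.ofReal_ne_top hpos.ne'))

/-- An order connected set with the same finite measure on both sides of the origin is a symmetric
interval. -/
lemma ae_eq_Icc_of_ordConnected {E : Set ℝ} (hE : E.OrdConnected) {r : ℝ} (hr : 0 < r)
    (hl : volume (E ∩ Iio 0) = ENNReal.ofReal r) (hg : volume (E ∩ Ioi 0) = ENNReal.ofReal r) :
    E =ᵐ[volume] Icc (-r) r := by
  have hr0 : ENNReal.ofReal r ≠ 0 := by simpa using hr
  obtain ⟨y, hy, hy0⟩ := nonempty_of_measure_ne_zero (hl.trans_ne hr0)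
  obtain ⟨z, hz, hz0⟩ := nonempty_of_measure_ne_zero (hg.trans_ne hr0)
  have hmem : (0 : ℝ) ∈ E := hE.out hy hz ⟨le_of_lt hy0, le_of_lt hz0⟩
  have hsub : E ⊆ Icc (-r) r := fun x hx => by
    constructor
    · by_contra! hlt
      have h1 : Ico x 0 ⊆ E ∩ Iio 0 := fun t ht => ⟨hE.out hx hmem ⟨ht.1, ht.2.le⟩, ht.2⟩
      have h2 := measure_mono (μ := volume) h1
      rw [hl, Real.volume_Ico, ENNReal.ofReal_le_ofReal_iff hr.le] at h2
      linarith
    · by_contra! hlt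
      have h1 : Ioc 0 x ⊆ E ∩ Ioi 0 := fun t ht => ⟨hE.out hmem hx ⟨ht.1.le, ht.2⟩, ht.1⟩
      have h2 := measure_mono (μ := volume) h1
      rw [hg, Real.volume_Ioc, ENNReal.ofReal_le_ofReal_iff hr.le] at h2
      linarith
  refine ae_eq_of_subset_of_measure_ge hsub ?_ hE.measurableSet.nullMeasurableSet
    measure_Icc_lt_top.ne
  have hd : Disjoint (E ∩ Iio 0) (E ∩ Ioi 0) :=
    (Iio_disjoint_Ioi_same (a := (0 : ℝ))).mono inter_subset_right inter_subset_right
  calc volume (Icc (-r) r) = volume (E ∩ Iio 0) + volume (E ∩ Ioi 0) := by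
        rw [hl, hg, Real.volume_Icc, ← ENNReal.ofReal_add hr.le hr.le]
        congr 1
        ring
    _ = volume (E ∩ Iio 0 ∪ E ∩ Ioi 0) :=
        (measure_union hd (hE.measurableSet.inter measurableSet_Ioi)).symm
    _ ≤ volume E := measure_mono (union_subset inter_subset_left inter_subset_left)

/-- The uniform density. -/
noncomputable def uniformDensity : ℝ → ℝ := (Ioo (-1) 1).indicator fun _ => 1 / 2

lemma rescale_uniformDensity {κ : ℝ} (hκ : 0 < κ) :
    rescale κ uniformDensity = (Ioo (-(1 / κ)) (1 / κ)).indicator fun _ => κ / 2 := by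
  ext x
  have : κ * x ∈ Ioo (-1) 1 ↔ x ∈ Ioo (-(1 / κ)) (1 / κ) := by
    rw [mem_Ioo, mem_Ioo, ← neg_div, div_lt_iff₀' hκ, lt_div_iff₀' hκ]
  rw [rescale, uniformDensity]
  by_cases h : x ∈ Ioo (-(1 / κ)) (1 / κ)
  · rw [indicator_of_mem (this.2 h), indicator_of_mem h, mul_one_div]
  · rw [indicator_of_notMem (mt this.1 h), indicator_of_notMem h, mul_zero]

lemma isDensity_rescale_uniformDensity {κ : ℝ} (hκ : 0 < κ) :
    IsDensity (rescale κ uniformDensity) := by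
  rw [rescale_uniformDensity hκ]
  refine ⟨measurable_const.indicator measurableSet_Ioo,
    fun x => indicator_nonneg (fun _ _ => by positivity) x, ?_⟩
  have : (fun x => ENNReal.ofReal ((Ioo (-(1 / κ)) (1 / κ)).indicator (fun _ => κ / 2) x)) =
      (Ioo (-(1 / κ)) (1 / κ)).indicator fun _ => ENNReal.ofReal (κ / 2) :=
    (indicator_comp_of_zero (g := ENNReal.ofReal) ENNReal.ofReal_zero).symm
  rw [this, lintegral_indicator_const measurableSet_Ioo, Real.volume_Ioo,
    ← ENNReal.ofReal_mul (by positivity)]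
  rw [show κ / 2 * (1 / κ - -(1 / κ)) = 1 by field_simp; norm_num, ENNReal.ofReal_one]

lemma setLIntegral_const_of_ae_eq (hf : IsDensity f) {C : ℝ} (hC : 0 < C)
    (h : ∀ᵐ x, 0 < f x → f x = C) (g : ℝ → ℝ) {s : Set ℝ} (hs : MeasurableSet s) :
    ∫⁻ t in s ∩ {t | 0 < f t}, ENNReal.ofReal (g (f t)) =
      ENNReal.ofReal (g C) * volume ({x | f x = C} ∩ s) := by
  have h1 : (s ∩ {t | 0 < f t} : Set ℝ) =ᵐ[volume] ({x | f x = C} ∩ s : Set ℝ) := by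
    filter_upwards [h] with x hx
    refine propext ⟨fun h => ⟨hx h.2, h.1⟩, fun h => ⟨h.2, ?_⟩⟩
    exact hC.trans_eq (show f x = C from h.1).symm
  rw [setLIntegral_congr h1, ← setLIntegral_const]
  exact setLIntegral_congr_fun ((hf.measurable (measurableSet_singleton C)).inter hs)
    fun x hx => by rw [show f x = C from hx.1]

/-- The set `{f = C}` is order connected and carries the mass. Equal masses give equal lengths on
both sides of the origin, and total mass one makes each `1/(2C)`, so `κ = 2C`. -/
theorem ae_eq_rescale_uniformDensity (hf : IsDensity f) (hα : 0 < α) (hβ : 0 < β)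
    (h : eVariationOn (fun x => f x ^ β / β) univ ^ (1 / β) *
      eLpNorm (absCumul α f) ∞ (densityMeasure f) ^ (1 / α) =
        ENNReal.ofReal (2 ^ (1 / β - 1 / α) * β ^ (-(1 / β)))) :
    ∃ κ : ℝ, 0 < κ ∧ f =ᵐ[volume] rescale κ uniformDensity := by
  obtain ⟨C, hC, ha, -, hae, hLR⟩ := exists_of_mul_eq hf hα hβ (hf.ofReal_le_eVariationOn hβ)
    (ae_absCumul_le hf α) h
  have hE := hf.ordConnected_of_eVariationOn hβ hC ha
  have hC1 : ENNReal.ofReal (C ^ (1 - α)) ≠ 0 := by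
    simpa using Real.rpow_pos_of_pos hC _
  rw [rightMass_comp_neg hf.measurable, rightMass,
    setLIntegral_const_of_ae_eq hf hC hae (fun y => y ^ (1 - α)) measurableSet_Iio,
    setLIntegral_const_of_ae_eq hf hC hae (fun y => y ^ (1 - α)) measurableSet_Ioi,
    ENNReal.mul_right_inj hC1 ENNReal.ofReal_ne_top] at hLR
  have htot : ENNReal.ofReal C * volume ({x | f x = C}) = 1 := by
    have h1 := setLIntegral_const_of_ae_eq hf hC hae id MeasurableSet.univ
    rw [inter_univ, univ_inter] at h1
    have h2 := hf.setLIntegral_rpow_mul 1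
    simp only [Real.rpow_one, sub_self, Real.rpow_zero, ENNReal.ofReal_one, mul_one] at h2
    exact h1.symm.trans h2
  have hadd : volume {x | f x = C} =
      volume ({x | f x = C} ∩ Iio 0) + volume ({x | f x = C} ∩ Ioi 0) := by
    rw [← measure_inter_add_sdiff {x | f x = C} (measurableSet_Iic (a := (0 : ℝ))),
      sdiff_eq, compl_Iic]
    congr 1
    exact measure_congr ((ae_eq_refl _).inter Iio_ae_eq_Iic.symm)
  have hhalf : volume ({x | f x = C} ∩ Ioi 0) = ENNReal.ofReal (1 / (2 * C)) := by
    rw [hadd, hLR] at htot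
    generalize volume ({x | f x = C} ∩ Ioi 0) = m at *
    have hm : m ≠ ∞ := by
      rintro rfl
      simp [ENNReal.mul_top, hC] at htot
    rw [← ENNReal.ofReal_toReal hm, ← ENNReal.ofReal_add ENNReal.toReal_nonneg
      ENNReal.toReal_nonneg, ← ENNReal.ofReal_mul hC.le, ENNReal.ofReal_eq_one] at htot
    rw [← ENNReal.ofReal_toReal hm]
    congr 1
    field_simp
    linarith
  have hEr := ae_eq_Icc_of_ordConnected hE (by positivity) (hLR.trans hhalf) hhalf
  refine ⟨2 * C, by positivity, ?_⟩
  rw [rescale_uniformDensity (by positivity), mul_div_cancel_left₀ C two_ne_zero]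
  filter_upwards [hae, hEr.trans Ioo_ae_eq_Icc.symm] with x hx hxE
  have hxE : f x = C ↔ x ∈ Ioo (-(1 / (2 * C))) (1 / (2 * C)) := iff_of_eq hxE
  by_cases hmem : x ∈ Ioo (-(1 / (2 * C))) (1 / (2 * C))
  · rw [indicator_of_mem hmem, hxE.2 hmem]
  · rw [indicator_of_notMem hmem]
    exact le_antisymm (le_of_not_gt fun h => hmem (hxE.1 (hx h))) (hf.nonneg x)

lemma eVariationOn_indicator_Ioo_le {r c : ℝ} (hr : 0 < r) (hc : 0 ≤ c) :
    eVariationOn ((Ioo (-r) r).indicator fun _ => c) univ ≤ ENNReal.ofReal (2 * c) := by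
  set g := (Ioo (-r) r).indicator fun _ : ℝ => c
  have hg0 : ∀ x, 0 ≤ g x := fun x => indicator_nonneg (fun _ _ => hc) x
  have hgc : ∀ x, g x ≤ c := fun x => indicator_le_self' (fun _ _ => hc) x
  have hmono : MonotoneOn g (Iic 0) := fun x hx y hy hxy => by
    have hy : y ≤ 0 := hy
    by_cases h : x ∈ Ioo (-r) r
    · rw [show g y = c from indicator_of_mem (show y ∈ Ioo (-r) r from ⟨by linarith [h.1], by linarith⟩) _]
      exact hgc x
    · rw [show g x = 0 from indicator_of_notMem h _]
      exact hg0 y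
  have hIic : eVariationOn g (Iic 0) ≤ ENNReal.ofReal c := by
    rw [eVariationOn.eq_biSup_inter_Icc]
    refine iSup₂_le fun p hp => ?_
    rw [hmono.eVariationOn_eq hp.1 hp.2.1]
    exact ENNReal.ofReal_le_ofReal (by linarith [hg0 p.1, hgc p.2])
  have heven : (fun x => g (-x)) = g := by
    ext x
    have : -x ∈ Ioo (-r) r ↔ x ∈ Ioo (-r) r := by
      constructor <;> rintro ⟨h1, h2⟩ <;> constructor <;> linarith
    by_cases h : x ∈ Ioo (-r) r
    · rw [show g x = c from indicator_of_mem h _, show g (-x) = c from indicator_of_mem (this.2 h) _]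
    · rw [show g x = 0 from indicator_of_notMem h _,
        show g (-x) = 0 from indicator_of_notMem (mt this.1 h) _]
  have hIci : eVariationOn g (Ici 0) ≤ ENNReal.ofReal c := by
    have := eVariationOn_comp_neg g (Iic 0)
    rw [heven, image_neg_Iic, neg_zero] at this
    rwa [this]
  rw [← Iic_union_Ici (a := (0 : ℝ)), eVariationOn.union g isGreatest_Iic isLeast_Ici, two_mul,
    ENNReal.ofReal_add hc hc]
  exact add_le_add hIic hIci

/-- Upper estimates suffice, since the general inequality supplies the reverse. -/
theorem rescale_uniformDensity_le (hα : 0 < α) (hβ : 0 < β) {κ : ℝ} (hκ : 0 < κ) :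
    eVariationOn (fun x => rescale κ uniformDensity x ^ β / β) univ ^ (1 / β) *
      eLpNorm (absCumul α (rescale κ uniformDensity)) ∞
        (densityMeasure (rescale κ uniformDensity)) ^ (1 / α) ≤
      ENNReal.ofReal (2 ^ (1 / β - 1 / α) * β ^ (-(1 / β))) := by
  have hf := isDensity_rescale_uniformDensity hκ
  have hκ2 : 0 < κ / 2 := by positivity
  have hκα := Real.rpow_pos_of_pos hκ2 α
  rw [rescale_uniformDensity hκ] at hf ⊢
  have hTV : eVariationOn (fun x => ((Ioo (-(1 / κ)) (1 / κ)).indicator (fun _ => κ / 2) x) ^ β / β)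
      univ ≤ ENNReal.ofReal (2 * ((κ / 2) ^ β / β)) := by
    have h0 : (fun x => ((Ioo (-(1 / κ)) (1 / κ)).indicator (fun _ => κ / 2) x) ^ β / β) =
        (Ioo (-(1 / κ)) (1 / κ)).indicator fun _ => (κ / 2) ^ β / β :=
      (indicator_comp_of_zero (g := fun y : ℝ => y ^ β / β)
        (by simp [Real.zero_rpow hβ.ne'])).symm
    rw [h0]
    exact eVariationOn_indicator_Ioo_le (by positivity) (by positivity)
  have hpos : ∀ t, 0 < (Ioo (-(1 / κ)) (1 / κ)).indicator (fun _ => κ / 2) t →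
      t ∈ Ioo (-(1 / κ)) (1 / κ) := fun t ht => by
    by_contra h
    rw [indicator_of_notMem h] at ht
    exact lt_irrefl _ ht
  have hM : eLpNorm (absCumul α ((Ioo (-(1 / κ)) (1 / κ)).indicator fun _ => κ / 2)) ∞
      (densityMeasure ((Ioo (-(1 / κ)) (1 / κ)).indicator fun _ => κ / 2)) ≤
        ENNReal.ofReal ((κ / 2) ^ (1 - α) * (1 / κ)) := by
    rw [eLpNorm_exponent_top]
    refine eLpNormEssSup_le_of_ae_enorm_bound (hf.ae_densityMeasure_iff.2 (ae_of_all _ fun x hx => ?_))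
    have hx := hpos x hx
    rw [enorm_eq_self, absCumul]
    have h1 : ∀ t ∈ uIoc 0 x ∩ {t | 0 < (Ioo (-(1 / κ)) (1 / κ)).indicator (fun _ => κ / 2) t},
        ENNReal.ofReal ((Ioo (-(1 / κ)) (1 / κ)).indicator (fun _ => κ / 2) t ^ (1 - α)) =
          ENNReal.ofReal ((κ / 2) ^ (1 - α)) := fun t ht => by
      rw [indicator_of_mem (hpos t ht.2)]
    rw [setLIntegral_congr_fun (measurableSet_uIoc.inter
      (measurableSet_lt measurable_const hf.measurable)) h1, setLIntegral_const,
      ENNReal.ofReal_mul (by positivity)]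
    gcongr
    refine (measure_mono inter_subset_left).trans ?_
    rw [uIoc, Real.volume_Ioc, max_sub_min_eq_abs, sub_zero]
    exact ENNReal.ofReal_le_ofReal (abs_le.2 ⟨hx.1.le, hx.2.le⟩)
  refine (mul_le_mul' (ENNReal.rpow_le_rpow hTV (by positivity))
    (ENNReal.rpow_le_rpow hM (by positivity))).trans_eq ?_
  rw [mul_rpow_eq_of_sup hα hβ hκ2 ENNReal.ofReal_ne_top]
  have h2 : (2 : ℝ≥0∞) = ENNReal.ofReal 2 := by simp
  rw [h2, ← ENNReal.ofReal_mul zero_le_two, ← ENNReal.ofReal_mul hκα.le,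
    show (κ / 2) ^ α * (2 * ((κ / 2) ^ (1 - α) * (1 / κ))) = 1 by
      rw [Real.rpow_sub hκ2, Real.rpow_one]; field_simp, ENNReal.ofReal_one, ENNReal.one_rpow,
    mul_one]

end BoundedVariation

end CumulativeCR

open MeasureTheory Set
open scoped ENNReal
namespace CumulativeCR
open ProbabilityTheory Filter
open scoped Topology

/-! ### The main theorem -/

section Main

variable {p : ℝ≥0∞} {β lam : ℝ}

lemma toReal_inv_dual : ((dual p)⁻¹).toReal = 1 / (dual p).toReal := by
  rw [ENNReal.toReal_inv, one_div]

lemma exponent_pos (hβ₁ : lam - 1 < β) (hβ₂ : (1 - lam) * ((dual p)⁻¹).toReal < β) : 0 < β := by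
  have h : 0 ≤ ((dual p)⁻¹).toReal := ENNReal.toReal_nonneg
  rcases le_total lam 1 with h1 | h1
  · exact lt_of_le_of_lt (mul_nonneg (by linarith) h) hβ₂
  · linarith

/-- The second hypothesis on `β` is exactly the finite moment condition for `b = β / α`. -/
lemma one_lt_shape (hp : 1 < p) (hβ₁ : lam - 1 < β)
    (hβ₂ : (1 - lam) * ((dual p)⁻¹).toReal < β) :
    1 < β / (1 + β - lam) * ((dual p).toReal + 1) := by
  have hq : 0 < (dual p).toReal := zero_lt_one.trans_le (one_le_toReal_dual hp)
  have hα : 0 < 1 + β - lam := by linarith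
  rw [toReal_inv_dual, mul_one_div, div_lt_iff₀ hq] at hβ₂
  rw [div_mul_eq_mul_div, lt_div_iff₀ hα]
  linarith

lemma bound_eq_rpow_sharpConst (hp : 1 < p) (hβ₁ : lam - 1 < β)
    (hβ₂ : (1 - lam) * ((dual p)⁻¹).toReal < β) :
    bound p β lam = sharpConst (dual p).toReal (β / (1 + β - lam)) (1 + β - lam) ^ (1 / β) := by
  have hq := one_le_toReal_dual hp
  have hb := one_lt_shape hp hβ₁ hβ₂
  have hβ := exponent_pos hβ₁ hβ₂
  rw [bound, if_neg hp.ne']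
  simp only [normConst₃, sharpConst, tailConst]
  set q := (dual p).toReal
  have hα : 0 < 1 + β - lam := by linarith
  set α := 1 + β - lam with hαdef
  have hN := normConst_pos hq hb
  set N := normConst q (β / α)
  have hm : 0 < β / α * q + β / α - 1 := by linarith
  have hmα : q * β + lam - 1 = α * (β / α * q + β / α - 1) := by
    field_simp
    rw [hαdef]; ring
  set m := β / α * q + β / α - 1
  have hb' : 0 < β / α := by positivity
  have hq0 : 0 < q := by linarith
  have e1 : lam - 1 = α * (β / α - 1) := by field_simp; linarith
  have e2 : β + (1 - lam) * (1 - 1 / q) = α * ((β / α + q - 1) / q) := by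
    field_simp
    rw [hαdef]
    ring
  have hNb := Real.rpow_pos_of_pos hN (β / α - 1)
  have hαm := Real.rpow_pos_of_pos (mul_pos hα hm) ((β / α + q - 1) / q)
  have hαb := Real.rpow_pos_of_pos hα ((β / α - 1) / q)
  have e3 : α ^ ((lam - 1) / q) * N ^ (lam - 1) / (α * m) ^ (α * ((β / α + q - 1) / q)) =
      (α ^ ((β / α - 1) / q) * N ^ (β / α - 1) / (α * m) ^ ((β / α + q - 1) / q)) ^ α := by
    rw [Real.div_rpow (by positivity) hαm.le, Real.mul_rpow hαb.le hNb.le, ← Real.rpow_mul hα.le,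
      ← Real.rpow_mul hN.le, ← Real.rpow_mul (by positivity), e1, mul_comm α (β / α - 1),
      mul_comm α ((β / α + q - 1) / q), mul_div_right_comm (β / α - 1) α q]
  rw [hmα, e2, e3, ← Real.rpow_mul (by positivity), show α * (1 / (β * α)) = 1 / β by field_simp,
    ← Real.mul_rpow hq0.le (by positivity)]
  congr 1
  rw [Real.mul_rpow hα.le hm.le, Real.div_rpow zero_le_one hm.le, Real.one_rpow,
    show (β / α + q - 1) / q = (β / α - 1) / q + 1 by field_simp; ring,
    Real.rpow_add_one hα.ne']
  have := Real.rpow_pos_of_pos hm ((β / α - 1) / q + 1)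
  field_simp

lemma mul_rpow_rpow_eq {α : ℝ} (hβ : 0 < β) (a M : ℝ≥0∞) :
    a ^ (1 / β) * M ^ (1 / α) = (a * M ^ (β / α)) ^ (1 / β) := by
  rw [ENNReal.mul_rpow_of_nonneg _ _ (by positivity), ← ENNReal.rpow_mul,
    show β / α * (1 / β) = 1 / α by field_simp]

lemma IsC1Density.differentiableAt {f : ℝ → ℝ} (hf : IsC1Density f) (x : ℝ) (hx : 0 < f x) :
    DifferentiableAt ℝ f x :=
  (hf.contDiffOn.differentiableOn one_ne_zero).differentiableAt
    ((isOpen_lt continuous_const hf.continuous).mem_nhds hx)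

lemma bound_one (hβ : 0 < β) (hα : 0 < 1 + β - lam) :
    bound 1 β lam = 2 ^ (1 / β - 1 / (1 + β - lam)) * β ^ (-(1 / β)) := by
  rw [bound, if_pos rfl, mul_comm]
  congr 2
  field_simp
  ring

lemma one_lt_toReal_dual (hp : 1 < p) (hpt : p < ∞) : 1 < (dual p).toReal := by
  have h : 1 < dual p := by
    rw [dual, ENNReal.one_lt_inv]
    exact ENNReal.sub_lt_self ENNReal.one_ne_top one_ne_zero (ENNReal.inv_ne_zero.2 hpt.ne)
  simpa using (ENNReal.toReal_lt_toReal ENNReal.one_ne_top (dual_ne_top hp)).2 h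

end Main

end CumulativeCR

theorem mainTheorem2 (p : ℝ≥0∞) (hp : 1 ≤ p) (β lam : ℝ)
    (hβ₁ : lam - 1 < β) (hβ₂ : (1 - lam) * ((dual p)⁻¹).toReal < β) :
    -- the inequality
    (∀ f : ℝ → ℝ, IsC1Density f →
      ENNReal.ofReal (bound p β lam) ≤ fisherPhi p β f * cumDev (dual p) (1 + β - lam) f) ∧
    -- the only minimizers are the rescaled copies of `ρ`
    (∀ f : ℝ → ℝ, IsC1Density f →
      fisherPhi p β f * cumDev (dual p) (1 + β - lam) f = ENNReal.ofReal (bound p β lam) →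
      ∃ κ : ℝ, 0 < κ ∧ f = rescale κ (minDensity p β lam)) ∧
    -- `ρ` is a density and, with all its rescaled copies, attains the bound
    IsDensity (minDensity p β lam) ∧
    (1 < p → p < ∞ → IsC1Density (minDensity p β lam)) ∧
    (1 < p → ∀ κ : ℝ, 0 < κ →
      fisherPhi p β (rescale κ (minDensity p β lam)) *
        cumDev (dual p) (1 + β - lam) (rescale κ (minDensity p β lam)) =
          ENNReal.ofReal (bound p β lam)) ∧
    -- for `p = 1`, where `ρ` jumps, the Fisher information is a total variation
    (p = 1 →
      (∀ f : ℝ → ℝ, IsDensity f →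
        ENNReal.ofReal (bound p β lam) ≤ fisherPhiTV β f * cumDev ∞ (1 + β - lam) f) ∧
      (∀ f : ℝ → ℝ, IsDensity f →
        fisherPhiTV β f * cumDev ∞ (1 + β - lam) f = ENNReal.ofReal (bound p β lam) →
        ∃ κ : ℝ, 0 < κ ∧ f =ᵐ[volume] rescale κ (minDensity p β lam)) ∧
      (∀ κ : ℝ, 0 < κ →
        fisherPhiTV β (rescale κ (minDensity p β lam)) *
          cumDev ∞ (1 + β - lam) (rescale κ (minDensity p β lam)) =
            ENNReal.ofReal (bound p β lam))) := by
  have hα : 0 < 1 + β - lam := by linarith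
  have hβ := exponent_pos hβ₁ hβ₂
  -- For `p = 1` the dual exponent is infinite and the reference density `stretchedGaussian` is not
  -- available; the direct argument takes over.
  rcases hp.eq_or_lt with rfl | hp1
  · have hdual : dual 1 = ∞ := by simp [dual]
    have hρ : minDensity 1 β lam = uniformDensity := by rw [minDensity, if_pos rfl, uniformDensity]
    have hle : ∀ f : ℝ → ℝ, IsDensity f →
        ENNReal.ofReal (bound 1 β lam) ≤ fisherPhiTV β f * cumDev ∞ (1 + β - lam) f := fun f hf => by
      rw [bound_one hβ hα]
      exact ofReal_le_mul_of_sup_le hf hα hβ (hf.ofReal_le_eVariationOn hβ) (ae_absCumul_le hf _)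
    rw [hρ, hdual]
    refine ⟨fun f hf => ?_, fun f hf h => ?_, ?_, fun h => absurd h (lt_irrefl _),
      fun h => absurd h (lt_irrefl _), fun _ => ⟨hle, fun f hf h => ?_, fun κ hκ => ?_⟩⟩
    · rw [bound_one hβ hα]
      exact ofReal_le_mul_of_sup_le hf.toIsDensity hα hβ
        (ofReal_le_eLpNorm_score hf.toIsDensity hf.continuous hf.differentiableAt hβ)
        (ae_absCumul_le hf.toIsDensity _)
    · rw [bound_one hβ hα] at h
      obtain ⟨C, hC, -, -, hae, -⟩ := exists_of_mul_eq hf.toIsDensity hα hβ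
        (ofReal_le_eLpNorm_score hf.toIsDensity hf.continuous hf.differentiableAt hβ)
        (ae_absCumul_le hf.toIsDensity _) h
      exact (hf.toIsDensity.not_ae_eq_const hf.continuous hC hae).elim
    · have := isDensity_rescale_uniformDensity one_pos
      rwa [rescale_one] at this
    · rw [bound_one hβ hα] at h
      exact ae_eq_rescale_uniformDensity hf hα hβ h
    · refine le_antisymm ?_ (hle _ (isDensity_rescale_uniformDensity hκ))
      rw [bound_one hβ hα]
      exact rescale_uniformDensity_le hα hβ hκ
  · have hq := one_le_toReal_dual hp1
    have hb := one_lt_shape hp1 hβ₁ hβ₂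
    have hρ := isEscort_minDensity (lam := lam) hp1 hβ hα
    have hβα : (1 + β - lam) * (β / (1 + β - lam)) = β := mul_div_cancel₀ β hα.ne'
    have hβ' : 0 < 1 / β := by positivity
    have hbound : ENNReal.ofReal (bound p β lam) =
        ENNReal.ofReal (sharpConst (dual p).toReal (β / (1 + β - lam)) (1 + β - lam)) ^ (1 / β) := by
      rw [bound_eq_rpow_sharpConst hp1 hβ₁ hβ₂, ENNReal.ofReal_rpow_of_pos (sharpConst_pos hq hb hα)]
    have hprod : ∀ f : ℝ → ℝ, fisherPhi p β f * cumDev (dual p) (1 + β - lam) f =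
        (eLpNorm (fun x => f x ^ ((1 + β - lam) * (β / (1 + β - lam)) - 2) * deriv f x) p
          (densityMeasure f) * eLpNorm (absCumul (1 + β - lam) f) (dual p)
            (densityMeasure f) ^ (β / (1 + β - lam))) ^ (1 / β) := fun f => by
      rw [fisherPhi, cumDev, mul_rpow_rpow_eq hβ, hβα]
    refine ⟨fun f hf => ?_, fun f hf h => ?_, ?_, fun _ hpt => ?_, fun _ κ hκ => ?_,
      fun h => absurd h hp1.ne'⟩
    · rw [hprod, hbound]
      exact ENNReal.rpow_le_rpow (sharpConst_le hp1 rfl hb hα hf.toIsDensity hf.continuous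
        hf.differentiableAt) hβ'.le
    · rw [hprod, hbound] at h
      obtain ⟨k, hk, hae⟩ := ae_eq_of_eq_sharpConst hp1 rfl hb hα hf.toIsDensity hf.continuous
        hf.differentiableAt (ENNReal.rpow_left_injective hβ'.ne' h)
      exact eq_rescale_of_ae_eq hq hb hα hf.toIsDensity hf.continuous hρ hk hae
    · have := hρ.isDensity_rescale hq hb one_pos
      rwa [rescale_one] at this
    · exact hρ.isC1Density (one_lt_toReal_dual hp1 hpt) hb hα
    · rw [hprod, hbound, hρ.eq_sharpConst hp1 rfl hb hα hκ]
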